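/- Fix $s\in\mathbb{C}$ with $\Re s>-1/2$. For $x\in\mathbb{R}$ put \[ \rho(x)=|x|^{\Re s}e^{-\frac{\pi}{2}\Im s\,\mathrm{sign}\,x},\qquad \psi(x)=e^{-\frac{i\pi}{2}\Re s\,\mathrm{sign}\,x}|x|^{-i\Im s},\qquad Z_s(x)=\frac{\Gamma(1+s)}{\Gamma(1+2\Re s)}\,{}_1F_1(\bar s;1+2\Re s;ix), \] where ${}_1F_1(a;b;z)=\sum_{k\ge0}\frac{(a)_k}{(b)_k k!}z^k$. Let $K^s$ be the integral operator on $L_2(\mathbb{R})$ with the confluent hypergeometric kernel \[ K^s(x,y)=\rho(x)\rho(y)\frac{Z_s(x)\overline{Z_s(y)}-e^{i(x-y)}\overline{Z_s(x)}Z_s(y)}{2\pi i(y-x)} \] (extended to $x=y$ by the limit), and let $\mathcal{PW}_s$ be its image. Let $\mathcal{T}_s$ be the unitary operator on $L_2(\mathbb{R})$ that extends the integral transform \[ f\mapsto\Big(\omega\mapsto\int_{\mathbb{R}}\mathcal{T}_s(\omega x)f(x)\,dx\Big),\qquad \mathcal{T}_s(x)=\frac{e^{-ix}}{\sqrt{2\pi}}\rho(x)\overline{\psi(x)}Z_s(x),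 \] from $L_1(\mathbb{R})\cap L_\infty(\mathbb{R})$ (both operators are well defined), and let $\psi^*$ be the operator of multiplication by $\overline{\psi}$. For $n\ge0$ let \[ H^{(s,n)}=\{f\in\mathcal{PW}_s: f=\rho h_f \text{ a.e. on } \mathbb{R},\ h_f \text{ entire},\ h_f(z)=O(z^n)\text{ as } z\to0\}, \] and let $L^{(s,n)}$ be the orthogonal complement of $H^{(s,n+1)}$ in $H^{(s,n)}$. Regard $L_2[0,1]$ as the subspace of $L_2(\mathbb{R})$ of functions vanishing off $[0,1]$. Then the following hold. \begin{itemize} \item Every $f\in\mathcal{PW}_s$ is $\rho$ times (the restriction to $\mathbb{R}$ of) an entire function; in particular $\mathcal{PW}_s=H^{(s,0)}$. \item For every $n\ge0$, put $F^{(s,n)}=\mathbb{I}_{[0,1]}(t)\,t^{s}\,\mathrm{span}_{\mathbb{C}}\langle 1,t,\dots,t^{n-1}\rangle\subset L_2[0,1]$. Then $H^{(s,n)}$ is the image under $\psi^*\mathcal{T}_s^*$ of $(F^{(s,n)})^{\perp}\cap L_2[0,1]$. \item Consequently, every $L^{(s,n)}$, $n\ge0$, is one-dimensional, and if $\{P_n^{(\Re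 s)}\}_{n\ge0}$, $\deg P_n^{(\Re s)}=n$, are (Jacobi) real orthogonal polynomials with respect to the weight $t^{2\Re s}$ on $[0,1]$, then $L^{(s,n)}$ is spanned by $\psi^*\mathcal{T}_s^*\big(\mathbb{I}_{[0,1]}(t)\,t^{s}P_n^{(\Re s)}(t)\big)$. \end{itemize} -/

import Mathlib

open MeasureTheory Set Filter Topology Polynomial
open scoped ENNReal InnerProductSpace ComplexConjugate

noncomputable section

namespace ConfluentPW

/-- The complex Hilbert space `L₂(ℝ)` (Lebesgue measure). -/
abbrev L2 : Type := Lp ℂ 2 (volume : Measure ℝ)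

/-- Kummer's confluent hypergeometric function `₁F₁(a; b; z) = ∑ₖ (a)ₖ zᵏ / ((b)ₖ k!)`. -/
def oneFOne (a b z : ℂ) : ℂ :=
  ∑' k : ℕ, (ascPochhammer ℂ k).eval a / ((ascPochhammer ℂ k).eval b * (k.factorial : ℂ)) * z ^ k

/-- `ρ(x) = |x|^{Re s} exp(-(π/2) Im s sign x)`. -/
def rho (s : ℂ) (x : ℝ) : ℝ :=
  |x| ^ s.re * Real.exp (-(Real.pi / 2) * s.im * Real.sign x)

/-- `Z_s(x) = Γ(1+s) / Γ(1+2 Re s) · ₁F₁(s̄; 1+2 Re s; i x)`. -/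
def Z (s : ℂ) (x : ℝ) : ℂ :=
  Complex.Gamma (1 + s) / Complex.Gamma (1 + 2 * (s.re : ℂ)) *
    oneFOne (conj s) (1 + 2 * (s.re : ℂ)) (Complex.I * (x : ℂ))

/-- `ψ(x) = exp(-(iπ/2) Re s sign x) |x|^{-i Im s}`. -/
def psi (s : ℂ) (x : ℝ) : ℂ :=
  Complex.exp (-(Complex.I * (Real.pi : ℂ) / 2) * (s.re : ℂ) * (Real.sign x : ℂ)) *
    ((|x| : ℝ) : ℂ) ^ (-(Complex.I * (s.im : ℂ)))

/-- The off-diagonal formula for the confluent hypergeometric kernel. -/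
def kernelFormula (s : ℂ) (x y : ℝ) : ℂ :=
  (rho s x : ℂ) * (rho s y : ℂ) *
    (Z s x * conj (Z s y) -
      Complex.exp (Complex.I * ((x : ℂ) - (y : ℂ))) * conj (Z s x) * Z s y) /
    (2 * (Real.pi : ℂ) * Complex.I * ((y : ℂ) - (x : ℂ)))

open scoped Classical in
/-- The confluent hypergeometric kernel `K^s(x, y)`; on the diagonal it is the limit of the
off-diagonal values. -/
def kernel (s : ℂ) (x y : ℝ) : ℂ :=
  if x = y then limUnder (𝓝[≠] x) (fun u => kernelFormula s x u) else kernelFormula s x y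

/-- The generalized exponential `𝒯_s(x) = e^{-ix} / √(2π) · ρ(x) · conj ψ(x) · Z_s(x)`. -/
def genExp (s : ℂ) (x : ℝ) : ℂ :=
  Complex.exp (-(Complex.I * (x : ℂ))) / (Real.sqrt (2 * Real.pi) : ℂ) *
    (rho s x : ℂ) * conj (psi s x) * Z s x

/-- The bounded operator `A` on `L₂(ℝ)` is the integral operator with kernel `k`: for every
`f ∈ L₂(ℝ)` and almost every `x` the integral `∫ k(x, y) f(y) dy` converges absolutely and equals
`(A f)(x)`. -/
def IsIntegralOperator (k : ℝ → ℝ → ℂ) (A : L2 →L[ℂ] L2) : Prop :=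
  ∀ f : L2, ∀ᵐ x : ℝ, Integrable (fun y : ℝ => k x y * f y) ∧ A f x = ∫ y : ℝ, k x y * f y

/-- The bounded operator `T` on `L₂(ℝ)` extends the integral transform
`f ↦ (ω ↦ ∫ 𝒯_s(ω x) f(x) dx)` from the dense subspace `L₁(ℝ) ∩ L_∞(ℝ)`. -/
def ExtendsTransform (s : ℂ) (T : L2 →L[ℂ] L2) : Prop :=
  ∀ f : L2, Integrable f → MemLp f ∞ →
    ∀ᵐ w : ℝ, T f w = ∫ x : ℝ, genExp s (w * x) * f x

/-- The extension of the transform to a bounded operator on `L₂(ℝ)` is unique. -/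
theorem ExtendsTransform.unique {s : ℂ} {T T' : L2 →L[ℂ] L2} (h : ExtendsTransform s T)
    (h' : ExtendsTransform s T') : T = T' := by
  have hd : DenseRange ((↑) : Lp.simpleFunc ℂ 2 (volume : Measure ℝ) → L2) :=
    Lp.simpleFunc.denseRange (by norm_num)
  refine ContinuousLinearMap.coeFn_injective (hd.equalizer T.continuous T'.continuous ?_)
  funext g
  have hg := Lp.simpleFunc.toSimpleFunc_eq_toFun g
  have hL2 : MemLp (Lp.simpleFunc.toSimpleFunc g) 2 (volume : Measure ℝ) :=
    Lp.simpleFunc.memLp g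
  have hi : Integrable ((g : L2) : ℝ → ℂ) :=
    ((SimpleFunc.memLp_iff_integrable (by norm_num) (by norm_num)).1 hL2).congr hg
  have ht : MemLp ((g : L2) : ℝ → ℂ) ∞ :=
    (memLp_congr_ae hg).1 (SimpleFunc.memLp_top _ _)
  ext1
  filter_upwards [h g hi ht, h' g hi ht] with x h1 h2
  exact h1.trans h2.symm

theorem IsIntegralOperator.unique {k : ℝ → ℝ → ℂ} {T T' : L2 →L[ℂ] L2}
    (h : IsIntegralOperator k T) (h' : IsIntegralOperator k T') : T = T' := by
  ext1 f
  ext1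
  filter_upwards [h f, h' f] with x h1 h2
  exact h1.2.trans h2.2.symm

theorem norm_psi_le (s : ℂ) (x : ℝ) : ‖psi s x‖ ≤ 1 := by
  have h1 : ‖Complex.exp (-(Complex.I * (Real.pi : ℂ) / 2) * (s.re : ℂ) *
      (Real.sign x : ℂ))‖ = 1 := by
    rw [Complex.norm_exp]; simp
  rw [psi, norm_mul, h1, one_mul]
  rcases eq_or_ne x 0 with rfl | hx
  · by_cases h : -(Complex.I * (s.im : ℂ)) = 0
    · rw [h]; simp
    · rw [abs_zero, Complex.ofReal_zero, Complex.zero_cpow h]; simp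
  · rw [Complex.norm_cpow_eq_rpow_re_of_pos (abs_pos.mpr hx)]; simp

theorem measurable_psi (s : ℂ) : Measurable (psi s) := by
  have hs : Measurable Real.sign := by
    unfold Real.sign
    exact Measurable.ite measurableSet_Iio measurable_const
      (Measurable.ite measurableSet_Ioi measurable_const measurable_const)
  unfold psi
  fun_prop

theorem memLp_conj_psi_mul (s : ℂ) (f : L2) :
    MemLp (fun x => conj (psi s x) * f x) 2 (volume : Measure ℝ) := by
  refine (Lp.memLp f).of_le ?_ (ae_of_all _ fun x => ?_)
  · exact (Complex.continuous_conj.measurable.comp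
      (measurable_psi s)).aestronglyMeasurable.mul (Lp.aestronglyMeasurable f)
  · rw [norm_mul, RCLike.norm_conj]
    exact mul_le_of_le_one_left (norm_nonneg _) (norm_psi_le s x)

/-- The operator `ψ^*` on `L₂(ℝ)`: pointwise multiplication by `conj ψ`. -/
def psiStar (s : ℂ) : L2 →ₗ[ℂ] L2 where
  toFun f := (memLp_conj_psi_mul s f).toLp _
  map_add' f g := by
    ext1
    filter_upwards [(memLp_conj_psi_mul s (f + g)).coeFn_toLp,
      (memLp_conj_psi_mul s f).coeFn_toLp, (memLp_conj_psi_mul s g).coeFn_toLp,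
      Lp.coeFn_add f g,
      Lp.coeFn_add ((memLp_conj_psi_mul s f).toLp _) ((memLp_conj_psi_mul s g).toLp _)]
      with x h1 h2 h3 h4 h5
    rw [h1, h5, Pi.add_apply, h2, h3, h4, Pi.add_apply, mul_add]
  map_smul' c f := by
    ext1
    filter_upwards [(memLp_conj_psi_mul s (c • f)).coeFn_toLp,
      (memLp_conj_psi_mul s f).coeFn_toLp, Lp.coeFn_smul c f,
      Lp.coeFn_smul c ((memLp_conj_psi_mul s f).toLp _)] with x h1 h2 h3 h4
    rw [h1, RingHom.id_apply, h4, Pi.smul_apply, h2, h3, Pi.smul_apply, smul_eq_mul, smul_eq_mul,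
      mul_left_comm]

/-- `L₂[0, 1]` as the subspace of `L₂(ℝ)` of functions vanishing almost everywhere off `[0, 1]`. -/
def L2Unit : Submodule ℂ L2 where
  carrier := {g | ∀ᵐ t : ℝ, t ∉ Icc (0 : ℝ) 1 → g t = 0}
  zero_mem' := by
    filter_upwards [Lp.coeFn_zero ℂ 2 (volume : Measure ℝ)] with t ht _
    rw [ht, Pi.zero_apply]
  add_mem' {f g} hf hg := by
    filter_upwards [hf, hg, Lp.coeFn_add f g] with t h1 h2 h3 ht
    rw [h3, Pi.add_apply, h1 ht, h2 ht, add_zero]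
  smul_mem' c f hf := by
    filter_upwards [hf, Lp.coeFn_smul c f] with t h1 h2 ht
    rw [h2, Pi.smul_apply, h1 ht, smul_zero]

/-- The function `𝕀_{[0,1]}(t) tˢ p(t)`. -/
def weighted (s : ℂ) (p : ℂ[X]) : ℝ → ℂ :=
  indicator (Icc (0 : ℝ) 1) (fun t => (t : ℂ) ^ s * p.eval (t : ℂ))

theorem memLp_weighted {s : ℂ} (hs : -(1 / 2 : ℝ) < s.re) (p : ℂ[X]) :
    MemLp (weighted s p) 2 (volume : Measure ℝ) := by
  have hmeas : Measurable (fun t : ℝ => (t : ℂ) ^ s * p.eval (t : ℂ)) := by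
    have : Measurable (fun t : ℝ => p.eval (t : ℂ)) :=
      (p.continuous.comp Complex.continuous_ofReal).measurable
    fun_prop
  rw [weighted, memLp_indicator_iff_restrict measurableSet_Icc,
    memLp_two_iff_integrable_sq_norm hmeas.aestronglyMeasurable,
    Measure.restrict_congr_set Ioc_ae_eq_Icc.symm]
  have h1 : IntegrableOn (fun t : ℝ => t ^ (2 * s.re)) (Ioc 0 1) :=
    (intervalIntegrable_iff_integrableOn_Ioc_of_le zero_le_one).1
      (intervalIntegral.intervalIntegrable_rpow' (by linarith))
  obtain ⟨C, hC⟩ := (isCompact_Icc (a := (0 : ℝ)) (b := 1)).exists_bound_of_continuousOn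
    (f := fun t : ℝ => p.eval (t : ℂ)) (p.continuous.comp Complex.continuous_ofReal).continuousOn
  refine Integrable.mono' (h1.mul_const (C ^ 2))
    (hmeas.norm.pow_const 2).aestronglyMeasurable ?_
  refine (ae_restrict_iff' measurableSet_Ioc).2 (ae_of_all _ fun t ht => ?_)
  rw [norm_mul, Complex.norm_cpow_eq_rpow_re_of_pos ht.1, Real.norm_of_nonneg (by positivity),
    mul_pow, ← Real.rpow_natCast (t ^ s.re), ← Real.rpow_mul ht.1.le,
    show s.re * ((2 : ℕ) : ℝ) = 2 * s.re by push_cast; ring]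
  have := hC t (Ioc_subset_Icc_self ht)
  have ht0 := Real.rpow_nonneg ht.1.le (2 * s.re)
  gcongr

/-- `𝕀_{[0,1]}(t) tˢ p(t)` as an element of `L₂(ℝ)`. -/
def weightedL2 {s : ℂ} (hs : -(1 / 2 : ℝ) < s.re) (p : ℂ[X]) : L2 :=
  (memLp_weighted hs p).toLp _

/-- `F^{(s,n)} = 𝕀_{[0,1]} tˢ span ⟨1, t, …, t^{n-1}⟩`. -/
def F {s : ℂ} (hs : -(1 / 2 : ℝ) < s.re) (n : ℕ) : Submodule ℂ L2 :=
  Submodule.span ℂ (range fun k : Fin n => weightedL2 hs (X ^ (k : ℕ)))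

/-- For a subspace `W` of `L₂(ℝ)`, the subspace of those `f ∈ W` of the form `f(x) = ρ(x) h(x)`
with `h` entire and `h(z) = O(zⁿ)` as `z → 0`. With `W = 𝒫𝒲_s` this is `H^{(s,n)}`. -/
def H (s : ℂ) (W : Submodule ℂ L2) (n : ℕ) : Submodule ℂ L2 where
  carrier := {f | f ∈ W ∧ ∃ h : ℂ → ℂ, Differentiable ℂ h ∧
    (∀ᵐ x : ℝ, f x = (rho s x : ℂ) * h (x : ℂ)) ∧ h =O[𝓝 0] (fun z : ℂ => z ^ n)}
  zero_mem' := by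
    refine ⟨W.zero_mem, fun _ => 0, differentiable_const 0, ?_, Asymptotics.isBigO_zero _ _⟩
    filter_upwards [Lp.coeFn_zero ℂ 2 (volume : Measure ℝ)] with x hx
    rw [hx, Pi.zero_apply, mul_zero]
  add_mem' := by
    rintro f g ⟨hf, h, hd, he, ho⟩ ⟨hg, h', hd', he', ho'⟩
    refine ⟨W.add_mem hf hg, fun z => h z + h' z, hd.add hd', ?_, ho.add ho'⟩
    filter_upwards [he, he', Lp.coeFn_add f g] with x h1 h2 h3
    rw [h3, Pi.add_apply, h1, h2, mul_add]
  smul_mem' := by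
    rintro c f ⟨hf, h, hd, he, ho⟩
    refine ⟨W.smul_mem c hf, fun z => c * h z, hd.const_mul c, ?_, ho.const_mul_left c⟩
    filter_upwards [he, Lp.coeFn_smul c f] with x h1 h2
    rw [h2, Pi.smul_apply, h1, smul_eq_mul, mul_left_comm]

/-- The orthogonal complement of `H s W (n+1)` in `H s W n`. With `W = 𝒫𝒲_s` this is
`L^{(s,n)}`. -/
def L (s : ℂ) (W : Submodule ℂ L2) (n : ℕ) : Submodule ℂ L2 :=
  H s W n ⊓ (H s W (n + 1))ᗮ

/-- `P` is a sequence of orthogonal polynomials with respect to the weight `t^a` on `[0, 1]`: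
`P n` has degree exactly `n` and distinct members are orthogonal. -/
def IsOrthogonalPolynomials (a : ℝ) (P : ℕ → ℝ[X]) : Prop :=
  (∀ n, (P n).degree = n) ∧
    ∀ m n, m ≠ n → ∫ t in (0 : ℝ)..1, t ^ a * ((P m).eval t * (P n).eval t) = 0

end ConfluentPW

end

/-! Write U for `unitaryMap`, the operator ψ* 𝒯_s*. Everything reduces to one formula: for g in
L₂[0,1], (U g)(x) = ρ(x) h(x), where h(z) = ∫₀¹ t^{s̄} E(tz) g(t) dt / √(2π) and E is the entire
function e^{iz} conj Z_s(z̄). By Kummer's transformation E is a multiple of ₁F₁(1+s̄; 1+2 Re s; iz).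
The outer conj ψ removes the phase of (ix)^s, which is why h is entire (`unitaryMap_ae_eq`).

All Taylor coefficients of E are nonzero because Re (1+s̄) > 0. The k-th coefficient of h is
therefore a nonzero constant times ⟪t^s t^k, g⟫, and h = O(zⁿ) means exactly that g is orthogonal to
F^{(s,n)} (`mem_H_range_iff`). The description of L^{(s,n)} is then Gram–Schmidt for polynomials
with weight t^{2 Re s}, transported by the unitary U.

Two facts about the operators remain. First, 𝒯_s is unitary. It is built on the dilates of 1_{x>0}
x^{s̄} e^{-x}, whose span is dense by uniqueness of the Laplace transform. Their images are explicit
Laplace transforms of Kummer's function, and the substitution w = -1/(2πξ) turns these into Fourier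
transforms, so Plancherel matches the Gram matrices. Since the kernel depends only on ωx, 𝒯_s is
symmetric for the bilinear pairing; hence its adjoint is its complex conjugate, again an isometry.

Second, K^s = U P U⁻¹ with P the projection onto L₂[0,1]. Off the diagonal K^s(x,y) is ρ(x)ρ(y)
times the inner product of the vectors representing evaluation at x and y. This is a
Christoffel–Darboux identity, obtained by integrating a derivative along the ray t ↦ (tx, ty)
(`kernel_eq_inner`). Hence 𝒫𝒲_s = U(L₂[0,1]). -/

noncomputable section

namespace ConfluentPW

/-! ### Kummer's function: convergence, contiguity and Kummer's transformation. -/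

section Kummer

/-- The Taylor coefficients of Kummer's function. -/
def kummerCoeff (a b : ℂ) (k : ℕ) : ℂ :=
  (ascPochhammer ℂ k).eval a / ((ascPochhammer ℂ k).eval b * (k.factorial : ℂ))

theorem ascPochhammer_eval_ne_zero {b : ℂ} (hb : 0 < b.re) (k : ℕ) :
    (ascPochhammer ℂ k).eval b ≠ 0 := by
  induction k with
  | zero => simp
  | succ k ih =>
    rw [ascPochhammer_succ_eval]
    refine mul_ne_zero ih fun h => ?_
    have := congrArg Complex.re h
    simp at this
    linarith [(Nat.cast_nonneg k : (0 : ℝ) ≤ k)]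

theorem kummerCoeff_ne_zero {a b : ℂ} (ha : 0 < a.re) (hb : 0 < b.re) (k : ℕ) :
    kummerCoeff a b k ≠ 0 :=
  div_ne_zero (ascPochhammer_eval_ne_zero ha k)
    (mul_ne_zero (ascPochhammer_eval_ne_zero hb k) (Nat.cast_ne_zero.2 k.factorial_ne_zero))

/-- Factor by factor: |a + k| ≤ |a| + k ≤ max(1, |a|/b) (b + k). -/
theorem norm_ascPochhammer_le (a : ℂ) {b : ℝ} (hb : 0 < b) (k : ℕ) :
    ‖(ascPochhammer ℂ k).eval a‖ ≤
      (max 1 (‖a‖ / b)) ^ k * ‖(ascPochhammer ℂ k).eval (b : ℂ)‖ := by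
  induction k with
  | zero => simp
  | succ k ih =>
    rw [ascPochhammer_succ_eval, ascPochhammer_succ_eval, norm_mul, norm_mul, pow_succ]
    have h1 : ‖a + k‖ ≤ max 1 (‖a‖ / b) * ‖(b : ℂ) + k‖ := by
      have h2 : ‖(b : ℂ) + k‖ = b + k := by
        rw [← Complex.ofReal_natCast, ← Complex.ofReal_add, Complex.norm_real,
          Real.norm_of_nonneg (by positivity)]
      have h3 : ‖a‖ ≤ max 1 (‖a‖ / b) * b := by
        rw [← div_le_iff₀ hb]; exact le_max_right _ _
      have h4 : (k : ℝ) ≤ max 1 (‖a‖ / b) * k :=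
        le_mul_of_one_le_left (Nat.cast_nonneg k) (le_max_left _ _)
      calc ‖a + k‖ ≤ ‖a‖ + ‖(k : ℂ)‖ := norm_add_le _ _
        _ = ‖a‖ + k := by simp
        _ ≤ _ := by rw [h2, mul_add]; gcongr
    calc _ ≤ (max 1 (‖a‖ / b) ^ k * ‖(ascPochhammer ℂ k).eval (b : ℂ)‖) *
          (max 1 (‖a‖ / b) * ‖(b : ℂ) + k‖) := by gcongr
      _ = _ := by ring

/-- The Pochhammer quotient grows at most geometrically, so the factorial survives. Bounds of the
form A rᵏ/k! control every power series below. -/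
theorem norm_kummerCoeff_le (a : ℂ) {b : ℝ} (hb : 0 < b) (k : ℕ) :
    ‖kummerCoeff a b k‖ ≤ (max 1 (‖a‖ / b)) ^ k / k.factorial := by
  have h0 : 0 < ‖(ascPochhammer ℂ k).eval (b : ℂ)‖ :=
    norm_pos_iff.2 (ascPochhammer_eval_ne_zero (by simpa using hb) k)
  have h1 : (0 : ℝ) < k.factorial := by positivity
  rw [kummerCoeff, norm_div, norm_mul, Complex.norm_natCast, div_le_div_iff₀ (by positivity) h1]
  calc _ ≤ ((max 1 (‖a‖ / b)) ^ k * ‖(ascPochhammer ℂ k).eval (b : ℂ)‖) * k.factorial := by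
        gcongr; exact norm_ascPochhammer_le a hb k
    _ = _ := by ring

/-- An exponentially bounded power series converges everywhere, absolutely. -/
theorem summable_norm_of_exp_bound {c : ℕ → ℂ} {A r : ℝ}
    (hc : ∀ k, ‖c k‖ ≤ A * (r ^ k / k.factorial)) (z : ℂ) :
    Summable fun k => ‖c k * z ^ k‖ := by
  refine Summable.of_nonneg_of_le (fun k => norm_nonneg _) (fun k => ?_)
    ((Real.summable_pow_div_factorial (r * ‖z‖)).mul_left A)
  rw [norm_mul, norm_pow, mul_pow, mul_div_right_comm, ← mul_assoc]
  exact mul_le_mul_of_nonneg_right (hc k) (by positivity)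

theorem hasDerivAt_tsum_of_exp_bound {c : ℕ → ℂ} {A r : ℝ} (hr : 0 ≤ r)
    (hc : ∀ k, ‖c k‖ ≤ A * (r ^ k / k.factorial)) (z : ℂ) :
    HasDerivAt (fun w => ∑' k, c k * w ^ k) (∑' k : ℕ, (k : ℂ) * c k * z ^ (k - 1)) z := by
  have hA : 0 ≤ A := by simpa using (norm_nonneg _).trans (hc 0)
  set R := ‖z‖ + 1
  have hR : 0 < R := by positivity
  have hu : Summable fun k : ℕ => A * (k * (r ^ k / k.factorial) * R ^ (k - 1)) := by
    -- The term k = 0 vanishes; after the shift, k + 1 cancels in (k+1)! and r (rR)ᵏ/k! remains.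
    refine Summable.mul_left A ((summable_nat_add_iff 1).1 ?_)
    refine ((Real.summable_pow_div_factorial (r * R)).mul_left r).congr fun k => ?_
    rw [Nat.factorial_succ, Nat.add_sub_cancel]
    push_cast
    have : (k.factorial : ℝ) ≠ 0 := by positivity
    field_simp
    ring_nf
  refine hasDerivAt_tsum_of_isPreconnected (g := fun (k : ℕ) (w : ℂ) => c k * w ^ k)
    (g' := fun (k : ℕ) (w : ℂ) => (k : ℂ) * c k * w ^ (k - 1)) (t := Metric.ball 0 R) (y₀ := 0) hu Metric.isOpen_ball
    (convex_ball (0 : ℂ) R).isPreconnected (fun k w _ => ?_) (fun k w hw => ?_) (by simpa using hR)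
    ((summable_norm_of_exp_bound hc 0).of_norm) (by simp [R])
  · exact ((hasDerivAt_pow k w).const_mul (c k)).congr_deriv (mul_left_comm _ _ _ |>.trans (mul_assoc _ _ _).symm)
  · rw [norm_mul, norm_mul, norm_pow, Complex.norm_natCast]
    have hw' : ‖w‖ ≤ R := by simpa using (mem_ball_zero_iff.1 hw).le
    calc (k : ℝ) * ‖c k‖ * ‖w‖ ^ (k - 1) ≤ k * (A * (r ^ k / k.factorial)) * R ^ (k - 1) := by
          gcongr; exact hc k
      _ = _ := by ring

variable {a : ℂ} {b : ℝ}

theorem summable_norm_kummer (a : ℂ) (hb : 0 < b) (z : ℂ) :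
    Summable fun k => ‖kummerCoeff a b k * z ^ k‖ :=
  summable_norm_of_exp_bound (A := 1) (fun k => by simpa using norm_kummerCoeff_le a hb k) z

theorem hasDerivAt_oneFOne (a : ℂ) (hb : 0 < b) (z : ℂ) :
    HasDerivAt (oneFOne a b) (∑' k : ℕ, (k : ℂ) * kummerCoeff a b k * z ^ (k - 1)) z :=
  hasDerivAt_tsum_of_exp_bound (c := kummerCoeff a b) (A := 1) (r := max 1 (‖a‖ / b))
    (by positivity) (fun k => by simpa using norm_kummerCoeff_le a hb k) z

theorem differentiable_oneFOne (a : ℂ) (hb : 0 < b) : Differentiable ℂ (oneFOne a b) :=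
  fun z => (hasDerivAt_oneFOne a hb z).differentiableAt

/-- Both sides are (a)_{k+1}, split off at its first or its last factor. -/
theorem ascPochhammer_eval_add_one_mul (a : ℂ) (k : ℕ) :
    a * (ascPochhammer ℂ k).eval (a + 1) = (a + k) * (ascPochhammer ℂ k).eval a := by
  have h1 := ascPochhammer_succ_eval k a
  have h2 : (ascPochhammer ℂ (k + 1)).eval a = a * (ascPochhammer ℂ k).eval (a + 1) := by
    rw [ascPochhammer_succ_left]; simp
  rw [← h2, h1, mul_comm]

/-- The contiguity relation `z M'(z) = a (M(a + 1; b; z) - M(a; b; z))`. -/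
theorem mul_deriv_oneFOne (a : ℂ) (hb : 0 < b) (z : ℂ) :
    z * deriv (oneFOne a b) z = a * (oneFOne (a + 1) b z - oneFOne a b z) := by
  have hs := (summable_norm_kummer a hb z).of_norm
  have hs1 := (summable_norm_kummer (a + 1) hb z).of_norm
  rw [(hasDerivAt_oneFOne a hb z).deriv, ← tsum_mul_left]
  change _ = a * ((∑' k, kummerCoeff (a + 1) b k * z ^ k) - ∑' k, kummerCoeff a b k * z ^ k)
  rw [← hs1.tsum_sub hs, ← tsum_mul_left]
  refine tsum_congr fun k => ?_
  have h := ascPochhammer_eval_add_one_mul a k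
  have h2 : a * kummerCoeff (a + 1) b k = (a + k) * kummerCoeff a b k := by
    rw [kummerCoeff, kummerCoeff, ← mul_div_assoc, h, mul_div_assoc]
  have h3 : z * (k * kummerCoeff a b k * z ^ (k - 1)) = k * kummerCoeff a b k * z ^ k := by
    cases k with
    | zero => simp
    | succ k => rw [Nat.add_sub_cancel, pow_succ]; ring
  rw [h3]
  linear_combination -(z ^ k) * h2

theorem descPochhammer_smeval_eq_ascPochhammer_eval (r : ℂ) (n : ℕ) :
    (descPochhammer ℤ n).smeval r = (ascPochhammer ℂ n).eval (r - n + 1) := by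
  rw [Polynomial.descPochhammer_smeval_eq_ascPochhammer, Polynomial.ascPochhammer_smeval_cast,
    Polynomial.ascPochhammer_smeval_eq_eval]

/-- A form of the Chu–Vandermonde identity. -/
theorem kummerCoeff_sum_antidiagonal (a : ℂ) {b : ℂ} (hb : 0 < b.re) (n : ℕ) :
    kummerCoeff a b n = ∑ p ∈ Finset.HasAntidiagonal.antidiagonal n,
      (kummerCoeff (b - a) b p.1 * (-1) ^ p.1) * ((p.2.factorial : ℂ)⁻¹) := by
  -- Vandermonde for falling factorials: the two arguments add up to a + n - 1, whose falling
  -- factorial of length n is (a)_n. The first argument contributes (-1)ⁱ (b - a)_i, the second (b +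
  -- i)_j.
  have hv := Ring.descPochhammer_smeval_add n (show Commute (a - b) (b + n - 1) from mul_comm _ _)
  rw [descPochhammer_smeval_eq_ascPochhammer_eval,
    show a - b + (b + n - 1) - n + 1 = a by ring] at hv
  rw [kummerCoeff, hv, Finset.sum_div]
  refine Finset.sum_congr rfl fun p hp => ?_
  obtain ⟨i, j⟩ := p
  have hij : i + j = n := by simpa using hp
  subst hij
  simp only
  have h1 : (descPochhammer ℤ i).smeval (a - b) = (-1) ^ i * (ascPochhammer ℂ i).eval (b - a) := by
    have := ascPochhammer_eval_neg_eq_descPochhammer ℂ (a - b) i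
    rw [neg_sub] at this
    rw [this, ← mul_assoc, ← mul_pow, neg_one_mul, neg_neg, one_pow, one_mul,
      descPochhammer_smeval_eq_ascPochhammer_eval, descPochhammer_eval_eq_ascPochhammer]
  have h2 : (descPochhammer ℤ j).smeval (b + (i + j : ℕ) - 1) =
      (ascPochhammer ℂ j).eval (b + i) := by
    rw [descPochhammer_smeval_eq_ascPochhammer_eval]; congr 1; push_cast; ring
  have h3 : (ascPochhammer ℂ (i + j)).eval b =
      (ascPochhammer ℂ i).eval b * (ascPochhammer ℂ j).eval (b + i) := by
    rw [← ascPochhammer_mul]; simp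
  have hne := ascPochhammer_eval_ne_zero hb (i + j)
  rw [h3] at hne
  have hne1 := left_ne_zero_of_mul hne
  have hne2 := right_ne_zero_of_mul hne
  rw [h1, h2, h3, kummerCoeff, Nat.cast_add_choose]
  have hi : (i.factorial : ℂ) ≠ 0 := Nat.cast_ne_zero.2 i.factorial_ne_zero
  have hj : (j.factorial : ℂ) ≠ 0 := Nat.cast_ne_zero.2 j.factorial_ne_zero
  have hk : ((i + j).factorial : ℂ) ≠ 0 := Nat.cast_ne_zero.2 (i + j).factorial_ne_zero
  field_simp

/-- Kummer's transformation. -/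
theorem exp_mul_oneFOne (a : ℂ) (hb : 0 < b) (z : ℂ) :
    Complex.exp z * oneFOne (b - a) b (-z) = oneFOne a b z := by
  have h1 := summable_norm_kummer (b - a) hb (-z)
  have h2 : Summable fun k : ℕ => ‖z ^ k / (k.factorial : ℂ)‖ :=
    NormedSpace.norm_expSeries_div_summable z
  have he : Complex.exp z = ∑' k : ℕ, z ^ k / (k.factorial : ℂ) := by
    rw [Complex.exp_eq_exp_ℂ, NormedSpace.exp_eq_tsum_div]
  change _ * (∑' k, kummerCoeff (b - a) b k * (-z) ^ k) = ∑' k, kummerCoeff a b k * z ^ k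
  rw [he, mul_comm, tsum_mul_tsum_eq_tsum_sum_antidiagonal_of_summable_norm h1 h2]
  refine tsum_congr fun n => ?_
  rw [kummerCoeff_sum_antidiagonal a (by simpa using hb) n, Finset.sum_mul]
  refine Finset.sum_congr rfl fun p hp => ?_
  have hij : p.1 + p.2 = n := by simpa using hp
  rw [← hij, neg_pow z, pow_add]
  ring

theorem conj_oneFOne (a : ℂ) (b : ℝ) (z : ℂ) :
    conj (oneFOne a b z) = oneFOne (conj a) b (conj z) := by
  rw [oneFOne, Complex.conj_tsum]
  refine tsum_congr fun k => ?_
  have h : ∀ c : ℂ, conj ((ascPochhammer ℂ k).eval c) = (ascPochhammer ℂ k).eval (conj c) := by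
    intro c
    induction k with
    | zero => simp
    | succ k ih => simp [ascPochhammer_succ_eval, ih]
  simp [h]

end Kummer

/-! ### The function Z_s: first-order relation and growth. -/

section ZFunction

variable {s : ℂ}

theorem beta_eq (s : ℂ) : 1 + 2 * (s.re : ℂ) = ((1 + 2 * s.re : ℝ) : ℂ) := by push_cast; ring

theorem beta_eq_add_conj (s : ℂ) : ((1 + 2 * s.re : ℝ) : ℂ) = 1 + s + conj s := by
  rw [add_assoc, Complex.add_conj]; push_cast; ring

theorem conj_Gamma_one_add (s : ℂ) :
    conj (Complex.Gamma (1 + s)) = Complex.Gamma (1 + conj s) := by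
  rw [← Complex.Gamma_conj]; simp

theorem conj_Gamma_beta (s : ℂ) :
    conj (Complex.Gamma (1 + 2 * (s.re : ℂ))) = Complex.Gamma (1 + 2 * (s.re : ℂ)) := by
  rw [← Complex.Gamma_conj, beta_eq, Complex.conj_ofReal]

theorem Gamma_one_add_ne_zero (hs : -(1 / 2 : ℝ) < s.re) : Complex.Gamma (1 + s) ≠ 0 :=
  Complex.Gamma_ne_zero_of_re_pos (by simp; linarith)

theorem Gamma_beta_ne_zero (hs : -(1 / 2 : ℝ) < s.re) :
    Complex.Gamma (1 + 2 * (s.re : ℂ)) ≠ 0 :=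
  Complex.Gamma_ne_zero_of_re_pos (by simp; linarith)

theorem beta_pos (hs : -(1 / 2 : ℝ) < s.re) : 0 < 1 + 2 * s.re := by linarith

/-- Conjugation reverses the imaginary argument and exchanges s with s̄. Bounds on the positive
half-line thus pass to the negative one. -/
theorem Z_neg (s : ℂ) (x : ℝ) : Z s (-x) = conj (Z (conj s) x) := by
  rw [Z, Z, beta_eq, beta_eq, map_mul, map_div₀, conj_Gamma_one_add, conj_oneFOne,
    ← beta_eq, ← beta_eq, conj_Gamma_beta]
  simp

/-- The entire function whose restriction to the real line is `exp (i x) conj (Z_s x)`. -/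
def entireZ (s : ℂ) (z : ℂ) : ℂ :=
  Complex.Gamma (1 + conj s) / Complex.Gamma (1 + 2 * (s.re : ℂ)) *
    oneFOne (1 + conj s) (1 + 2 * (s.re : ℂ)) (Complex.I * z)

/-- Kummer's transformation applies with 1 + 2 Re s = 1 + s + s̄, so the parameter 1 + s̄ is
complementary to s. -/
theorem exp_mul_conj_Z (hs : -(1 / 2 : ℝ) < s.re) (x : ℝ) :
    Complex.exp (Complex.I * x) * conj (Z s x) = entireZ s x := by
  have h := exp_mul_oneFOne (1 + conj s) (beta_pos hs) (Complex.I * x)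
  rw [beta_eq_add_conj, show 1 + s + conj s - (1 + conj s) = s by ring, ← beta_eq_add_conj] at h
  rw [Z, entireZ, map_mul, map_div₀, conj_Gamma_one_add, conj_Gamma_beta, beta_eq, conj_oneFOne,
    Complex.conj_conj, map_mul, Complex.conj_I, Complex.conj_ofReal, neg_mul, ← h]
  ring

/-- The unimodular constant `Γ(1+s) / Γ(1+s̄)`. -/
def gammaPhase (s : ℂ) : ℂ := Complex.Gamma (1 + s) / Complex.Gamma (1 + conj s)

theorem Gamma_one_add_conj_ne_zero (hs : -(1 / 2 : ℝ) < s.re) :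
    Complex.Gamma (1 + conj s) ≠ 0 :=
  Gamma_one_add_ne_zero (s := conj s) (by simpa using hs)

theorem hasDerivAt_Z (hs : -(1 / 2 : ℝ) < s.re) (x : ℝ) :
    HasDerivAt (Z s) (Complex.Gamma (1 + s) / Complex.Gamma (1 + 2 * (s.re : ℂ)) *
      (deriv (oneFOne (conj s) (1 + 2 * (s.re : ℂ))) (Complex.I * x) * Complex.I)) x := by
  have h1 : HasDerivAt (fun t : ℝ => Complex.I * (t : ℂ)) Complex.I x := by
    simpa using ((hasDerivAt_id x).ofReal_comp).const_mul Complex.I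
  have h2 := (differentiable_oneFOne (conj s) (beta_pos hs) (Complex.I * x)).hasDerivAt
  rw [← beta_eq] at h2
  exact (h2.comp x h1).const_mul _

theorem continuous_Z (hs : -(1 / 2 : ℝ) < s.re) : Continuous (Z s) :=
  continuous_iff_continuousAt.2 fun x => (hasDerivAt_Z hs x).continuousAt

/-- Contiguity at a = s̄ produces parameter s̄ + 1, which is e^{ix} conj Z up to the constant phase.
The resulting first-order equation couples Z with conj Z; it yields both the growth bound and the
Christoffel–Darboux identity. -/
theorem mul_deriv_Z (hs : -(1 / 2 : ℝ) < s.re) (x : ℝ) :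
    x * deriv (Z s) x =
      conj s * (gammaPhase s * (Complex.exp (Complex.I * x) * conj (Z s x)) - Z s x) := by
  rw [(hasDerivAt_Z hs x).deriv, exp_mul_conj_Z hs, gammaPhase, entireZ, Z]
  have h := mul_deriv_oneFOne (conj s) (beta_pos hs) (Complex.I * x)
  rw [← beta_eq] at h
  have h1 := Gamma_one_add_conj_ne_zero hs
  have h2 := Gamma_beta_ne_zero hs
  rw [add_comm (conj s) 1] at h
  generalize deriv (oneFOne (conj s) (1 + 2 * (s.re : ℂ))) (Complex.I * x) = d at h ⊢
  generalize oneFOne (1 + conj s) (1 + 2 * (s.re : ℂ)) (Complex.I * x) = u at h ⊢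
  generalize oneFOne (conj s) (1 + 2 * (s.re : ℂ)) (Complex.I * x) = v at h ⊢
  field_simp
  linear_combination Complex.Gamma (1 + s) * h

theorem conj_ofReal_cpow {x : ℝ} (hx : 0 < x) (c : ℂ) : conj ((x : ℂ) ^ c) = (x : ℂ) ^ conj c := by
  rw [Complex.cpow_conj]
  · simp
  · rw [Complex.arg_ofReal_of_nonneg hx.le]; exact Real.pi_pos.ne

/-- Grönwall with the integrable coefficient K/x²: the function ‖q‖² exp(2K/x) is nonincreasing. -/
theorem bounded_of_norm_deriv_le {q q' : ℝ → ℂ} {K x₀ : ℝ} (h0 : 0 < x₀)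
    (hd : ∀ x, x₀ ≤ x → HasDerivAt q (q' x) x)
    (hb : ∀ x, x₀ ≤ x → ‖q' x‖ ≤ K * ‖q x‖ / x ^ 2) :
    ∃ C, ∀ x, x₀ ≤ x → ‖q x‖ ≤ C := by
  wlog hK : 0 ≤ K generalizing K
  · refine this (K := 0) (fun x hx => ?_) le_rfl
    refine (hb x hx).trans ?_
    push Not at hK
    gcongr
  have hd2 : ∀ x, x₀ ≤ x → HasDerivAt (fun x => ‖q x‖ ^ 2 * Real.exp (2 * K / x))
      (2 * ⟪q x, q' x⟫_ℝ * Real.exp (2 * K / x) +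
        ‖q x‖ ^ 2 * (Real.exp (2 * K / x) * (-(2 * K) / x ^ 2))) x := by
    intro x hx
    have hx0 : x ≠ 0 := (h0.trans_le hx).ne'
    have h1 : HasDerivAt (fun x : ℝ => 2 * K / x) (-(2 * K) / x ^ 2) x := by
      have := (hasDerivAt_inv hx0).const_mul (2 * K)
      refine (this.congr_deriv ?_).congr_of_eventuallyEq (Eventually.of_forall fun y => ?_)
      · field_simp
      · simp [div_eq_mul_inv]
    exact ((hd x hx).norm_sq).mul h1.exp
  have hanti : AntitoneOn (fun x => ‖q x‖ ^ 2 * Real.exp (2 * K / x)) (Ici x₀) := by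
    refine antitoneOn_of_deriv_nonpos (convex_Ici x₀)
      (fun x hx => (hd2 x hx).continuousAt.continuousWithinAt)
      (fun x hx => (hd2 x (interior_subset hx)).differentiableAt.differentiableWithinAt)
      fun x hx => ?_
    have hx := interior_subset hx
    rw [(hd2 x hx).deriv]
    have hx0 : 0 < x := h0.trans_le hx
    have h1 : ⟪q x, q' x⟫_ℝ ≤ ‖q x‖ * (K * ‖q x‖ / x ^ 2) :=
      (real_inner_le_norm _ _).trans (by gcongr; exact hb x hx)
    have h2 : 2 * ⟪q x, q' x⟫_ℝ * Real.exp (2 * K / x) +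
        ‖q x‖ ^ 2 * (Real.exp (2 * K / x) * (-(2 * K) / x ^ 2)) =
        2 * Real.exp (2 * K / x) * (⟪q x, q' x⟫_ℝ - ‖q x‖ * (K * ‖q x‖ / x ^ 2)) := by ring
    rw [h2]
    exact mul_nonpos_of_nonneg_of_nonpos (by positivity) (by linarith)
  refine ⟨Real.sqrt (‖q x₀‖ ^ 2 * Real.exp (2 * K / x₀)), fun x hx => Real.le_sqrt_of_sq_le ?_⟩
  have hx0 : 0 < x := h0.trans_le hx
  refine le_trans ?_ (hanti self_mem_Ici hx hx)
  exact le_mul_of_one_le_right (by positivity) (Real.one_le_exp (by positivity))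

/-- The function w = x^{s̄} Z solves w' = c g conj w with g = e^{ix} x^{s̄-s-1}. Here |g| = 1/x is
not integrable, so the oscillation of g must be used: adding i c g conj w, which amounts to one
integration by parts, leaves a derivative of size O(|w|/x²), and Grönwall applies. -/
theorem rpow_mul_norm_Z_le (hs : -(1 / 2 : ℝ) < s.re) :
    ∃ C, ∀ x : ℝ, 1 ≤ x → x ^ s.re * ‖Z s x‖ ≤ C := by
  set c : ℂ := conj s * gammaPhase s with hc
  set e : ℂ := conj s - s - 1 with he
  have hre : e.re = -1 := by simp [he]
  set w : ℝ → ℂ := fun x => (x : ℂ) ^ conj s * Z s x with hw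
  set g : ℝ → ℂ := fun x => Complex.exp (Complex.I * x) * (x : ℂ) ^ e with hg
  have hexp : ∀ x : ℝ, ‖Complex.exp (Complex.I * x)‖ = 1 := fun x => by
    rw [mul_comm, Complex.norm_exp_ofReal_mul_I]
  have hgn : ∀ x : ℝ, 0 < x → ‖g x‖ = x⁻¹ := fun x hx => by
    rw [hg]
    simp only
    rw [norm_mul, hexp, one_mul, Complex.norm_cpow_eq_rpow_re_of_pos hx, hre, Real.rpow_neg_one]
  have hwn : ∀ x : ℝ, 0 < x → ‖w x‖ = x ^ s.re * ‖Z s x‖ := fun x hx => by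
    rw [hw]
    simp only
    rw [norm_mul, Complex.norm_cpow_eq_rpow_re_of_pos hx, Complex.conj_re]
  have hpow : ∀ (r : ℂ) (x : ℝ), 0 < x →
      HasDerivAt (fun y : ℝ => (y : ℂ) ^ r) (r * (x : ℂ) ^ r / x) x := by
    intro r x hx
    have hx' : (x : ℂ) ≠ 0 := by exact_mod_cast hx.ne'
    have h1 : HasDerivAt (fun y : ℂ => y ^ r) (r * (x : ℂ) ^ (r - 1)) (x : ℂ) := by
      simpa using (hasDerivAt_id (x : ℂ)).cpow_const (c := r)
        (Complex.ofReal_mem_slitPlane.2 hx)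
    refine h1.comp_ofReal.congr_deriv ?_
    rw [Complex.cpow_sub _ _ hx', Complex.cpow_one, mul_div_assoc]
  have hwd : ∀ x : ℝ, 0 < x → HasDerivAt w (c * g x * conj (w x)) x := by
    intro x hx
    have hx' : (x : ℂ) ≠ 0 := by exact_mod_cast hx.ne'
    have h1 := (hpow (conj s) x hx).mul (hasDerivAt_Z hs x).differentiableAt.hasDerivAt
    refine h1.congr_deriv ?_
    have h2 := mul_deriv_Z hs x
    have h3 : (x : ℂ) ^ e * (x : ℂ) ^ s * x = (x : ℂ) ^ conj s := by
      rw [← Complex.cpow_add _ _ hx']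
      nth_rewrite 2 [← Complex.cpow_one (x : ℂ)]
      rw [← Complex.cpow_add _ _ hx', he]
      congr 1; ring
    have h4 : conj (w x) = (x : ℂ) ^ s * conj (Z s x) := by
      rw [hw]; simp only; rw [map_mul, conj_ofReal_cpow hx, Complex.conj_conj]
    rw [h4, hg, ← mul_right_inj' hx']
    simp only
    rw [hc]
    generalize Complex.exp (Complex.I * x) = E at h2 ⊢
    field_simp
    rw [← h3]
    linear_combination ((x : ℂ) ^ e * (x : ℂ) ^ s * x) * h2
  have hgd : ∀ x : ℝ, 0 < x → HasDerivAt g (Complex.I * g x + e * g x / x) x := by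
    intro x hx
    have h1 : HasDerivAt (fun t : ℝ => Complex.I * (t : ℂ)) Complex.I x := by
      simpa using ((hasDerivAt_id x).ofReal_comp).const_mul Complex.I
    refine (h1.cexp.mul (hpow e x hx)).congr_deriv ?_
    rw [hg]; simp only; ring
  set q : ℝ → ℂ := fun x => w x + Complex.I * c * g x * conj (w x) with hq
  have hqd : ∀ x : ℝ, 0 < x → HasDerivAt q
      (Complex.I * c * (e * g x / x * conj (w x) + g x * (conj c * conj (g x) * w x))) x := by
    intro x hx
    have hst : HasDerivAt (fun y => conj (w y)) (conj (c * g x * conj (w x))) x := (hwd x hx).star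
    have h1 := (hwd x hx).add (((hgd x hx).const_mul (Complex.I * c)).mul hst)
    refine (h1.congr_deriv ?_)
    simp only [map_mul, Complex.conj_conj]
    ring_nf
    rw [Complex.I_sq]
    ring
  -- Beyond 2‖c‖ the correction is at most ‖w‖/2, so q controls w.
  set x₀ : ℝ := max 1 (2 * ‖c‖) with hx₀
  have hx₀1 : 1 ≤ x₀ := le_max_left _ _
  have hwq : ∀ x, x₀ ≤ x → ‖w x‖ ≤ 2 * ‖q x‖ := by
    intro x hx
    have hx0 : 0 < x := by linarith
    have h1 : ‖w x‖ ≤ ‖q x‖ + ‖Complex.I * c * g x * conj (w x)‖ := by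
      have : w x = q x - Complex.I * c * g x * conj (w x) := by rw [hq]; ring
      rw [this]
      refine (norm_sub_le _ _).trans ?_
      rw [← this]
    have h2 : ‖Complex.I * c * g x * conj (w x)‖ ≤ ‖w x‖ / 2 := by
      rw [norm_mul, norm_mul, norm_mul, Complex.norm_I, one_mul, RCLike.norm_conj, hgn x hx0]
      have h3 : ‖c‖ * x⁻¹ ≤ 1 / 2 := by
        rw [← div_eq_mul_inv, div_le_iff₀ hx0]
        linarith [le_max_right 1 (2 * ‖c‖)]
      calc _ ≤ 1 / 2 * ‖w x‖ := by gcongr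
        _ = _ := by ring
    linarith
  obtain ⟨C, hC⟩ := bounded_of_norm_deriv_le (q := q) (K := ‖c‖ * (‖e‖ + ‖c‖) * 2) (x₀ := x₀)
    (by linarith) (fun x hx => hqd x (by linarith)) (fun x hx => by
      have hx0 : 0 < x := by linarith
      have h1 : ‖e * g x / x * conj (w x) + g x * (conj c * conj (g x) * w x)‖ ≤
          (‖e‖ + ‖c‖) * ‖w x‖ / x ^ 2 := by
        refine (norm_add_le _ _).trans ?_
        simp only [norm_mul, norm_div, RCLike.norm_conj, hgn x hx0, Complex.norm_real,
          Real.norm_of_nonneg hx0.le]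
        apply le_of_eq
        field_simp
      rw [norm_mul, norm_mul, Complex.norm_I, one_mul]
      calc _ ≤ ‖c‖ * ((‖e‖ + ‖c‖) * (2 * ‖q x‖) / x ^ 2) := by
            gcongr
            refine h1.trans ?_
            gcongr
            exact hwq x hx
        _ = _ := by ring)
  obtain ⟨D, hD⟩ := (isCompact_Icc (a := (1 : ℝ)) (b := x₀)).exists_bound_of_continuousOn
    (f := w) fun x hx => (hwd x (by linarith [hx.1])).continuousAt.continuousWithinAt
  refine ⟨max D (2 * C), fun x hx => ?_⟩
  rw [← hwn x (by linarith)]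
  rcases le_total x x₀ with h | h
  · exact (hD x ⟨hx, h⟩).trans (le_max_left _ _)
  · exact ((hwq x h).trans (by linarith [hC x h])).trans (le_max_right _ _)

end ZFunction

/-! ### The generalized exponential: branches, dilations and size. -/

section GeneralizedExponential

variable {s : ℂ}

theorem measurable_sign : Measurable Real.sign := by
  unfold Real.sign
  exact Measurable.ite measurableSet_Iio measurable_const
    (Measurable.ite measurableSet_Ioi measurable_const measurable_const)

theorem measurable_rho (s : ℂ) : Measurable (rho s) := by
  have := measurable_sign
  unfold rho
  fun_prop

theorem measurable_genExp (hs : -(1 / 2 : ℝ) < s.re) : Measurable (genExp s) := by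
  have h1 := (continuous_Z hs).measurable
  have h2 := measurable_rho s
  have h3 : Measurable fun x => conj (psi s x) :=
    Complex.continuous_conj.measurable.comp (measurable_psi s)
  unfold genExp
  fun_prop

theorem rho_pos (s : ℂ) {x : ℝ} (hx : x ≠ 0) : 0 < rho s x :=
  mul_pos (Real.rpow_pos_of_pos (abs_pos.2 hx) _) (Real.exp_pos _)

theorem norm_psi (s : ℂ) {x : ℝ} (hx : x ≠ 0) : ‖psi s x‖ = 1 := by
  have h1 : ‖Complex.exp (-(Complex.I * (Real.pi : ℂ) / 2) * (s.re : ℂ) *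
      (Real.sign x : ℂ))‖ = 1 := by
    rw [Complex.norm_exp]; simp
  rw [psi, norm_mul, h1, one_mul, Complex.norm_cpow_eq_rpow_re_of_pos (abs_pos.mpr hx)]
  simp

theorem conj_psi_mul_psi (s : ℂ) {x : ℝ} (hx : x ≠ 0) : conj (psi s x) * psi s x = 1 := by
  rw [mul_comm, Complex.mul_conj, Complex.normSq_eq_norm_sq, norm_psi s hx]; simp

theorem log_I_mul {x : ℝ} (hx : x ≠ 0) :
    Complex.log (Complex.I * x) =
      (Real.log |x| : ℂ) + Complex.I * (Real.pi / 2) * (Real.sign x : ℂ) := by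
  rcases lt_or_gt_of_ne hx with h | h
  · have h1 : Complex.I * (x : ℂ) = ((-x : ℝ) : ℂ) * (-Complex.I) := by push_cast; ring
    rw [h1, Complex.log_ofReal_mul (by linarith) (by simp), Complex.log_neg_I, Real.sign_of_neg h,
      abs_of_neg h]
    push_cast; ring
  · rw [mul_comm, Complex.log_ofReal_mul h (by simp), Complex.log_I, Real.sign_of_pos h,
      abs_of_pos h]
    push_cast; ring

/-- Since log(ix) = log|x| + (iπ/2) sign x on the principal branch, ρ and conj ψ are the modulus and
the phase of (ix)^s. -/
theorem rho_mul_conj_psi (s : ℂ) {x : ℝ} (hx : x ≠ 0) :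
    (rho s x : ℂ) * conj (psi s x) = (Complex.I * x) ^ s := by
  have hx' : Complex.I * (x : ℂ) ≠ 0 := mul_ne_zero Complex.I_ne_zero (by exact_mod_cast hx)
  have h0 : 0 < |x| := abs_pos.2 hx
  have h0' : ((|x| : ℝ) : ℂ) ≠ 0 := by exact_mod_cast h0.ne'
  have h1 : (rho s x : ℂ) = Complex.exp (Real.log |x| * s.re - Real.pi / 2 * s.im * Real.sign x) := by
    rw [rho, Real.rpow_def_of_pos h0, ← Real.exp_add]
    push_cast; congr 1; ring
  have h2 : conj (psi s x) = Complex.exp (Complex.I * Real.pi / 2 * s.re * Real.sign x +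
      Real.log |x| * (Complex.I * s.im)) := by
    rw [psi, map_mul, conj_ofReal_cpow h0, ← Complex.exp_conj, Complex.cpow_def_of_ne_zero h0',
      ← Complex.exp_add, ← Complex.ofReal_log h0.le]
    congr 1
    have : conj (2 : ℂ) = 2 := map_ofNat _ 2
    simp [this, neg_div]
  rw [h1, h2, ← Complex.exp_add, Complex.cpow_def_of_ne_zero hx', log_I_mul hx]
  congr 1
  conv_rhs => rw [← Complex.re_add_im s]
  ring_nf
  rw [Complex.I_sq]
  ring

theorem genExp_eq (s : ℂ) {x : ℝ} (hx : x ≠ 0) :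
    genExp s x = Complex.exp (-(Complex.I * x)) / (Real.sqrt (2 * Real.pi) : ℂ) *
      (Complex.I * x) ^ s * Z s x := by
  rw [genExp, ← rho_mul_conj_psi s hx]; ring

theorem I_mul_mul_cpow (s : ℂ) {t x : ℝ} (ht : 0 < t) (hx : x ≠ 0) :
    (Complex.I * ((x * t : ℝ) : ℂ)) ^ s = (t : ℂ) ^ s * (Complex.I * x) ^ s := by
  have hx' : Complex.I * (x : ℂ) ≠ 0 := mul_ne_zero Complex.I_ne_zero (by exact_mod_cast hx)
  have ht' : (t : ℂ) ≠ 0 := by exact_mod_cast ht.ne'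
  rw [show Complex.I * ((x * t : ℝ) : ℂ) = (t : ℂ) * (Complex.I * x) by push_cast; ring,
    Complex.cpow_def_of_ne_zero (mul_ne_zero ht' hx'), Complex.log_ofReal_mul ht hx',
    Complex.cpow_def_of_ne_zero ht', Complex.cpow_def_of_ne_zero hx', ← Complex.exp_add,
    ← Complex.ofReal_log ht.le]
  congr 1; ring

/-- This is the integral kernel of ψ* 𝒯_s*. The phase ψ(x) coming from the conjugated exponential
cancels against conj ψ(x), and the remaining dependence on x is ρ(x) times an entire function. -/
theorem conj_psi_mul_conj_genExp (hs : -(1 / 2 : ℝ) < s.re) {t x : ℝ} (ht : 0 < t) (hx : x ≠ 0) :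
    conj (psi s x) * conj (genExp s (x * t)) =
      rho s x * ((t : ℂ) ^ conj s * entireZ s ((t * x : ℝ) : ℂ) / (Real.sqrt (2 * Real.pi) : ℂ)) := by
  have hp := conj_psi_mul_psi s hx
  rw [genExp_eq s (mul_ne_zero hx ht.ne'), I_mul_mul_cpow s ht hx, ← rho_mul_conj_psi s hx,
    ← exp_mul_conj_Z hs]
  simp only [map_mul, map_div₀, Complex.conj_ofReal, Complex.conj_conj, conj_ofReal_cpow ht,
    ← Complex.exp_conj, map_neg, Complex.conj_I, neg_mul, neg_neg]
  rw [mul_comm t x]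
  push_cast
  linear_combination (Complex.exp (Complex.I * (x * t)) / (Real.sqrt (2 * Real.pi) : ℂ) *
    (t : ℂ) ^ conj s * rho s x * conj (Z s (x * t))) * hp

theorem rho_le (s : ℂ) (x : ℝ) :
    rho s x ≤ Real.exp (Real.pi / 2 * |s.im|) * |x| ^ s.re := by
  rw [rho, mul_comm]
  refine mul_le_mul_of_nonneg_right (Real.exp_le_exp.2 ?_) (by positivity)
  have h1 : |Real.sign x| ≤ 1 := by
    rcases lt_trichotomy x 0 with h | h | h
    · simp [Real.sign_of_neg h]
    · simp [h]
    · simp [Real.sign_of_pos h]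
  calc -(Real.pi / 2) * s.im * Real.sign x ≤ |-(Real.pi / 2) * s.im * Real.sign x| := le_abs_self _
    _ = Real.pi / 2 * |s.im| * |Real.sign x| := by
      rw [abs_mul, abs_mul, abs_neg, abs_of_pos (by positivity : 0 < Real.pi / 2)]
    _ ≤ Real.pi / 2 * |s.im| * 1 := by gcongr
    _ = _ := mul_one _

theorem norm_genExp_le_mul (s : ℂ) (x : ℝ) :
    ‖genExp s x‖ ≤ Real.exp (Real.pi / 2 * |s.im|) * (|x| ^ s.re * ‖Z s x‖) := by
  have h1 : ‖Complex.exp (-(Complex.I * x))‖ = 1 := by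
    rw [Complex.norm_exp]; simp
  have h2 : 1 ≤ Real.sqrt (2 * Real.pi) := Real.one_le_sqrt.2 (by linarith [Real.pi_gt_three])
  have h3 : 0 ≤ rho s x := by unfold rho; positivity
  rw [genExp, norm_mul, norm_mul, norm_mul, norm_div, h1, RCLike.norm_conj, Complex.norm_real,
    Complex.norm_real, Real.norm_of_nonneg h3, Real.norm_of_nonneg (by positivity), ← mul_assoc]
  refine mul_le_mul_of_nonneg_right ?_ (norm_nonneg _)
  calc 1 / Real.sqrt (2 * Real.pi) * rho s x * ‖psi s x‖ ≤ 1 * rho s x * 1 := by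
        gcongr
        · rw [div_le_one (by positivity)]; exact h2
        · exact norm_psi_le s x
    _ ≤ _ := by rw [one_mul, mul_one]; exact rho_le s x

/-- The generalized exponential is bounded at infinity and has at most a square integrable
singularity at the origin. -/
theorem norm_genExp_le (hs : -(1 / 2 : ℝ) < s.re) :
    ∃ C, 0 ≤ C ∧ ∀ x : ℝ, x ≠ 0 → ‖genExp s x‖ ≤ C * (1 + |x| ^ min s.re 0) := by
  obtain ⟨C₁, h1⟩ := rpow_mul_norm_Z_le hs
  -- The conjugate parameter serves the negative half-line, through `Z_neg`.
  obtain ⟨C₂, h2⟩ := rpow_mul_norm_Z_le (s := conj s) (by simpa using hs)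
  obtain ⟨C₃, h3⟩ := (isCompact_Icc (a := (-1 : ℝ)) (b := 1)).exists_bound_of_continuousOn
    (continuous_Z hs).continuousOn
  set E := Real.exp (Real.pi / 2 * |s.im|)
  have hE : 0 < E := Real.exp_pos _
  refine ⟨E * max (max (max C₁ C₂) C₃) 0, by positivity, fun x hx => ?_⟩
  have hx0 := abs_pos.2 hx
  refine (norm_genExp_le_mul s x).trans ?_
  rw [mul_assoc]
  refine mul_le_mul_of_nonneg_left ?_ hE.le
  set M := max (max (max C₁ C₂) C₃) 0
  have hM1 : C₁ ≤ M := le_trans (le_trans (le_max_left _ _) (le_max_left _ _)) (le_max_left _ _)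
  have hM2 : C₂ ≤ M := le_trans (le_trans (le_max_right _ _) (le_max_left _ _)) (le_max_left _ _)
  have hM3 : C₃ ≤ M := le_trans (le_max_right _ _) (le_max_left _ _)
  have hM0 : 0 ≤ M := le_max_right _ _
  have hp : 0 ≤ |x| ^ min s.re 0 := by positivity
  rcases le_total |x| 1 with h | h
  · have h4 := h3 x (abs_le.1 h)
    have h5 : |x| ^ s.re ≤ |x| ^ min s.re 0 :=
      Real.rpow_le_rpow_of_exponent_ge hx0 h (min_le_left _ _)
    calc |x| ^ s.re * ‖Z s x‖ ≤ |x| ^ min s.re 0 * M := by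
          gcongr; exact h4.trans hM3
      _ ≤ _ := by rw [mul_comm]; gcongr; linarith
  · have h6 : |x| ^ s.re * ‖Z s x‖ ≤ M := by
      rcases le_total 0 x with h' | h'
      · rw [abs_of_nonneg h'] at h ⊢
        exact (h1 x h).trans hM1
      · rw [abs_of_nonpos h'] at h ⊢
        have := h2 (-x) h
        rw [Complex.conj_re] at this
        have h7 := Z_neg s (-x)
        rw [neg_neg] at h7
        rw [h7, RCLike.norm_conj]
        exact this.trans hM2
    refine h6.trans (le_mul_of_one_le_right hM0 (by linarith))

end GeneralizedExponential

/-! ### Laplace transforms, analytic continuation and Kummer's function. -/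

section Laplace

theorem integrableOn_rpow_mul_exp {u δ : ℝ} (hu : -1 < u) (hδ : 0 < δ) :
    IntegrableOn (fun x : ℝ => x ^ u * Real.exp (-(δ * x))) (Ioi 0) := by
  simpa using integrableOn_rpow_mul_exp_neg_mul_rpow hu one_pos hδ

theorem differentiableOn_laplace {g : ℝ → ℂ} (hgm : AEStronglyMeasurable g (volume.restrict (Ioi 0)))
    (hg : ∀ δ : ℝ, 0 < δ → IntegrableOn (fun x : ℝ => Complex.exp (-(δ * x)) * g x) (Ioi 0)) :
    DifferentiableOn ℂ (fun p => ∫ x in Ioi (0 : ℝ), Complex.exp (-(p * x)) * g x)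
      {p | 0 < p.re} := by
  intro p₀ hp₀
  have hp₀' : 0 < p₀.re := hp₀
  -- On the ball of radius 2η one has Re p ≥ 2η. One factor e^{-ηx} absorbs the x produced by
  -- differentiation; the other is the integrable majorant.
  set η := p₀.re / 4 with hη
  have hη0 : 0 < η := by positivity
  have hm : ∀ p : ℂ, AEStronglyMeasurable (fun x : ℝ => Complex.exp (-(p * x)) * g x)
      (volume.restrict (Ioi 0)) := fun p =>
    (by fun_prop : Continuous fun x : ℝ => Complex.exp (-(p * x))).aestronglyMeasurable.mul hgm
  have hn : ∀ (p : ℂ) (x : ℝ), ‖Complex.exp (-(p * x))‖ = Real.exp (-(p.re * x)) := fun p x => by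
    rw [Complex.norm_exp]; simp
  have hmain := hasDerivAt_integral_of_dominated_loc_of_deriv_le (𝕜 := ℂ)
    (μ := volume.restrict (Ioi (0 : ℝ))) (x₀ := p₀) (s := Metric.ball p₀ (2 * η))
    (F := fun p x => Complex.exp (-(p * x)) * g x)
    (F' := fun p x => (-(x : ℂ)) * Complex.exp (-(p * x)) * g x)
    (bound := fun x => η⁻¹ * ‖Complex.exp (-(η * x)) * g x‖)
    (Metric.ball_mem_nhds _ (by positivity)) (Eventually.of_forall hm) ?_ ?_ ?_ ?_ ?_
  · exact hmain.2.differentiableAt.differentiableWithinAt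
  · refine Integrable.mono (hg p₀.re hp₀) (hm p₀) (ae_of_all _ fun x => ?_)
    rw [norm_mul, norm_mul, hn, hn, Complex.ofReal_re]
  · simp only [mul_assoc]
    exact (by fun_prop : Continuous fun x : ℝ => -(x : ℂ)).aestronglyMeasurable.mul (hm p₀)
  · refine (ae_restrict_iff' measurableSet_Ioi).2 (ae_of_all _ fun x hx p hp => ?_)
    have hx0 : 0 < x := hx
    have hp1 : 2 * η ≤ p.re := by
      have h1 : |(p - p₀).re| < 2 * η :=
        (Complex.abs_re_le_norm _).trans_lt (by simpa [dist_eq_norm] using hp)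
      rw [Complex.sub_re] at h1
      have := (abs_lt.1 h1).1
      linarith
    rw [norm_mul, norm_mul, norm_mul, hn, hn, norm_neg, Complex.norm_real,
      Real.norm_of_nonneg hx0.le, Complex.ofReal_re, ← mul_assoc]
    refine mul_le_mul_of_nonneg_right ?_ (norm_nonneg _)
    have h2 : x ≤ η⁻¹ * Real.exp (η * x) := by
      rw [inv_mul_eq_div, le_div_iff₀ hη0, mul_comm]
      linarith [Real.add_one_le_exp (η * x)]
    calc x * Real.exp (-(p.re * x)) ≤ (η⁻¹ * Real.exp (η * x)) * Real.exp (-(2 * η * x)) := by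
          gcongr
      _ = η⁻¹ * Real.exp (-(η * x)) := by
          rw [mul_assoc, ← Real.exp_add]; congr 2; ring
  · exact (hg η hη0).norm.const_mul _
  · refine ae_of_all _ fun x p _ => ?_
    have h1 : HasDerivAt (fun p : ℂ => -(p * x)) (-(x : ℂ)) p := by
      exact ((hasDerivAt_id p).mul_const (x : ℂ)).neg.congr_deriv (by simp)
    exact (h1.cexp.mul_const (g x)).congr_deriv (by ring)

/-- Identity theorem: a real ray accumulates inside the half-plane. A Laplace transform therefore
need only be computed for large real p. -/
theorem eqOn_re_pos_of_eq_on_reals {f g : ℂ → ℂ} (hf : DifferentiableOn ℂ f {p | 0 < p.re})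
    (hg : DifferentiableOn ℂ g {p | 0 < p.re}) {P : ℝ} (hP : 0 ≤ P)
    (h : ∀ p : ℝ, P < p → f p = g p) : EqOn f g {p | 0 < p.re} := by
  have ho : IsOpen {p : ℂ | 0 < p.re} := isOpen_lt continuous_const Complex.continuous_re
  refine (hf.analyticOnNhd ho).eqOn_of_preconnected_of_frequently_eq (hg.analyticOnNhd ho)
    (convex_halfSpace_re_gt 0).isPreconnected (z₀ := ((P + 1 : ℝ) : ℂ))
    (by simp; linarith) ?_
  have ht : Tendsto (fun p : ℝ => (p : ℂ)) (𝓝[≠] (P + 1)) (𝓝[≠] ((P + 1 : ℝ) : ℂ)) := by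
    refine tendsto_nhdsWithin_of_tendsto_nhds_of_eventually_within _
      (Complex.continuous_ofReal.continuousAt.tendsto.mono_left nhdsWithin_le_nhds) ?_
    filter_upwards [self_mem_nhdsWithin] with p hp
    simpa using fun h' => hp (Complex.ofReal_injective h')
  refine ht.frequently (Eventually.frequently ?_)
  filter_upwards [nhdsWithin_le_nhds (lt_mem_nhds (show P < P + 1 by linarith))] with p hp
  exact h p hp

/-- Both sides are holomorphic in r on the right half-plane, so the Gamma integral at real rates
suffices. -/
theorem integral_cpow_mul_exp_neg_mul {a : ℂ} (ha : 0 < a.re) {r : ℂ} (hr : 0 < r.re) :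
    ∫ t in Ioi (0 : ℝ), Complex.exp (-(r * t)) * (t : ℂ) ^ (a - 1) = r ^ (-a) * Complex.Gamma a := by
  have hm : AEStronglyMeasurable (fun t : ℝ => (t : ℂ) ^ (a - 1)) (volume.restrict (Ioi 0)) := by
    have : Measurable fun t : ℝ => (t : ℂ) ^ (a - 1) := by fun_prop
    exact this.aestronglyMeasurable
  refine eqOn_re_pos_of_eq_on_reals
    (f := fun r => ∫ t in Ioi (0 : ℝ), Complex.exp (-(r * t)) * (t : ℂ) ^ (a - 1))
    (g := fun r => r ^ (-a) * Complex.Gamma a)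
    (differentiableOn_laplace hm fun δ hδ => ?_) ?_ le_rfl (fun p hp => ?_) hr
  · have h := integrableOn_rpow_mul_exp (u := a.re - 1) (by linarith) hδ
    refine Integrable.mono h ((by fun_prop : Continuous fun x : ℝ =>
      Complex.exp (-(δ * x))).aestronglyMeasurable.mul hm) ?_
    refine (ae_restrict_iff' measurableSet_Ioi).2 (ae_of_all _ fun x hx => ?_)
    have hx0 : (0 : ℝ) < x := hx
    rw [norm_mul, Complex.norm_exp, Complex.norm_cpow_eq_rpow_re_of_pos hx0,
      Real.norm_of_nonneg (by positivity), mul_comm]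
    simp
  · intro r hr
    refine DifferentiableAt.differentiableWithinAt ?_
    exact (differentiableAt_id.cpow_const (Or.inl hr)).mul_const _
  · have h := Complex.integral_cpow_mul_exp_neg_mul_Ioi ha hp
    simp only [mul_comm (Complex.exp _)]
    rw [h, one_div, Complex.inv_cpow, Complex.cpow_neg]
    rw [Complex.arg_ofReal_of_nonneg hp.le]
    exact Real.pi_pos.ne

theorem Gamma_add_natCast {b : ℂ} (hb : 0 < b.re) (k : ℕ) :
    Complex.Gamma (b + k) = (ascPochhammer ℂ k).eval b * Complex.Gamma b := by
  induction k with
  | zero => simp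
  | succ k ih =>
    have : b + k ≠ 0 := fun h => by
      have := congrArg Complex.re h
      simp at this
      linarith [(Nat.cast_nonneg k : (0 : ℝ) ≤ k)]
    push_cast
    rw [← add_assoc, Complex.Gamma_add_one _ this, ih, ascPochhammer_succ_eval]
    ring

theorem hasSum_ascPochhammer (α : ℂ) {y : ℂ} (hy : ‖y‖ < 1) :
    HasSum (fun k : ℕ => (ascPochhammer ℂ k).eval α / k.factorial * y ^ k) ((1 - y) ^ (-α)) := by
  have h := (Complex.one_div_one_sub_cpow_hasFPowerSeriesOnBall_zero α).hasSum (y := y)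
    (by simpa [← ENNReal.ofReal_one, Metric.eball_ofReal] using hy)
  rw [zero_add, one_div, ← Complex.cpow_neg] at h
  refine Eq.mp (congrArg (fun f : ℕ → ℂ => HasSum f ((1 - y) ^ (-α))) (funext fun k => ?_)) h
  rw [FormalMultilinearSeries.ofScalars_apply_eq, Ring.choose_eq_smul,
    descPochhammer_smeval_eq_ascPochhammer_eval, show α + k - 1 - k + 1 = α by ring]
  simp [div_eq_inv_mul]

/-- The Laplace transform of `x ^ (b - 1) M(α; b; c x)` for large real argument. -/
theorem laplace_kummer_of_large {α c : ℂ} {b : ℝ} (hb : 0 < b) {p : ℝ}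
    (hp : max 1 ‖α‖ * ‖c‖ < p) :
    ∫ x in Ioi (0 : ℝ), Complex.exp (-(p * x)) * ((x : ℂ) ^ ((b : ℂ) - 1) * oneFOne α b (c * x)) =
      Complex.Gamma b * (p : ℂ) ^ (-(b : ℂ)) * (1 - c / p) ^ (-α) := by
  set R := max 1 ‖α‖ with hR
  have hR1 : 1 ≤ R := le_max_left _ _
  have hp0 : 0 < p := lt_of_le_of_lt (by positivity) hp
  have hp' : (p : ℂ) ≠ 0 := by exact_mod_cast hp0.ne'
  have hbre : 0 < (b : ℂ).re := by simpa using hb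
  have hy : ‖c / p‖ < 1 := by
    rw [norm_div, Complex.norm_real, Real.norm_of_nonneg hp0.le, div_lt_one hp0]
    exact (le_mul_of_one_le_left (norm_nonneg _) hR1).trans_lt hp
  -- Termwise integration gives Γ(b + k) p^{-b-k}; the denominator (b)_k cancels, and the binomial
  -- series of (1 - c/p)^{-α} is left.
  set F : ℕ → ℝ → ℂ := fun k x =>
    Complex.exp (-(p * x)) * ((x : ℂ) ^ ((b + k : ℂ) - 1)) * (kummerCoeff α b k * c ^ k) with hF
  have hterm : ∀ k, ∫ x in Ioi (0 : ℝ), F k x = Complex.Gamma b * (p : ℂ) ^ (-(b : ℂ)) *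
      ((ascPochhammer ℂ k).eval α / k.factorial * (c / p) ^ k) := fun k => by
    rw [hF]
    simp only
    rw [integral_mul_const, integral_cpow_mul_exp_neg_mul (a := b + k) (by simp; positivity)
      (by simpa using hp0), Gamma_add_natCast hbre, neg_add, Complex.cpow_add _ _ hp', kummerCoeff,
      Complex.cpow_neg _ (k : ℂ), Complex.cpow_natCast]
    have h1 := ascPochhammer_eval_ne_zero hbre k
    have h2 : (k.factorial : ℂ) ≠ 0 := Nat.cast_ne_zero.2 k.factorial_ne_zero
    rw [div_pow]
    field_simp
  have hnorm : ∀ k, ∀ x ∈ Ioi (0 : ℝ), ‖F k x‖ =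
      Real.exp (-(p * x)) * x ^ (b + k - 1) * ‖kummerCoeff α b k * c ^ k‖ := fun k x hx => by
    rw [hF]
    simp only
    rw [norm_mul, norm_mul, Complex.norm_exp, Complex.norm_cpow_eq_rpow_re_of_pos hx]
    simp
  have hint : ∀ k, Integrable (F k) (volume.restrict (Ioi 0)) := fun k => by
    have h := (integrableOn_rpow_mul_exp (u := b + k - 1)
      (by linarith [(Nat.cast_nonneg k : (0 : ℝ) ≤ k)]) hp0).mul_const ‖kummerCoeff α b k * c ^ k‖
    refine Integrable.mono h ?_ ?_
    · have : Measurable (F k) := by fun_prop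
      exact this.aestronglyMeasurable
    · refine (ae_restrict_iff' measurableSet_Ioi).2 (ae_of_all _ fun x hx => ?_)
      rw [hnorm k x hx, Real.norm_of_nonneg]
      · rw [mul_comm (Real.exp _)]
      · have : (0 : ℝ) < x := hx
        positivity
  -- From |(α)_k| ≤ Rᵏ k! the norms are dominated by a geometric series of ratio R‖c‖/p, which
  -- explains the lower bound imposed on p.
  have hsum : Summable fun k => ∫ x in Ioi (0 : ℝ), ‖F k x‖ := by
    have hq : Summable fun k : ℕ => Real.Gamma b * p ^ (-b) * (R * ‖c‖ / p) ^ k :=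
      (summable_geometric_of_lt_one (by positivity) ((div_lt_one hp0).2 hp)).mul_left _
    refine Summable.of_nonneg_of_le (fun k => integral_nonneg fun x => norm_nonneg _) (fun k => ?_) hq
    have h3 : ∫ x in Ioi (0 : ℝ), ‖F k x‖ =
        (1 / p) ^ (b + k) * Real.Gamma (b + k) * ‖kummerCoeff α b k * c ^ k‖ := by
      rw [setIntegral_congr_fun measurableSet_Ioi (hnorm k), integral_mul_const,
        ← Real.integral_rpow_mul_exp_neg_mul_Ioi (by positivity) hp0]
      simp only [mul_comm]
    have h4 : ((ascPochhammer ℂ k).eval (b : ℂ)) * (Real.Gamma b : ℂ) = (Real.Gamma (b + k) : ℂ) := by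
      have := Gamma_add_natCast hbre k
      rw [← Complex.ofReal_natCast, ← Complex.ofReal_add, Complex.Gamma_ofReal,
        Complex.Gamma_ofReal] at this
      exact this.symm
    have hG : 0 < Real.Gamma b := Real.Gamma_pos_of_pos hb
    have h5 : ‖(ascPochhammer ℂ k).eval (b : ℂ)‖ * Real.Gamma b = Real.Gamma (b + k) := by
      have := congrArg norm h4
      rwa [norm_mul, Complex.norm_real, Complex.norm_real, Real.norm_of_nonneg hG.le,
        Real.norm_of_nonneg (Real.Gamma_pos_of_pos (by positivity)).le] at this
    have h6 : ‖(ascPochhammer ℂ k).eval α‖ ≤ R ^ k * k.factorial := by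
      have := norm_ascPochhammer_le α one_pos k
      simpa [ascPochhammer_eval_one] using this
    have h7 : 0 < ‖(ascPochhammer ℂ k).eval (b : ℂ)‖ :=
      norm_pos_iff.2 (ascPochhammer_eval_ne_zero hbre k)
    have h8 : (0 : ℝ) < k.factorial := by positivity
    rw [h3, ← h5, kummerCoeff, norm_mul, norm_div, norm_mul, norm_pow, Complex.norm_natCast,
      one_div, Real.inv_rpow hp0.le, ← Real.rpow_neg hp0.le, neg_add, Real.rpow_add hp0,
      Real.rpow_neg hp0.le (k : ℝ), Real.rpow_natCast]
    calc _ = Real.Gamma b * p ^ (-b) *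
          ((‖(ascPochhammer ℂ k).eval α‖ / k.factorial) * (‖c‖ ^ k / p ^ k)) := by
          field_simp
      _ ≤ Real.Gamma b * p ^ (-b) * (R ^ k * (‖c‖ ^ k / p ^ k)) := by
          gcongr
          rwa [div_le_iff₀ h8]
      _ = _ := by rw [div_pow, mul_pow]; ring
  have h1 := hasSum_integral_of_summable_integral_norm hint hsum
  simp only [hterm] at h1
  have h2 := h1.unique ((hasSum_ascPochhammer α hy).mul_left _)
  rw [← h2]
  refine setIntegral_congr_fun measurableSet_Ioi fun x hx => ?_
  have hx' : (x : ℂ) ≠ 0 := by exact_mod_cast (ne_of_gt hx)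
  change _ * (_ * ∑' k, kummerCoeff α b k * (c * x) ^ k) = _
  rw [← tsum_mul_left, ← tsum_mul_left]
  refine tsum_congr fun k => ?_
  rw [hF]
  simp only
  rw [show (b + k - 1 : ℂ) = (b - 1) + k by ring, Complex.cpow_add _ _ hx', Complex.cpow_natCast,
    mul_pow]
  ring

end Laplace

/-! ### Test functions x^{s̄} e^{-x} and their explicit transforms. -/

section TestFunctions

variable {s : ℂ}

/-- The function `𝕀_{x > 0} x^{s̄} e^{-x}`, whose dilations span a dense subspace. -/
def testFn (s : ℂ) : ℝ → ℂ :=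
  indicator (Ioi 0) fun x => (x : ℂ) ^ conj s * Complex.exp (-x)

/-- The transform of `testFn`. -/
def testImage (s : ℂ) (w : ℝ) : ℂ :=
  Complex.Gamma (1 + s) / (Real.sqrt (2 * Real.pi) : ℂ) * (Complex.I * w) ^ s *
    (1 + Complex.I * w) ^ (-(1 + s))

theorem neg_one_lt_re_add_min (hs : -(1 / 2 : ℝ) < s.re) : -1 < s.re + min s.re 0 := by
  rcases min_choice s.re 0 with h | h <;> rw [h] <;> linarith

theorem integrableOn_exp_mul_genExp (hs : -(1 / 2 : ℝ) < s.re) {w : ℝ} (hw : w ≠ 0) {δ : ℝ}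
    (hδ : 0 < δ) :
    IntegrableOn (fun x : ℝ => Complex.exp (-(δ * x)) * (genExp s (w * x) * (x : ℂ) ^ conj s))
      (Ioi 0) := by
  obtain ⟨C, hC0, hC⟩ := norm_genExp_le hs
  set m := min s.re 0
  have h1 := (integrableOn_rpow_mul_exp (u := s.re) (by linarith) hδ).const_mul C
  have h2 := (integrableOn_rpow_mul_exp (u := s.re + m) (neg_one_lt_re_add_min hs) hδ).const_mul
    (C * |w| ^ m)
  refine Integrable.mono (h1.add h2) ?_ ?_
  · have hg := measurable_genExp hs
    have : Measurable fun x : ℝ =>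
        Complex.exp (-(δ * x)) * (genExp s (w * x) * (x : ℂ) ^ conj s) := by fun_prop
    exact this.aestronglyMeasurable
  · refine (ae_restrict_iff' measurableSet_Ioi).2 (ae_of_all _ fun x hx => ?_)
    have hx0 : (0 : ℝ) < x := hx
    have h3 := hC (w * x) (mul_ne_zero hw hx0.ne')
    rw [norm_mul, norm_mul, Complex.norm_exp, Complex.norm_cpow_eq_rpow_re_of_pos hx0,
      Complex.conj_re]
    simp only [Pi.add_apply]
    rw [Real.norm_of_nonneg (by positivity), Real.rpow_add hx0]
    rw [abs_mul, abs_of_pos hx0, Real.mul_rpow (abs_nonneg w) hx0.le] at h3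
    calc _ ≤ Real.exp (-(δ * x)) * (C * (1 + |w| ^ m * x ^ m) * x ^ s.re) := by
          gcongr
          simp
      _ = _ := by ring

/-- Kummer's transformation absorbs e^{-iwx}, and x^s x^{s̄} = x^{b-1} with b = 1 + 2 Re s. This is
the form whose Laplace transform is elementary. -/
theorem genExp_mul_cpow (hs : -(1 / 2 : ℝ) < s.re) {w x : ℝ} (hw : w ≠ 0) (hx : 0 < x) :
    genExp s (w * x) * (x : ℂ) ^ conj s =
      (Complex.Gamma (1 + s) / Complex.Gamma (1 + 2 * (s.re : ℂ)) /
        (Real.sqrt (2 * Real.pi) : ℂ) * (Complex.I * w) ^ s) *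
      ((x : ℂ) ^ (((1 + 2 * s.re : ℝ) : ℂ) - 1) *
        oneFOne (1 + s) ((1 + 2 * s.re : ℝ) : ℂ) (-(Complex.I * w) * x)) := by
  have hx' : (x : ℂ) ≠ 0 := by exact_mod_cast hx.ne'
  have h := exp_mul_oneFOne (1 + s) (beta_pos hs) (-(Complex.I * w) * x)
  rw [show ((1 + 2 * s.re : ℝ) : ℂ) - (1 + s) = conj s by rw [beta_eq_add_conj]; ring] at h
  rw [genExp_eq s (mul_ne_zero hw hx.ne'), I_mul_mul_cpow s hx hw, ← h, Z, ← beta_eq,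
    show -(-(Complex.I * (w : ℂ)) * x) = Complex.I * ((w * x : ℝ) : ℂ) by push_cast; ring,
    show -(Complex.I * (w : ℂ)) * x = -(Complex.I * ((w * x : ℝ) : ℂ)) by push_cast; ring,
    show (1 + 2 * (s.re : ℂ)) - 1 = s + conj s by rw [Complex.add_conj]; push_cast; ring,
    Complex.cpow_add _ _ hx']
  ring

/-- The quotient is (p + iw)/p. Were it real and nonpositive, multiplying by p would give Re (p +
iw) ≤ 0, yet this real part is Re p. -/
theorem one_sub_div_mem_slitPlane (w : ℝ) {p : ℂ} (hp : 0 < p.re) :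
    1 - -(Complex.I * w) / p ∈ Complex.slitPlane := by
  have hp0 : p ≠ 0 := fun h => by simp [h] at hp
  rw [Complex.mem_slitPlane_iff]
  by_contra! h
  have h1 : (1 - -(Complex.I * w) / p) * p = p + Complex.I * w := by field_simp; ring
  have h2 := congrArg Complex.re h1
  rw [Complex.mul_re, h.2] at h2
  simp only [zero_mul, sub_zero, Complex.add_re, Complex.mul_re, Complex.I_re, Complex.I_im,
    Complex.ofReal_im, Complex.ofReal_re, mul_zero, add_zero] at h2
  nlinarith [h.1]

/-- The series computation reaches only p > max(1, |1+s|) |w|; analytic continuation in p brings the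
formula to p = 1. -/
theorem integral_genExp_mul (hs : -(1 / 2 : ℝ) < s.re) {w : ℝ} (hw : w ≠ 0) :
    ∫ x in Ioi (0 : ℝ), genExp s (w * x) * ((x : ℂ) ^ conj s * Complex.exp (-x)) =
      testImage s w := by
  set b : ℝ := 1 + 2 * s.re with hb
  set K : ℂ := Complex.Gamma (1 + s) / Complex.Gamma (1 + 2 * (s.re : ℂ)) /
        (Real.sqrt (2 * Real.pi) : ℂ) * (Complex.I * w) ^ s with hK
  set c : ℂ := -(Complex.I * w) with hc
  have hmeas : Measurable fun x : ℝ => genExp s (w * x) * (x : ℂ) ^ conj s := by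
    have := measurable_genExp hs
    fun_prop
  have h := eqOn_re_pos_of_eq_on_reals
    (f := fun p => ∫ x in Ioi (0 : ℝ), Complex.exp (-(p * x)) *
      (genExp s (w * x) * (x : ℂ) ^ conj s))
    (g := fun p => K * (Complex.Gamma b * p ^ (-(b : ℂ)) * (1 - c / p) ^ (-(1 + s))))
    (differentiableOn_laplace hmeas.aestronglyMeasurable
      fun δ hδ => integrableOn_exp_mul_genExp hs hw hδ) ?_
    (P := max 1 ‖1 + s‖ * ‖c‖) (by positivity) (fun p hp => ?_)
    (show (0 : ℝ) < (1 : ℂ).re by simp)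
  · simp only [one_mul, Complex.one_cpow, mul_one, div_one] at h
    have h2 := Gamma_beta_ne_zero hs
    simp only [mul_comm (Complex.exp _), mul_assoc] at h
    rw [h, hK, testImage, hc, sub_neg_eq_add, hb, ← beta_eq]
    field_simp
  · intro p hp
    have hp' : 0 < p.re := hp
    have hp0 : p ≠ 0 := fun h => by simp [h] at hp'
    refine DifferentiableAt.differentiableWithinAt ?_
    have h1 : DifferentiableAt ℂ (fun p : ℂ => p ^ (-(b : ℂ))) p :=
      differentiableAt_id.cpow_const (Or.inl hp)
    have h2 : DifferentiableAt ℂ (fun p : ℂ => (1 - c / p) ^ (-(1 + s))) p := by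
      refine DifferentiableAt.cpow_const ?_ (one_sub_div_mem_slitPlane w hp')
      exact (differentiableAt_const _).sub ((differentiableAt_const _).div differentiableAt_id hp0)
    exact ((h1.const_mul _).mul h2).const_mul _
  · rw [← laplace_kummer_of_large (beta_pos hs) hp, ← integral_const_mul]
    refine setIntegral_congr_fun measurableSet_Ioi fun x hx => ?_
    rw [genExp_mul_cpow hs hw hx]
    ring

theorem measurable_testFn (s : ℂ) : Measurable (testFn s) := by
  refine Measurable.indicator ?_ measurableSet_Ioi
  fun_prop

theorem measurable_testImage (s : ℂ) : Measurable (testImage s) := by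
  unfold testImage; fun_prop

theorem norm_testFn_le (s : ℂ) (x : ℝ) :
    ‖testFn s x‖ ≤ indicator (Ioi 0) (fun x => x ^ s.re * Real.exp (-(1 * x))) x := by
  by_cases hx : x ∈ Ioi (0 : ℝ)
  · have hx0 : (0 : ℝ) < x := hx
    rw [testFn, indicator_of_mem hx, indicator_of_mem hx, norm_mul, Complex.norm_exp,
      Complex.norm_cpow_eq_rpow_re_of_pos hx0]
    simp
  · rw [testFn, indicator_of_notMem hx, indicator_of_notMem hx, norm_zero]

theorem integrable_rpow_mul_testFn {u : ℝ} (hu : -1 < s.re + u) :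
    Integrable fun x => (|x| ^ u : ℝ) * ‖testFn s x‖ := by
  have h1 := (integrable_indicator_iff measurableSet_Ioi).2 (integrableOn_rpow_mul_exp hu one_pos)
  refine Integrable.mono h1 ?_ (ae_of_all _ fun x => ?_)
  · have := measurable_testFn s
    have : Measurable fun x => (|x| ^ u : ℝ) * ‖testFn s x‖ := by fun_prop
    exact this.aestronglyMeasurable
  · have h2 := norm_testFn_le s x
    rw [Real.norm_of_nonneg (by positivity)]
    by_cases hx : x ∈ Ioi (0 : ℝ)
    · have hx0 : (0 : ℝ) < x := hx
      rw [indicator_of_mem hx] at h2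
      rw [indicator_of_mem hx, Real.norm_of_nonneg (by positivity), Real.rpow_add hx0,
        abs_of_pos hx0]
      calc _ ≤ x ^ u * (x ^ s.re * Real.exp (-(1 * x))) := by gcongr
        _ = _ := by ring
    · rw [indicator_of_notMem hx] at h2
      rw [indicator_of_notMem hx, le_antisymm h2 (norm_nonneg _)]
      simp

theorem integrable_testFn (hs : -(1 / 2 : ℝ) < s.re) : Integrable (testFn s) := by
  have := integrable_rpow_mul_testFn (s := s) (u := 0) (by linarith)
  simp only [Real.rpow_zero, one_mul] at this
  exact (integrable_norm_iff (measurable_testFn s).aestronglyMeasurable).1 this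

theorem memLp_testFn (hs : -(1 / 2 : ℝ) < s.re) : MemLp (testFn s) 2 := by
  rw [memLp_two_iff_integrable_sq_norm (measurable_testFn s).aestronglyMeasurable]
  have h1 := (integrable_indicator_iff measurableSet_Ioi).2
    (integrableOn_rpow_mul_exp (u := s.re + s.re) (by linarith) two_pos)
  refine Integrable.mono h1 ((measurable_testFn s).norm.pow_const 2).aestronglyMeasurable
    (ae_of_all _ fun x => ?_)
  have h2 := norm_testFn_le s x
  by_cases hx : x ∈ Ioi (0 : ℝ)
  · have hx0 : (0 : ℝ) < x := hx
    rw [indicator_of_mem hx] at h2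
    rw [indicator_of_mem hx, Real.norm_of_nonneg (by positivity),
      Real.norm_of_nonneg (by positivity), Real.rpow_add hx0]
    calc _ ≤ (x ^ s.re * Real.exp (-(1 * x))) ^ 2 := by gcongr
      _ = x ^ s.re * x ^ s.re * (Real.exp (-(1 * x)) * Real.exp (-(1 * x))) := by ring
      _ = _ := by rw [← Real.exp_add]; ring_nf
  · rw [indicator_of_notMem hx] at h2
    rw [indicator_of_notMem hx, le_antisymm h2 (norm_nonneg _)]
    simp

/-- The kernel depends on wx alone, so dilations of the input become inverse dilations of the
output. Negative p is allowed in order to reach the left half-line. -/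
theorem integral_genExp_mul_testFn (hs : -(1 / 2 : ℝ) < s.re) {w p : ℝ} (hw : w ≠ 0)
    (hp : p ≠ 0) :
    ∫ x, genExp s (w * x) * testFn s (p * x) = |p|⁻¹ * testImage s (w / p) := by
  have h1 := Measure.integral_comp_mul_left (fun y => genExp s (w / p * y) * testFn s y) p
  have h2 : ∀ x, genExp s (w / p * (p * x)) = genExp s (w * x) := fun x => by
    congr 1; field_simp
  simp only [h2] at h1
  rw [h1, abs_inv, Complex.real_smul, Complex.ofReal_inv]
  congr 1
  rw [← integral_genExp_mul hs (div_ne_zero hw hp), ← integral_indicator measurableSet_Ioi]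
  refine integral_congr_ae (ae_of_all _ fun x => ?_)
  by_cases hx : x ∈ Ioi (0 : ℝ) <;> simp [testFn, hx]

end TestFunctions

/-! ### Completeness of the dilated test functions. -/

section LaplaceUniqueness

theorem continuousOn_comp_neg_log {g : ℝ → ℝ} (hg : Continuous g) (hc : HasCompactSupport g)
    (hs : tsupport g ⊆ Ioi 0) : ContinuousOn (fun y => g (-Real.log y)) (Icc 0 1) := by
  intro y hy
  rcases hy.1.eq_or_lt with h | h
  · subst h
    obtain ⟨M, hM⟩ := hc.isCompact.isBounded.subset_closedBall (0 : ℝ)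
    -- By convention `Real.log 0 = 0`, so the value at the endpoint y = 0 is g 0; it agrees with the
    -- limit, which is zero as the support is bounded.
    have h0 : g 0 = 0 := image_eq_zero_of_notMem_tsupport fun h => lt_irrefl (0 : ℝ) (hs h)
    have h1 : ∀ᶠ y in 𝓝[Icc (0 : ℝ) 1] 0, g (-Real.log y) = 0 := by
      filter_upwards [nhdsWithin_le_nhds (gt_mem_nhds (Real.exp_pos (-(|M| + 1)))),
        self_mem_nhdsWithin] with y hy hy'
      rcases hy'.1.eq_or_lt with h | h
      · rw [← h, Real.log_zero, neg_zero, h0]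
      · refine image_eq_zero_of_notMem_tsupport fun h' => ?_
        have h2 := hM h'
        rw [mem_closedBall_zero_iff, Real.norm_eq_abs] at h2
        have h3 := (Real.log_lt_iff_lt_exp h).2 hy
        linarith [le_abs_self (-Real.log y), le_abs_self M]
    have h2 : Tendsto (fun y => g (-Real.log y)) (𝓝[Icc (0 : ℝ) 1] 0) (𝓝 0) :=
      tendsto_const_nhds.congr' (h1.mono fun y hy => hy.symm)
    simpa [ContinuousWithinAt, h0] using h2
  · exact (hg.continuousAt.comp (Real.continuousAt_log h.ne').neg).continuousWithinAt

/-- Uniqueness for the Laplace transform, sampled at the positive integers. -/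
theorem ae_eq_zero_of_laplace_eq_zero {h : ℝ → ℂ}
    (hi : IntegrableOn (fun x : ℝ => Complex.exp (-x) * h x) (Ioi 0))
    (h0 : ∀ n : ℕ, ∫ x in Ioi (0 : ℝ), Complex.exp (-((n + 1) * x)) * h x = 0) :
    ∀ᵐ x : ℝ, x ∈ Ioi 0 → h x = 0 := by
  set G : ℝ → ℂ := fun x => Complex.exp (-x) * h x with hG
  suffices hGz : ∀ᵐ x : ℝ, x ∈ Ioi 0 → G x = 0 by
    filter_upwards [hGz] with x hx hx0
    exact (mul_eq_zero.1 (hx hx0)).resolve_left (Complex.exp_ne_zero _)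
  -- In the variable y = e^{-x} the hypotheses are vanishing moments, so G annihilates every
  -- polynomial in y. Weierstrass approximation on [0,1] then reaches all test functions.
  have hpoly : ∀ P : ℝ[X], IntegrableOn (fun x => P.eval (Real.exp (-x)) • G x) (Ioi 0) ∧
      ∫ x in Ioi (0 : ℝ), P.eval (Real.exp (-x)) • G x = 0 := by
    intro P
    have hk : ∀ k : ℕ, IntegrableOn (fun x => (P.coeff k * Real.exp (-x) ^ k) • G x) (Ioi 0) ∧
        ∫ x in Ioi (0 : ℝ), (P.coeff k * Real.exp (-x) ^ k) • G x = 0 := by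
      intro k
      constructor
      · refine Integrable.mono (hi.norm.const_mul |P.coeff k|)
          ((by fun_prop : Continuous fun x => P.coeff k * Real.exp (-x) ^ k).aestronglyMeasurable.smul
            hi.aestronglyMeasurable) ?_
        refine (ae_restrict_iff' measurableSet_Ioi).2 (ae_of_all _ fun x hx => ?_)
        have hx0 : (0 : ℝ) < x := hx
        rw [norm_smul, Real.norm_of_nonneg (by positivity : 0 ≤ |P.coeff k| * ‖Complex.exp (-x) * h x‖),
          norm_mul, Real.norm_eq_abs]
        refine mul_le_mul_of_nonneg_right ?_ (norm_nonneg _)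
        refine mul_le_of_le_one_right (abs_nonneg _) ?_
        rw [norm_pow, Real.norm_of_nonneg (Real.exp_pos _).le]
        exact pow_le_one₀ (Real.exp_pos _).le (Real.exp_le_one_iff.2 (by linarith))
      · have : ∀ x : ℝ, (P.coeff k * Real.exp (-x) ^ k) • G x =
            (P.coeff k : ℂ) * (Complex.exp (-((k + 1) * x)) * h x) := fun x => by
          rw [hG, Complex.real_smul]
          simp only
          push_cast
          rw [← Complex.exp_nat_mul, mul_assoc, ← mul_assoc (Complex.exp _), ← Complex.exp_add]
          congr 3; ring
        simp_rw [this]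
        rw [integral_const_mul, h0, mul_zero]
    simp_rw [Polynomial.eval_eq_sum_range, Finset.sum_smul]
    refine ⟨integrable_finsetSum _ fun k _ => (hk k).1, ?_⟩
    rw [integral_finsetSum _ fun k _ => (hk k).1]
    exact Finset.sum_eq_zero fun k _ => (hk k).2
  refine isOpen_Ioi.ae_eq_zero_of_integral_contDiff_smul_eq_zero hi.locallyIntegrableOn
    fun g hg hc hs => ?_
  have hsupp : ∫ x, g x • G x = ∫ x in Ioi (0 : ℝ), g x • G x := by
    refine (setIntegral_eq_integral_of_forall_compl_eq_zero fun x hx => ?_).symm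
    rw [image_eq_zero_of_notMem_tsupport fun h => hx (hs h), zero_smul]
  rw [hsupp, ← norm_le_zero_iff]
  set A := ∫ x in Ioi (0 : ℝ), ‖G x‖ with hA
  have hA0 : 0 ≤ A := integral_nonneg fun x => norm_nonneg _
  refine le_of_forall_pos_le_add fun ε hε => ?_
  obtain ⟨P, hP⟩ := exists_polynomial_near_of_continuousOn 0 1 _
    (continuousOn_comp_neg_log hg.continuous hc hs) (ε / (A + 1)) (by positivity)
  have hb : ∀ x ∈ Ioi (0 : ℝ), |g x - P.eval (Real.exp (-x))| ≤ ε / (A + 1) := fun x hx => by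
    have hx0 : (0 : ℝ) < x := hx
    have := hP (Real.exp (-x)) ⟨(Real.exp_pos _).le, Real.exp_le_one_iff.2 (by linarith)⟩
    rw [Real.log_exp, neg_neg, abs_sub_comm] at this
    exact this.le
  have hgi : IntegrableOn (fun x => g x • G x) (Ioi 0) := by
    obtain ⟨M, hM⟩ := hc.exists_bound_of_continuous hg.continuous
    exact Integrable.bdd_smul hi M hg.continuous.aestronglyMeasurable (ae_of_all _ hM)
  have heq : ∫ x in Ioi (0 : ℝ), g x • G x =
      ∫ x in Ioi (0 : ℝ), (g x - P.eval (Real.exp (-x))) • G x := by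
    simp_rw [sub_smul]
    rw [integral_sub hgi (hpoly P).1, (hpoly P).2, sub_zero]
  rw [heq, zero_add]
  calc _ ≤ ∫ x in Ioi (0 : ℝ), ε / (A + 1) * ‖G x‖ := by
        refine norm_integral_le_of_norm_le (hi.norm.const_mul _) ?_
        refine (ae_restrict_iff' measurableSet_Ioi).2 (ae_of_all _ fun x hx => ?_)
        rw [norm_smul, Real.norm_eq_abs]
        exact mul_le_mul_of_nonneg_right (hb x hx) (norm_nonneg _)
    _ = ε / (A + 1) * A := by rw [integral_const_mul]
    _ ≤ ε := by
        rw [div_mul_eq_mul_div, div_le_iff₀ (by positivity)]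
        nlinarith

variable {s : ℂ}

theorem testFn_mul {p x : ℝ} (hp : 0 < p) (hx : 0 < x) :
    testFn s (p * x) = (p : ℂ) ^ conj s * (Complex.exp (-(p * x)) * (x : ℂ) ^ conj s) := by
  have h : p * x ∈ Ioi (0 : ℝ) := mul_pos hp hx
  rw [testFn, indicator_of_mem h, Complex.ofReal_mul, Complex.mul_cpow_ofReal_nonneg hp.le hx.le]
  ring

theorem testFn_of_nonpos {x : ℝ} (hx : x ≤ 0) : testFn s x = 0 :=
  indicator_of_notMem (fun h : 0 < x => not_lt.2 hx h) _

theorem ae_eq_zero_of_integral_testFn_pos {h : ℝ → ℂ}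
    (hi : ∀ p : ℝ, 0 < p → Integrable fun x => h x * testFn s (p * x))
    (h0 : ∀ p : ℝ, 0 < p → ∫ x, h x * testFn s (p * x) = 0) :
    ∀ᵐ x : ℝ, x ∈ Ioi 0 → h x = 0 := by
  have hset : ∀ p : ℝ, 0 < p → ∀ x ∈ Ioi (0 : ℝ), h x * testFn s (p * x) =
      (p : ℂ) ^ conj s * (Complex.exp (-(p * x)) * ((x : ℂ) ^ conj s * h x)) := fun p hp x hx => by
    rw [testFn_mul hp hx]; ring
  have hp0 : ∀ p : ℝ, 0 < p → (p : ℂ) ^ conj s ≠ 0 := fun p hp => by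
    rw [Ne, Complex.cpow_eq_zero_iff]
    exact fun h => hp.ne' (by exact_mod_cast h.1)
  have key : ∀ᵐ x : ℝ, x ∈ Ioi 0 → (x : ℂ) ^ conj s * h x = 0 := by
    refine ae_eq_zero_of_laplace_eq_zero ?_ fun n => ?_
    · have h1 := (integrableOn_congr_fun (hset 1 one_pos) measurableSet_Ioi).1
        (hi 1 one_pos).integrableOn
      simpa using h1
    · have hn : (0 : ℝ) < n + 1 := by positivity
      have h1 := h0 (n + 1) hn
      rw [← setIntegral_eq_integral_of_forall_compl_eq_zero (s := Ioi 0) fun x hx => by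
        rw [testFn_of_nonpos (mul_nonpos_of_nonneg_of_nonpos hn.le (not_lt.1 hx)), mul_zero],
        setIntegral_congr_fun measurableSet_Ioi (hset _ hn), integral_const_mul] at h1
      simpa using (mul_eq_zero.1 h1).resolve_left (hp0 _ hn)
  filter_upwards [key] with x hx hx0
  exact (mul_eq_zero.1 (hx hx0)).resolve_left (hp0 x hx0)

/-- Positive dilates see only the right half-line and negative ones only the left, so the one-sided
result is applied to h and to its reflection. -/
theorem ae_eq_zero_of_integral_testFn {h : ℝ → ℂ}
    (hi : ∀ p : ℝ, p ≠ 0 → Integrable fun x => h x * testFn s (p * x))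
    (h0 : ∀ p : ℝ, p ≠ 0 → ∫ x, h x * testFn s (p * x) = 0) : ∀ᵐ x : ℝ, h x = 0 := by
  have h1 := ae_eq_zero_of_integral_testFn_pos (fun p hp => hi p hp.ne') fun p hp => h0 p hp.ne'
  have h2 : ∀ᵐ x : ℝ, x ∈ Ioi 0 → h (-x) = 0 := by
    refine ae_eq_zero_of_integral_testFn_pos (s := s) (h := fun x => h (-x))
      (fun p hp => ?_) fun p hp => ?_
    · simpa using (hi (-p) (by simpa using hp.ne')).comp_neg
    · have := integral_neg_eq_self (fun x => h x * testFn s (-p * x)) volume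
      rw [h0 (-p) (by simpa using hp.ne')] at this
      simpa using this
  have h3 := (Measure.measurePreserving_neg (volume : Measure ℝ)).quasiMeasurePreserving.ae h2
  filter_upwards [h1, h3, compl_mem_ae_iff.2 (measure_singleton (0 : ℝ))] with x hx hx' hx0
  rcases lt_or_gt_of_ne (show x ≠ 0 from hx0) with h | h
  · simpa using hx' (by simpa using h)
  · exact hx h

end LaplaceUniqueness

/-! ### Plancherel for Fourier integrals on L¹ ∩ L². -/

section Plancherel

open scoped FourierTransform SchwartzMap ContDiff

theorem integral_mul_fourier_eq {f g : ℝ → ℂ} (hf : Integrable f) (hg : Integrable g) :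
    ∫ ξ, 𝓕 f ξ * g ξ = ∫ x, f x * 𝓕 g x := by
  have := VectorFourier.integral_fourierIntegral_smul_eq_flip (L := innerₗ ℝ) (μ := volume)
    (ν := volume) Real.continuous_fourierChar continuous_inner hf hg
  rw [flip_innerₗ] at this
  exact this

/-- On `L¹ ∩ L²` the `L²` Fourier transform is given by the Fourier integral. -/
theorem coeFn_fourier_toLp {f : ℝ → ℂ} (hf : Integrable f) (hf2 : MemLp f 2) :
    ((𝓕 (hf2.toLp f) : L2) : ℝ → ℂ) =ᵐ[volume] 𝓕 f := by
  have hcont : Continuous (𝓕 f) :=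
    VectorFourier.fourierIntegral_continuous Real.continuous_fourierChar continuous_inner hf
  refine ae_eq_of_integral_contDiff_smul_eq ((Lp.memLp _).locallyIntegrable (by norm_num))
    hcont.locallyIntegrable fun g hg hc => ?_
  have hg₁ : HasCompactSupport (Complex.ofRealCLM ∘ g) := hc.comp_left rfl
  have hg₂ : ContDiff ℝ ∞ (Complex.ofRealCLM ∘ g) := by fun_prop
  set φ : 𝓢(ℝ, ℂ) := hg₁.toSchwartzMap hg₂ with hφ
  have hφg : ∀ x, φ x = (g x : ℂ) := fun x => rfl
  -- As a tempered distribution the L² transform is defined by moving 𝓕 onto φ; the multiplication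
  -- formula moves it back onto f.
  have h1 := congrArg (fun T => T φ) (Lp.fourier_toTemperedDistribution_eq (hf2.toLp f))
  simp only [TemperedDistribution.fourier_apply, Lp.toTemperedDistribution_apply] at h1
  have h2 := integral_mul_fourier_eq φ.integrable hf
  calc ∫ x, g x • (𝓕 (hf2.toLp f) : L2) x = ∫ x, φ x • (𝓕 (hf2.toLp f) : L2) x := by
        simp [hφg]
    _ = ∫ x, (𝓕 φ) x • (hf2.toLp f) x := h1.symm
    _ = ∫ x, 𝓕 (φ : ℝ → ℂ) x * f x := by
        refine integral_congr_ae ?_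
        filter_upwards [hf2.coeFn_toLp] with x hx
        rw [hx, smul_eq_mul, SchwartzMap.fourier_coe]
    _ = ∫ x, φ x * 𝓕 f x := h2
    _ = _ := by simp [hφg]

theorem memLp_fourier {f : ℝ → ℂ} (hf : Integrable f) (hf2 : MemLp f 2) : MemLp (𝓕 f) 2 :=
  (memLp_congr_ae (coeFn_fourier_toLp hf hf2)).1 (Lp.memLp _)

theorem integral_fourier_mul_conj {f g : ℝ → ℂ} (hf : Integrable f) (hf2 : MemLp f 2)
    (hg : Integrable g) (hg2 : MemLp g 2) :
    ∫ ξ, 𝓕 f ξ * conj (𝓕 g ξ) = ∫ x, f x * conj (g x) := by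
  have h := Lp.inner_fourier_eq (hg2.toLp g) (hf2.toLp f)
  rw [L2.inner_def, L2.inner_def] at h
  have h1 : ∫ ξ, 𝓕 f ξ * conj (𝓕 g ξ) =
      ∫ ξ, ⟪(𝓕 (hg2.toLp g) : L2) ξ, (𝓕 (hf2.toLp f) : L2) ξ⟫_ℂ := by
    refine integral_congr_ae ?_
    filter_upwards [coeFn_fourier_toLp hf hf2, coeFn_fourier_toLp hg hg2] with x h1 h2
    rw [h1, h2, RCLike.inner_apply]
  have h2 : ∫ x, f x * conj (g x) = ∫ ξ, ⟪(hg2.toLp g) ξ, (hf2.toLp f) ξ⟫_ℂ := by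
    refine integral_congr_ae ?_
    filter_upwards [hf2.coeFn_toLp, hg2.coeFn_toLp] with x h1 h2
    rw [h1, h2, RCLike.inner_apply]
  rw [h1, h2, h]

end Plancherel

/-! ### The substitution w = -1/(2πξ). -/

section Inversion

/-- The map is an involution off the origin, which supplies the preimage. It is chosen so that iw =
1/(2πiξ). -/
theorem image_neg_inv_two_pi :
    (fun ξ : ℝ => -(2 * Real.pi * ξ)⁻¹) '' {0}ᶜ = {0}ᶜ := by
  ext w
  simp only [mem_image, mem_compl_iff, mem_singleton_iff]
  constructor
  · rintro ⟨ξ, h, rfl⟩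
    simp [h, Real.pi_ne_zero]
  · intro h
    refine ⟨-(2 * Real.pi * w)⁻¹, by simp [h, Real.pi_ne_zero], ?_⟩
    have := Real.pi_ne_zero
    field_simp

theorem hasDerivWithinAt_neg_inv_two_pi (ξ : ℝ) (hξ : ξ ∈ ({0}ᶜ : Set ℝ)) :
    HasDerivWithinAt (fun ξ : ℝ => -(2 * Real.pi * ξ)⁻¹) ((2 * Real.pi * ξ ^ 2)⁻¹) {0}ᶜ ξ := by
  have h0 : ξ ≠ 0 := hξ
  have hpi := Real.pi_ne_zero
  have h1 : HasDerivAt (fun ξ : ℝ => 2 * Real.pi * ξ) (2 * Real.pi) ξ := by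
    simpa using (hasDerivAt_id ξ).const_mul (2 * Real.pi)
  refine ((h1.inv (by positivity)).neg.congr_deriv ?_).hasDerivWithinAt
  field_simp

theorem injOn_neg_inv_two_pi : InjOn (fun ξ : ℝ => -(2 * Real.pi * ξ)⁻¹) {0}ᶜ := by
  intro x _ y _ h
  have hpi := Real.pi_ne_zero
  simpa [hpi] using h

theorem restrict_compl_zero : (volume : Measure ℝ).restrict {0}ᶜ = volume :=
  Measure.restrict_eq_self_of_ae_mem (s := {0}ᶜ) (compl_mem_ae_iff.2 (measure_singleton (0 : ℝ)))

variable (F : ℝ → ℂ)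

theorem integral_comp_neg_inv_two_pi :
    ∫ w, F w = ∫ ξ, ((2 * Real.pi * ξ ^ 2)⁻¹ : ℝ) • F (-(2 * Real.pi * ξ)⁻¹) := by
  have h := integral_image_eq_integral_abs_deriv_smul (measurableSet_singleton (0 : ℝ)).compl
    hasDerivWithinAt_neg_inv_two_pi injOn_neg_inv_two_pi F
  rw [image_neg_inv_two_pi, restrict_compl_zero] at h
  rw [h]
  congr 1; ext ξ
  rw [abs_of_nonneg]
  positivity

theorem integrable_comp_neg_inv_two_pi :
    Integrable F ↔
      Integrable fun ξ => ((2 * Real.pi * ξ ^ 2)⁻¹ : ℝ) • F (-(2 * Real.pi * ξ)⁻¹) := by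
  have h := integrableOn_image_iff_integrableOn_abs_deriv_smul
    (measurableSet_singleton (0 : ℝ)).compl
    hasDerivWithinAt_neg_inv_two_pi injOn_neg_inv_two_pi F
  rw [image_neg_inv_two_pi, IntegrableOn, IntegrableOn, restrict_compl_zero] at h
  rw [h]
  have : ∀ ξ : ℝ, |(2 * Real.pi * ξ ^ 2)⁻¹| = (2 * Real.pi * ξ ^ 2)⁻¹ := fun ξ =>
    abs_of_nonneg (by positivity)
  simp_rw [this]

end Inversion

/-! ### Gram matrices of the test functions and of their images. -/

section Gram

open scoped FourierTransform

variable {s : ℂ}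

theorem conj_testFn (s : ℂ) (x : ℝ) : conj (testFn (conj s) x) = testFn s x := by
  by_cases hx : x ∈ Ioi (0 : ℝ)
  · rw [testFn, testFn, indicator_of_mem hx, indicator_of_mem hx, map_mul, conj_ofReal_cpow hx,
      Complex.conj_conj, ← Complex.exp_conj]
    simp
  · rw [testFn, testFn, indicator_of_notMem hx, indicator_of_notMem hx, map_zero]

theorem fourier_testFn (hs : -(1 / 2 : ℝ) < s.re) (ξ : ℝ) :
    𝓕 (testFn (conj s)) ξ =
      (1 + 2 * Real.pi * Complex.I * ξ) ^ (-(1 + s)) * Complex.Gamma (1 + s) := by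
  rw [Real.fourier_real_eq_integral_exp_smul,
    ← integral_cpow_mul_exp_neg_mul (a := 1 + s) (by simp; linarith)
      (r := 1 + 2 * Real.pi * Complex.I * ξ) (by simp), ← integral_indicator measurableSet_Ioi]
  refine integral_congr_ae (ae_of_all _ fun x => ?_)
  by_cases hx : x ∈ Ioi (0 : ℝ)
  · simp only [testFn, indicator_of_mem hx, Complex.conj_conj, smul_eq_mul, add_sub_cancel_left]
    rw [mul_left_comm, ← Complex.exp_add, mul_comm]
    congr 2
    push_cast
    ring
  · simp [testFn, indicator_of_notMem hx]

theorem fourier_dilate (f : ℝ → ℂ) {p : ℝ} (hp : p ≠ 0) (ξ : ℝ) :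
    𝓕 (fun x => ((|p|⁻¹ : ℝ) : ℂ) * f (p⁻¹ * x)) ξ = 𝓕 f (p * ξ) := by
  rw [Real.fourier_real_eq_integral_exp_smul, Real.fourier_real_eq_integral_exp_smul]
  have h := Measure.integral_comp_mul_left
    (fun v : ℝ => Complex.exp (↑(-2 * Real.pi * v * (p * ξ)) * Complex.I) • f v) p⁻¹
  rw [inv_inv, Complex.real_smul] at h
  have hp' : ((|p| : ℝ) : ℂ) ≠ 0 := by exact_mod_cast (abs_pos.2 hp).ne'
  rw [← mul_right_inj' hp', ← h, ← integral_const_mul]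
  congr 1; ext x
  rw [show -2 * Real.pi * (p⁻¹ * x) * (p * ξ) = -2 * Real.pi * x * ξ by field_simp]
  push_cast
  simp only [smul_eq_mul]
  field_simp

/-- With q = 2πiξ the powers combine as q^{-s} (1 + 1/q)^{-(1+s)} = q (1+q)^{-(1+s)}, and
(1+q)^{-(1+s)} Γ(1+s) is the Fourier transform of x^s e^{-x} on the half-line. -/
theorem testImage_neg_inv (hs : -(1 / 2 : ℝ) < s.re) {ξ : ℝ} (hξ : ξ ≠ 0) :
    testImage s (-(2 * Real.pi * ξ)⁻¹) =
      2 * Real.pi * Complex.I * ξ / (Real.sqrt (2 * Real.pi) : ℂ) * 𝓕 (testFn (conj s)) ξ := by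
  set q : ℂ := 2 * Real.pi * Complex.I * ξ with hq
  have hpi : (Real.pi : ℂ) ≠ 0 := by exact_mod_cast Real.pi_ne_zero
  have hξ' : (ξ : ℂ) ≠ 0 := by exact_mod_cast hξ
  have hq0 : q ≠ 0 := by simp [hq, hpi, hξ']
  have h1 : Complex.I * ((-(2 * Real.pi * ξ)⁻¹ : ℝ) : ℂ) = q⁻¹ := by
    push_cast
    rw [hq]
    field_simp
    simp
  have harg : q.arg ≠ Real.pi := by
    rw [Ne, Complex.arg_eq_pi_iff]
    simp [hq]
  have hq1 : 1 + q ≠ 0 := fun h => by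
    have := congrArg Complex.re h
    simp [hq] at this
  -- No branch is crossed: |arg (1+q)| < π/2 and |arg q| ≤ π/2.
  have hlog : Complex.log (1 + q⁻¹) = Complex.log (1 + q) - Complex.log q := by
    rw [show 1 + q⁻¹ = (1 + q) * q⁻¹ by field_simp; ring, Complex.log_mul hq1 (inv_ne_zero hq0),
      Complex.log_inv _ harg, sub_eq_add_neg]
    rw [Complex.arg_inv, if_neg harg]
    have h2 : |(1 + q).arg| < Real.pi / 2 := by
      rw [Complex.abs_arg_lt_pi_div_two_iff]; left; simp [hq]
    have h3 : |q.arg| ≤ Real.pi / 2 := by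
      rw [Complex.abs_arg_le_pi_div_two_iff]; simp [hq]
    have h4 := abs_lt.1 h2
    have h5 := abs_le.1 h3
    constructor <;> linarith [h4.1, h4.2, h5.1, h5.2]
  have hq2 : 1 + q⁻¹ ≠ 0 := by
    rw [show 1 + q⁻¹ = (1 + q) * q⁻¹ by field_simp; ring]
    exact mul_ne_zero hq1 (inv_ne_zero hq0)
  have h6 : (q⁻¹) ^ s * (1 + q⁻¹) ^ (-(1 + s)) = q * (1 + q) ^ (-(1 + s)) := by
    rw [Complex.cpow_def_of_ne_zero (inv_ne_zero hq0), Complex.cpow_def_of_ne_zero hq2,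
      Complex.cpow_def_of_ne_zero hq1, hlog, Complex.log_inv _ harg, ← Complex.exp_add]
    rw [show -Complex.log q * s + (Complex.log (1 + q) - Complex.log q) * -(1 + s) =
      Complex.log q + Complex.log (1 + q) * -(1 + s) by ring, Complex.exp_add,
      Complex.exp_log hq0]
  rw [testImage, h1, fourier_testFn hs, ← hq, mul_assoc, h6]
  ring

/-- The transform of the dilated test function. -/
def dilatedImage (s : ℂ) (p w : ℝ) : ℂ := ((|p|⁻¹ : ℝ) : ℂ) * testImage s (w / p)

/-- The Jacobian 1/(2πξ²) cancels the factors 2πiξ and 1/√(2π) of the two images exactly, leaving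
only the sign of pr. -/
theorem smul_dilatedImage_mul_conj (hs : -(1 / 2 : ℝ) < s.re) {p r ξ : ℝ} (hp : p ≠ 0)
    (hr : r ≠ 0) (hξ : ξ ≠ 0) :
    ((2 * Real.pi * ξ ^ 2)⁻¹ : ℝ) • (dilatedImage s p (-(2 * Real.pi * ξ)⁻¹) *
      conj (dilatedImage s r (-(2 * Real.pi * ξ)⁻¹))) =
    ((p * r / (|p| * |r|) : ℝ) : ℂ) *
      (𝓕 (testFn (conj s)) (p * ξ) * conj (𝓕 (testFn (conj s)) (r * ξ))) := by
  have h : ∀ t : ℝ, -(2 * Real.pi * ξ)⁻¹ / t = -(2 * Real.pi * (t * ξ))⁻¹ := fun t => by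
    rw [mul_inv, mul_inv, mul_inv, mul_inv]; ring
  rw [dilatedImage, dilatedImage, h, h, testImage_neg_inv hs (mul_ne_zero hp hξ),
    testImage_neg_inv hs (mul_ne_zero hr hξ)]
  generalize 𝓕 (testFn (conj s)) (p * ξ) = A
  generalize 𝓕 (testFn (conj s)) (r * ξ) = B
  have hpi : (Real.pi : ℂ) ≠ 0 := by exact_mod_cast Real.pi_ne_zero
  have hξ' : (ξ : ℂ) ≠ 0 := by exact_mod_cast hξ
  have h2 : (Real.sqrt (2 * Real.pi) : ℂ) ^ 2 = 2 * Real.pi := by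
    rw [← Complex.ofReal_pow, Real.sq_sqrt (by positivity)]; push_cast; ring
  have h3 : (Real.sqrt (2 * Real.pi) : ℂ) ≠ 0 := by
    exact_mod_cast (Real.sqrt_pos.2 (by positivity)).ne'
  have hp' : ((|p| : ℝ) : ℂ) ≠ 0 := by exact_mod_cast (abs_pos.2 hp).ne'
  have hr' : ((|r| : ℝ) : ℂ) ≠ 0 := by exact_mod_cast (abs_pos.2 hr).ne'
  have h4 : conj (2 : ℂ) = 2 := map_ofNat _ 2
  simp only [map_mul, map_div₀, Complex.conj_ofReal, Complex.conj_I, h4, Complex.real_smul]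
  push_cast
  field_simp
  rw [h2, Complex.I_sq]
  ring

theorem integrable_dilated_testFn (hs : -(1 / 2 : ℝ) < s.re) {p : ℝ} (hp : p ≠ 0) :
    Integrable fun x => testFn s (p * x) := (integrable_testFn hs).comp_mul_left' hp

theorem memLp_dilated {f : ℝ → ℂ} (hf : MemLp f 2) {p : ℝ} (hp : p ≠ 0) :
    MemLp (fun x => f (p * x)) 2 := by
  have hm : AEStronglyMeasurable (fun x => f (p * x)) volume :=
    hf.1.comp_quasiMeasurePreserving 
      ⟨by fun_prop, by rw [Real.map_volume_mul_left hp]; exact Measure.smul_absolutelyContinuous⟩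
  rw [memLp_two_iff_integrable_sq_norm hm]
  exact ((memLp_two_iff_integrable_sq_norm hf.1).1 hf).comp_mul_left' hp

theorem memLp_dilated_testFn (hs : -(1 / 2 : ℝ) < s.re) {p : ℝ} (hp : p ≠ 0) :
    MemLp (fun x => testFn s (p * x)) 2 := memLp_dilated (memLp_testFn hs) hp

theorem measurable_dilatedImage (s : ℂ) (p : ℝ) : Measurable (dilatedImage s p) := by
  have := measurable_testImage s
  unfold dilatedImage
  fun_prop

theorem memLp_fourier_testFn (hs : -(1 / 2 : ℝ) < s.re) : MemLp (𝓕 (testFn (conj s))) 2 :=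
  memLp_fourier (integrable_testFn (by simpa using hs)) (memLp_testFn (by simpa using hs))

theorem integrable_fourier_mul (hs : -(1 / 2 : ℝ) < s.re) {p r : ℝ} (hp : p ≠ 0) (hr : r ≠ 0) :
    Integrable fun ξ => 𝓕 (testFn (conj s)) (p * ξ) * conj (𝓕 (testFn (conj s)) (r * ξ)) :=
  (memLp_dilated (memLp_fourier_testFn hs) hp).integrable_mul
    (memLp_dilated (memLp_fourier_testFn hs) hr).star

theorem ae_ne_zero : ∀ᵐ x : ℝ, x ≠ 0 := compl_mem_ae_iff.2 (measure_singleton (0 : ℝ))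

theorem memLp_dilatedImage (hs : -(1 / 2 : ℝ) < s.re) {p : ℝ} (hp : p ≠ 0) :
    MemLp (dilatedImage s p) 2 := by
  rw [memLp_two_iff_integrable_sq_norm (measurable_dilatedImage s p).aestronglyMeasurable]
  have h1 : Integrable fun w => dilatedImage s p w * conj (dilatedImage s p w) := by
    rw [integrable_comp_neg_inv_two_pi]
    refine ((integrable_fourier_mul hs hp hp).const_mul ((p * p / (|p| * |p|) : ℝ) : ℂ)).congr ?_
    · filter_upwards [ae_ne_zero] with ξ hξ
      exact (smul_dilatedImage_mul_conj hs hp hp hξ).symm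
  refine h1.norm.congr (ae_of_all _ fun w => ?_)
  simp only [norm_mul, RCLike.norm_conj]
  ring

/-- Plancherel gives the inner product of the dilates by 1/p and 1/r with s̄ in place of s.
Rescaling x by pr exchanges the roles of p and r, and conjugation restores s. -/
theorem integral_dilatedImage_mul_conj (hs : -(1 / 2 : ℝ) < s.re) {p r : ℝ} (hp : p ≠ 0)
    (hr : r ≠ 0) :
    ∫ w, dilatedImage s p w * conj (dilatedImage s r w) =
      ∫ x, testFn s (p * x) * conj (testFn s (r * x)) := by
  have hs' : -(1 / 2 : ℝ) < (conj s).re := by simpa using hs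
  have hd : ∀ {p : ℝ}, p ≠ 0 →
      Integrable (fun x => ((|p|⁻¹ : ℝ) : ℂ) * testFn (conj s) (p⁻¹ * x)) ∧
      MemLp (fun x => ((|p|⁻¹ : ℝ) : ℂ) * testFn (conj s) (p⁻¹ * x)) 2 := fun hp =>
    ⟨(integrable_dilated_testFn hs' (inv_ne_zero hp)).const_mul _,
      (memLp_dilated_testFn hs' (inv_ne_zero hp)).const_mul _⟩
  have h1 := integral_fourier_mul_conj (hd hp).1 (hd hp).2 (hd hr).1 (hd hr).2
  simp only [fourier_dilate _ hp, fourier_dilate _ hr] at h1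
  rw [integral_comp_neg_inv_two_pi, integral_congr_ae (g := fun ξ =>
    ((p * r / (|p| * |r|) : ℝ) : ℂ) *
      (𝓕 (testFn (conj s)) (p * ξ) * conj (𝓕 (testFn (conj s)) (r * ξ)))) (by
      filter_upwards [ae_ne_zero] with ξ hξ using smul_dilatedImage_mul_conj hs hp hr hξ),
    integral_const_mul, h1]
  have h2 := Measure.integral_comp_mul_left (fun x => ((|p|⁻¹ : ℝ) : ℂ) * testFn (conj s) (p⁻¹ * x) *
    conj (((|r|⁻¹ : ℝ) : ℂ) * testFn (conj s) (r⁻¹ * x))) (p * r)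
  have hpr : p * r ≠ 0 := mul_ne_zero hp hr
  have hp' : ((|p| : ℝ) : ℂ) ≠ 0 := by exact_mod_cast (abs_pos.2 hp).ne'
  have hr' : ((|r| : ℝ) : ℂ) ≠ 0 := by exact_mod_cast (abs_pos.2 hr).ne'
  have h3 : ∫ x, ((|p|⁻¹ : ℝ) : ℂ) * testFn (conj s) (p⁻¹ * x) *
      conj (((|r|⁻¹ : ℝ) : ℂ) * testFn (conj s) (r⁻¹ * x)) =
      ∫ x, testFn (conj s) (r * x) * testFn s (p * x) := by
    rw [abs_inv, Complex.real_smul, abs_mul] at h2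
    have h4 : ∀ I : ℂ, I = ((|p| * |r| : ℝ) : ℂ) * ((((|p| * |r|)⁻¹ : ℝ) : ℂ) * I) := fun I => by
      push_cast; field_simp
    rw [h4 (∫ x, ((|p|⁻¹ : ℝ) : ℂ) * testFn (conj s) (p⁻¹ * x) *
      conj (((|r|⁻¹ : ℝ) : ℂ) * testFn (conj s) (r⁻¹ * x))), ← h2, ← integral_const_mul]
    congr 1; ext x
    rw [show p⁻¹ * (p * r * x) = r * x by field_simp, show r⁻¹ * (p * r * x) = p * x by field_simp,
      map_mul, conj_testFn, Complex.conj_ofReal]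
    push_cast
    field_simp
  rw [h3, ← integral_const_mul]
  congr 1; ext x
  have h5 : conj (testFn s (r * x)) = testFn (conj s) (r * x) := by
    rw [← conj_testFn, Complex.conj_conj]
  rw [h5]
  -- Where both test functions live, pr > 0 and the sign is one; elsewhere both integrands vanish.
  by_cases h : 0 < p * x ∧ 0 < r * x
  · have hx : 0 < x ^ 2 := by
      have : x ≠ 0 := fun h0 => by simp [h0] at h
      positivity
    have h6 : 0 < p * r := by
      have := mul_pos h.1 h.2
      by_contra! h7
      nlinarith
    rw [← abs_mul, abs_of_pos h6, div_self h6.ne']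
    push_cast
    ring
  · rw [not_and_or, not_lt, not_lt] at h
    rcases h with h | h <;> simp [testFn_of_nonpos h]

/-- Rescaling turns each side into ∫ `testImage s v` · `testFn s (p r v)` dv, which is symmetric in
p and r. -/
theorem integral_dilatedImage_mul_testFn {p r : ℝ} (hp : p ≠ 0) (hr : r ≠ 0) :
    ∫ w, dilatedImage s p w * testFn s (r * w) = ∫ x, testFn s (p * x) * dilatedImage s r x := by
  have key : ∀ {p r : ℝ}, p ≠ 0 → r ≠ 0 → ∫ w, dilatedImage s p w * testFn s (r * w) =
      ∫ v, testImage s v * testFn s (r * p * v) := by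
    intro p r hp hr
    have h := Measure.integral_comp_mul_left (fun v => testImage s v * testFn s (r * p * v)) p⁻¹
    rw [inv_inv, Complex.real_smul] at h
    have hp' : ((|p| : ℝ) : ℂ) ≠ 0 := by exact_mod_cast (abs_pos.2 hp).ne'
    rw [← mul_right_inj' hp', ← h, ← integral_const_mul]
    congr 1; ext w
    rw [dilatedImage, show r * p * (p⁻¹ * w) = r * w by field_simp,
      show w / p = p⁻¹ * w by field_simp]
    push_cast
    field_simp
  rw [key hp hr]
  simp_rw [mul_comm (testFn s _) (dilatedImage s r _)]
  rw [key hr hp, mul_comm r p]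

end Gram

/-! ### Equal Gram matrices give isometries. -/

section LinearCombination

variable {ι E F : Type*} [NormedAddCommGroup E] [InnerProductSpace ℂ E] [NormedAddCommGroup F]
  [InnerProductSpace ℂ F]

theorem norm_linearCombination_eq {u : ι → E} {v : ι → F}
    (h : ∀ i j, ⟪u i, u j⟫_ℂ = ⟪v i, v j⟫_ℂ) (c : ι →₀ ℂ) :
    ‖Finsupp.linearCombination ℂ u c‖ = ‖Finsupp.linearCombination ℂ v c‖ := by
  have key : ⟪Finsupp.linearCombination ℂ u c, Finsupp.linearCombination ℂ u c⟫_ℂ =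
      ⟪Finsupp.linearCombination ℂ v c, Finsupp.linearCombination ℂ v c⟫_ℂ := by
    simp only [Finsupp.linearCombination_apply, Finsupp.sum, sum_inner, inner_sum, inner_smul_left,
      inner_smul_right, h]
  rw [inner_self_eq_norm_sq_to_K, inner_self_eq_norm_sq_to_K] at key
  have : ‖Finsupp.linearCombination ℂ u c‖ ^ 2 = ‖Finsupp.linearCombination ℂ v c‖ ^ 2 := by
    exact_mod_cast key
  exact (pow_left_inj₀ (norm_nonneg _) (norm_nonneg _) two_ne_zero).1 this

end LinearCombination

/-! ### The bilinear pairing on L₂(ℝ). -/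

section BilinearPairing

theorem norm_star_L2 (f : L2) : ‖star f‖ = ‖f‖ := by
  rw [Lp.norm_def, Lp.norm_def]
  congr 1
  refine eLpNorm_congr_norm_ae ?_
  filter_upwards [Lp.coeFn_star f] with x hx
  rw [hx, Pi.star_apply, norm_star]

theorem inner_star_left (f g : L2) : ⟪star f, g⟫_ℂ = ∫ x, f x * g x := by
  rw [L2.inner_def]
  refine integral_congr_ae ?_
  filter_upwards [Lp.coeFn_star f] with x hx
  rw [hx, RCLike.inner_apply, Pi.star_apply, mul_comm]
  simp

theorem integrable_mul_L2 (f g : L2) : Integrable fun x => f x * g x :=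
  (Lp.memLp f).integrable_mul (Lp.memLp g)

end BilinearPairing

/-! ### The unitary transform and its integral representation. -/

section Transform

variable {s : ℂ}

/-- The dilated test functions as elements of `L₂(ℝ)`. -/
def testL2 (hs : -(1 / 2 : ℝ) < s.re) (p : {p : ℝ // p ≠ 0}) : L2 :=
  (memLp_dilated_testFn hs p.2).toLp _

/-- Their transforms as elements of `L₂(ℝ)`. -/
def imageL2 (hs : -(1 / 2 : ℝ) < s.re) (p : {p : ℝ // p ≠ 0}) : L2 :=
  (memLp_dilatedImage hs p.2).toLp _

variable (hs : -(1 / 2 : ℝ) < s.re)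

theorem coeFn_testL2 (p : {p : ℝ // p ≠ 0}) :
    testL2 hs p =ᵐ[volume] fun x => testFn s (p * x) := MemLp.coeFn_toLp _

theorem coeFn_imageL2 (p : {p : ℝ // p ≠ 0}) :
    imageL2 hs p =ᵐ[volume] dilatedImage s p := MemLp.coeFn_toLp _

theorem inner_imageL2 (p r : {p : ℝ // p ≠ 0}) :
    ⟪imageL2 hs p, imageL2 hs r⟫_ℂ = ⟪testL2 hs p, testL2 hs r⟫_ℂ := by
  have h := integral_dilatedImage_mul_conj hs r.2 p.2
  rw [L2.inner_def, L2.inner_def]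
  calc _ = ∫ w, dilatedImage s r w * conj (dilatedImage s p w) := by
        refine integral_congr_ae ?_
        filter_upwards [coeFn_imageL2 hs p, coeFn_imageL2 hs r] with x h1 h2
        rw [h1, h2, RCLike.inner_apply]
    _ = ∫ x, testFn s (r * x) * conj (testFn s (p * x)) := h
    _ = _ := by
        refine integral_congr_ae ?_
        filter_upwards [coeFn_testL2 hs p, coeFn_testL2 hs r] with x h1 h2
        rw [h1, h2, RCLike.inner_apply]

theorem span_testL2_dense : Dense (Submodule.span ℂ (range (testL2 hs)) : Set L2) := by
  rw [Submodule.dense_iff_topologicalClosure_eq_top, Submodule.topologicalClosure_eq_top_iff,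
    Submodule.eq_bot_iff]
  intro g hg
  have hz : ∀ᵐ x : ℝ, conj (g x) = 0 := by
    have hint : ∀ p : {p : ℝ // p ≠ 0}, Integrable (fun x => conj (g x) * testFn s (p * x)) ∧
        ∫ x, conj (g x) * testFn s (p * x) = 0 := by
      intro p
      have hae : (fun x => conj (g x) * testL2 hs p x) =ᵐ[volume]
          fun x => conj (g x) * testFn s (p * x) := by
        filter_upwards [coeFn_testL2 hs p] with x hx
        rw [hx]
      constructor
      · exact ((Lp.memLp g).star.integrable_mul (Lp.memLp (testL2 hs p))).congr hae
      · have h1 : ⟪g, testL2 hs p⟫_ℂ = 0 :=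
          Submodule.inner_left_of_mem_orthogonal (Submodule.subset_span (mem_range_self p)) hg
        rw [L2.inner_def] at h1
        rw [← h1]
        refine integral_congr_ae ?_
        filter_upwards [hae] with x hx
        rw [RCLike.inner_apply, mul_comm (testL2 hs p x)]
        exact hx.symm
    exact ae_eq_zero_of_integral_testFn (fun p hp => (hint ⟨p, hp⟩).1) fun p hp => (hint ⟨p, hp⟩).2
  ext1
  filter_upwards [hz, Lp.coeFn_zero ℂ 2 (volume : Measure ℝ)] with x h1 h2
  rw [h2, Pi.zero_apply]
  simpa using h1

theorem ext_testL2 {G : Type*} [NormedAddCommGroup G] [NormedSpace ℂ G] {A B : L2 →L[ℂ] G}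
    (h : ∀ p, A (testL2 hs p) = B (testL2 hs p)) : A = B :=
  ContinuousLinearMap.ext_on (span_testL2_dense hs) (by rintro _ ⟨p, rfl⟩; exact h p)

theorem denseRange_linearCombination_testL2 :
    DenseRange (Finsupp.linearCombination ℂ (testL2 hs)) := by
  have := span_testL2_dense hs
  rw [← Finsupp.range_linearCombination] at this
  exact this

/-- The unitary operator `𝒯_s` on `L₂(ℝ)`. -/
def transform : L2 →L[ℂ] L2 :=
  (Finsupp.linearCombination ℂ (imageL2 hs)).extendOfNorm (Finsupp.linearCombination ℂ (testL2 hs))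

theorem transform_linearCombination (c : {p : ℝ // p ≠ 0} →₀ ℂ) :
    transform hs (Finsupp.linearCombination ℂ (testL2 hs) c) =
      Finsupp.linearCombination ℂ (imageL2 hs) c :=
  LinearMap.extendOfNorm_eq (denseRange_linearCombination_testL2 hs)
    ⟨1, fun c => by rw [one_mul, norm_linearCombination_eq (inner_imageL2 hs) c]⟩ c

theorem transform_testL2 (p : {p : ℝ // p ≠ 0}) : transform hs (testL2 hs p) = imageL2 hs p := by
  simpa using transform_linearCombination hs (Finsupp.single p 1)

theorem norm_transform (f : L2) : ‖transform hs f‖ = ‖f‖ := by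
  refine DenseRange.induction_on (p := fun f => ‖transform hs f‖ = ‖f‖)
    (denseRange_linearCombination_testL2 hs) f
    (isClosed_eq (transform hs).continuous.norm continuous_norm) fun c => ?_
  rw [transform_linearCombination, norm_linearCombination_eq (inner_imageL2 hs) c]

theorem inner_star_comm (f g : L2) : ⟪star f, g⟫_ℂ = ⟪star g, f⟫_ℂ := by
  rw [inner_star_left, inner_star_left]
  simp_rw [mul_comm]

/-- Symmetry for the bilinear pairing holds on the test functions and extends by density, one
variable at a time. -/
theorem inner_star_transform (f g : L2) :
    ⟪star (transform hs f), g⟫_ℂ = ⟪star f, transform hs g⟫_ℂ := by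
  have h1 : ∀ p r, ⟪star (imageL2 hs p), testL2 hs r⟫_ℂ = ⟪star (testL2 hs p), imageL2 hs r⟫_ℂ := by
    intro p r
    rw [inner_star_left, inner_star_left]
    calc _ = ∫ w, dilatedImage s p w * testFn s (r * w) := by
          refine integral_congr_ae ?_
          filter_upwards [coeFn_imageL2 hs p, coeFn_testL2 hs r] with x h1 h2
          rw [h1, h2]
      _ = ∫ x, testFn s (p * x) * dilatedImage s r x := integral_dilatedImage_mul_testFn p.2 r.2
      _ = _ := by
          refine integral_congr_ae ?_
          filter_upwards [coeFn_testL2 hs p, coeFn_imageL2 hs r] with x h1 h2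
          rw [h1, h2]
  have h2 : ∀ p, innerSL ℂ (star (imageL2 hs p)) =
      innerSL ℂ (star (testL2 hs p)) ∘L transform hs := fun p => by
    refine ext_testL2 hs fun r => ?_
    simpa [transform_testL2] using h1 p r
  have h3 : innerSL ℂ (star (transform hs f)) = innerSL ℂ (star f) ∘L transform hs := by
    refine ext_testL2 hs fun p => ?_
    have := congrArg (fun A : L2 →L[ℂ] ℂ => A f) (h2 p)
    simp only [innerSL_apply_apply, ContinuousLinearMap.comp_apply] at this ⊢
    rw [inner_star_comm, ← this, transform_testL2, inner_star_comm]
  exact congrArg (fun A : L2 →L[ℂ] ℂ => A g) h3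

/-- The transpose of the transform is itself, so the adjoint is its complex conjugate. In particular
the adjoint is isometric, and unitarity follows. -/
theorem adjoint_transform (g : L2) :
    ContinuousLinearMap.adjoint (transform hs) g = star (transform hs (star g)) := by
  refine ext_inner_right ℂ fun f => ?_
  rw [ContinuousLinearMap.adjoint_inner_left, inner_star_transform, star_star]

theorem transform_mem_unitary : transform hs ∈ unitary (L2 →L[ℂ] L2) := by
  have h1 := (ContinuousLinearMap.norm_map_iff_adjoint_comp_self _).1 (norm_transform hs)
  have h2 := (ContinuousLinearMap.norm_map_iff_adjoint_comp_self
    (ContinuousLinearMap.adjoint (transform hs))).1 fun g => by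
      rw [adjoint_transform, norm_star_L2, norm_transform, norm_star_L2]
  rw [ContinuousLinearMap.adjoint_adjoint] at h2
  exact Unitary.mem_iff.2 ⟨h1, h2⟩

/-- Fubini's hypothesis: the bound 1 + |wx|^m for the kernel splits into products of functions of
one variable. -/
theorem integrable_prod_genExp (hs : -(1 / 2 : ℝ) < s.re) {f : ℝ → ℂ} (hf : Integrable f)
    (hf' : Integrable fun x => ((|x| ^ min s.re 0 : ℝ) : ℂ) * f x) {p : ℝ} (hp : p ≠ 0) :
    Integrable (fun z : ℝ × ℝ => genExp s (z.1 * z.2) * f z.2 * testFn s (p * z.1))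
      (volume.prod volume) := by
  obtain ⟨C, hC0, hC⟩ := norm_genExp_le hs
  set m := min s.re 0
  have he := integrable_dilated_testFn hs hp
  have he' : Integrable fun x => (|x| ^ m : ℝ) * ‖testFn s (p * x)‖ := by
    have h := (integrable_rpow_mul_testFn (neg_one_lt_re_add_min hs)).comp_mul_left' hp
    refine (h.const_mul ((|p| ^ m)⁻¹)).congr (ae_of_all _ fun x => ?_)
    change (|p| ^ m)⁻¹ * (|p * x| ^ m * _) = _
    rw [abs_mul, Real.mul_rpow (abs_nonneg p) (abs_nonneg x)]
    have := (Real.rpow_pos_of_pos (abs_pos.2 hp) m).ne'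
    field_simp
  have h1 := (he.norm.mul_prod hf.norm).const_mul C
  have h2 := (he'.mul_prod hf'.norm).const_mul C
  refine Integrable.mono (h1.add h2) ?_ ?_
  · have hm := measurable_genExp hs
    have hm' := measurable_testFn s
    refine AEStronglyMeasurable.mul (AEStronglyMeasurable.mul ?_ hf.1.comp_snd) ?_
    · have : Measurable fun z : ℝ × ℝ => genExp s (z.1 * z.2) := by fun_prop
      exact this.aestronglyMeasurable
    · have : Measurable fun z : ℝ × ℝ => testFn s (p * z.1) := by fun_prop
      exact this.aestronglyMeasurable
  · have h1 : ∀ᵐ z : ℝ × ℝ ∂(volume.prod volume), z.1 ≠ 0 :=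
      Measure.quasiMeasurePreserving_fst.ae ae_ne_zero
    have h2 : ∀ᵐ z : ℝ × ℝ ∂(volume.prod volume), z.2 ≠ 0 :=
      Measure.quasiMeasurePreserving_snd.ae ae_ne_zero
    filter_upwards [h1, h2] with z hz1 hz2
    simp only [Pi.add_apply]
    rw [Real.norm_of_nonneg (by positivity), norm_mul, norm_mul, norm_mul, Complex.norm_real,
      Real.norm_of_nonneg (by positivity)]
    have h2 := hC (z.1 * z.2) (mul_ne_zero hz1 hz2)
    rw [abs_mul, Real.mul_rpow (abs_nonneg z.1) (abs_nonneg z.2)] at h2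
    calc _ ≤ C * (1 + |z.1| ^ m * |z.2| ^ m) * ‖f z.2‖ * ‖testFn s (p * z.1)‖ := by gcongr
      _ = _ := by ring

/-- The transform is given by the absolutely convergent integral. -/
theorem transform_ae_eq {f : L2} (hf : Integrable f)
    (hf' : Integrable fun x => ((|x| ^ min s.re 0 : ℝ) : ℂ) * f x) :
    ∀ᵐ w : ℝ, transform hs f w = ∫ x, genExp s (w * x) * f x := by
  have hmain : ∀ p : {p : ℝ // p ≠ 0},
      Integrable (fun w => (transform hs f w - ∫ x, genExp s (w * x) * f x) * testFn s (p * w)) ∧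
      ∫ w, (transform hs f w - ∫ x, genExp s (w * x) * f x) * testFn s (p * w) = 0 := by
    intro p
    have hprod := integrable_prod_genExp hs hf hf' p.2
    have h1 : Integrable fun w => (∫ x, genExp s (w * x) * f x) * testFn s (p * w) := by
      refine hprod.integral_prod_left.congr (ae_of_all _ fun w => ?_)
      simp only
      rw [integral_mul_const]
    have hae : (fun w => transform hs f w * testL2 hs p w) =ᵐ[volume]
        fun w => transform hs f w * testFn s (p * w) := by
      filter_upwards [coeFn_testL2 hs p] with x hx
      rw [hx]
    have h2 : Integrable fun w => transform hs f w * testFn s (p * w) :=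
      (integrable_mul_L2 _ _).congr hae
    refine ⟨(h2.sub h1).congr (ae_of_all _ fun w => (sub_mul _ _ _).symm), ?_⟩
    simp_rw [sub_mul]
    -- Symmetry moves the transform onto the test function, where it is an explicit integral; Fubini
    -- then moves it back onto f.
    rw [integral_sub h2 h1, sub_eq_zero, ← integral_congr_ae hae, ← inner_star_left,
      inner_star_transform, transform_testL2, inner_star_left]
    simp_rw [← integral_mul_const]
    rw [integral_integral_swap hprod]
    refine integral_congr_ae ?_
    filter_upwards [coeFn_imageL2 hs p, ae_ne_zero] with x hx hx0
    rw [hx, dilatedImage, ← integral_genExp_mul_testFn hs hx0 p.2, ← integral_const_mul]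
    congr 1; ext w
    rw [mul_comm w x]; ring
  have := ae_eq_zero_of_integral_testFn (fun p hp => (hmain ⟨p, hp⟩).1) fun p hp => (hmain ⟨p, hp⟩).2
  filter_upwards [this] with w hw
  exact sub_eq_zero.1 hw

/-- The singularity of the generalized exponential at the origin is harmless on `L¹ ∩ L²`. -/
theorem integrable_rpow_min_mul (hs : -(1 / 2 : ℝ) < s.re) {f : ℝ → ℂ} (hf : Integrable f)
    (hf2 : MemLp f 2) : Integrable fun x => ((|x| ^ min s.re 0 : ℝ) : ℂ) * f x := by
  set m := min s.re 0
  have hm : -1 < m + m := by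
    have : -(1 / 2) < m := lt_min hs (by norm_num)
    linarith
  have hm0 : m ≤ 0 := min_le_right _ _
  -- Near the origin the singularity is square integrable, since 2m > -1, and pairs with f in L²;
  -- away from it the power is at most 1 and f in L¹ suffices.
  set k : ℝ → ℂ := indicator (Icc (-1) 1) fun x => ((|x| ^ m : ℝ) : ℂ) with hk
  have hkm : Measurable k := Measurable.indicator (by fun_prop) measurableSet_Icc
  have hk2 : MemLp k 2 := by
    rw [memLp_two_iff_integrable_sq_norm hkm.aestronglyMeasurable]
    have h1 := (integrable_indicator_iff measurableSet_Ioi).2 (integrableOn_rpow_mul_exp hm one_pos)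
    refine Integrable.mono ((h1.add h1.comp_neg).const_mul (Real.exp 1))
      (hkm.norm.pow_const 2).aestronglyMeasurable ?_
    have h2 : ∀ y : ℝ, 0 < y → y ≤ 1 →
        (y ^ m) ^ 2 ≤ Real.exp 1 * (y ^ (m + m) * Real.exp (-(1 * y))) := by
      intro y hy hy1
      have h3 : 1 ≤ Real.exp 1 * Real.exp (-(1 * y)) := by
        rw [← Real.exp_add]; exact Real.one_le_exp (by linarith)
      rw [Real.rpow_add hy, sq]
      have : 0 ≤ y ^ m * y ^ m := by positivity
      nlinarith
    filter_upwards [ae_ne_zero] with x hx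
    by_cases hx1 : x ∈ Icc (-1 : ℝ) 1
    · rw [hk, indicator_of_mem hx1, Complex.norm_real, Real.norm_of_nonneg (by positivity),
        Real.norm_of_nonneg (by positivity)]
      simp only [Pi.add_apply]
      rcases lt_or_gt_of_ne hx with h | h
      · rw [indicator_of_notMem (by simp [h.le]), indicator_of_mem (by simpa using h), abs_of_neg h,
          zero_add, Real.norm_of_nonneg (by have := neg_pos.2 h; positivity)]
        exact h2 (-x) (by linarith) (by linarith [hx1.1])
      · rw [indicator_of_mem (by simpa using h), indicator_of_notMem (by simp [h.le]), abs_of_pos h,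
          add_zero, Real.norm_of_nonneg (by positivity)]
        exact h2 x h hx1.2
    · rw [hk, indicator_of_notMem hx1]
      simp only [norm_zero, ne_eq, OfNat.ofNat_ne_zero, not_false_eq_true, zero_pow]
      exact norm_nonneg _
  have h4 : Integrable fun x => k x * f x := hk2.integrable_mul hf2
  refine Integrable.mono (h4.norm.add hf.norm) ?_ (ae_of_all _ fun x => ?_)
  · exact (by fun_prop : Measurable fun x : ℝ => ((|x| ^ m : ℝ) : ℂ)).aestronglyMeasurable.mul hf.1
  · simp only [Pi.add_apply]
    rw [Real.norm_of_nonneg (by positivity), norm_mul, norm_mul]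
    by_cases hx1 : x ∈ Icc (-1 : ℝ) 1
    · rw [hk, indicator_of_mem hx1]
      linarith [norm_nonneg (f x)]
    · have h5 : 1 ≤ |x| := by
        by_contra! h
        exact hx1 (abs_le.1 h.le)
      have h6 : ‖((|x| ^ m : ℝ) : ℂ)‖ ≤ 1 := by
        rw [Complex.norm_real, Real.norm_of_nonneg (by positivity)]
        exact Real.rpow_le_one_of_one_le_of_nonpos h5 hm0
      have h7 : 0 ≤ ‖k x‖ * ‖f x‖ := by positivity
      nlinarith [norm_nonneg (f x)]

theorem transform_ae_eq_of_integrable {f : L2} (hf : Integrable f) :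
    ∀ᵐ w : ℝ, transform hs f w = ∫ x, genExp s (w * x) * f x :=
  transform_ae_eq hs hf (integrable_rpow_min_mul hs hf (Lp.memLp f))

theorem transform_extends : ExtendsTransform s (transform hs) := fun _ hf _ =>
  transform_ae_eq_of_integrable hs hf

end Transform

/-! ### The operator ψ* 𝒯_s* and the closed subspace L₂[0,1]. -/

section UnitaryMap

variable {s : ℂ}

theorem coeFn_psiStar (s : ℂ) (f : L2) :
    psiStar s f =ᵐ[volume] fun x => conj (psi s x) * f x := (memLp_conj_psi_mul s f).coeFn_toLp

theorem norm_psiStar (s : ℂ) (f : L2) : ‖psiStar s f‖ = ‖f‖ := by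
  rw [Lp.norm_def, Lp.norm_def]
  congr 1
  refine eLpNorm_congr_norm_ae ?_
  filter_upwards [coeFn_psiStar s f, ae_ne_zero] with x hx h0
  rw [hx, norm_mul, RCLike.norm_conj, norm_psi s h0, one_mul]

theorem psiStar_surjective (s : ℂ) : Function.Surjective (psiStar s) := by
  intro f
  have hm : MemLp (fun x => psi s x * f x) 2 := by
    refine (Lp.memLp f).of_le ((measurable_psi s).aestronglyMeasurable.mul
      (Lp.aestronglyMeasurable f)) (ae_of_all _ fun x => ?_)
    rw [norm_mul]
    exact mul_le_of_le_one_left (norm_nonneg _) (norm_psi_le s x)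
  refine ⟨hm.toLp _, ?_⟩
  ext1
  filter_upwards [coeFn_psiStar s (hm.toLp _), hm.coeFn_toLp, ae_ne_zero] with x h1 h2 h0
  rw [h1, h2, ← mul_assoc, conj_psi_mul_psi s h0, one_mul]

variable (hs : -(1 / 2 : ℝ) < s.re)

theorem adjoint_transform_transform (f : L2) :
    ContinuousLinearMap.adjoint (transform hs) (transform hs f) = f :=
  congrArg (fun A : L2 →L[ℂ] L2 => A f) (Unitary.mem_iff.1 (transform_mem_unitary hs)).1

/-- The unitary operator `ψ^* 𝒯_s^*`. -/
def unitaryMap : L2 ≃ₗᵢ[ℂ] L2 :=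
  LinearIsometryEquiv.ofSurjective
    { toLinearMap := psiStar s ∘ₗ (ContinuousLinearMap.adjoint (transform hs)).toLinearMap
      norm_map' := fun f => by
        rw [LinearMap.comp_apply, norm_psiStar, ContinuousLinearMap.coe_coe, adjoint_transform,
          norm_star_L2, norm_transform, norm_star_L2] }
    ((psiStar_surjective s).comp fun f => ⟨_, adjoint_transform_transform hs f⟩)

theorem unitaryMap_apply (f : L2) :
    unitaryMap hs f = psiStar s (ContinuousLinearMap.adjoint (transform hs) f) := rfl

theorem isClosed_L2Unit : IsClosed (L2Unit : Set L2) := by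
  have h : (L2Unit : Set L2) =
      (LpToLpRestrictCLM ℝ ℂ ℂ (volume : Measure ℝ) 2 (Icc (0 : ℝ) 1)ᶜ) ⁻¹' {0} := by
    ext g
    rw [mem_preimage, mem_singleton_iff, Lp.eq_zero_iff_ae_eq_zero]
    have h1 := LpToLpRestrictCLM_coeFn ℂ (Icc (0 : ℝ) 1)ᶜ g
    constructor
    · intro hg
      have hg' : ∀ᵐ t : ℝ, t ∈ (Icc (0 : ℝ) 1)ᶜ → g t = 0 := hg
      filter_upwards [h1, (ae_restrict_iff' measurableSet_Icc.compl).2 hg'] with t h2 h3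
      rw [h2, h3, Pi.zero_apply]
    · intro hg
      refine (ae_restrict_iff' measurableSet_Icc.compl).1 ?_
      filter_upwards [h1, hg] with t h2 h3
      rw [← h2, h3, Pi.zero_apply]
  rw [h]
  exact isClosed_singleton.preimage (ContinuousLinearMap.continuous _)

instance : CompleteSpace L2Unit := isClosed_L2Unit.completeSpace_coe

theorem star_mem_L2Unit {g : L2} (hg : g ∈ L2Unit) : star g ∈ L2Unit := by
  have hg' : ∀ᵐ t : ℝ, t ∉ Icc (0 : ℝ) 1 → g t = 0 := hg
  change ∀ᵐ t : ℝ, t ∉ Icc (0 : ℝ) 1 → (star g : L2) t = 0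
  filter_upwards [hg', Lp.coeFn_star g] with t h1 h2 ht
  rw [h2, Pi.star_apply, h1 ht, star_zero]

theorem integrable_of_mem_L2Unit {g : L2} (hg : g ∈ L2Unit) : Integrable g := by
  have h1 : IntegrableOn g (Icc (0 : ℝ) 1) :=
    MemLp.integrable one_le_two ((Lp.memLp g).restrict _)
  exact h1.integrable_of_ae_notMem_eq_zero hg

end UnitaryMap

/-! ### Vectors representing evaluation, and the projection onto 𝒫𝒲_s. -/

section Reproducing

variable {s : ℂ}

theorem entireZ_eq (s : ℂ) : entireZ s = fun z => Complex.Gamma (1 + conj s) /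
    Complex.Gamma (1 + 2 * (s.re : ℂ)) *
    oneFOne (1 + conj s) ((1 + 2 * s.re : ℝ) : ℂ) (Complex.I * z) := by
  funext z; rw [entireZ, beta_eq]

theorem differentiable_entireZ (hs : -(1 / 2 : ℝ) < s.re) : Differentiable ℂ (entireZ s) := by
  rw [entireZ_eq]
  exact ((differentiable_oneFOne _ (beta_pos hs)).comp
    (differentiable_id.const_mul Complex.I)).const_mul _

/-- The functions of `t` that represent evaluation at `z`. -/
def evalFn (s z : ℂ) : ℝ → ℂ :=
  indicator (Ioc 0 1) fun t => (t : ℂ) ^ conj s * entireZ s (t * z) / (Real.sqrt (2 * Real.pi) : ℂ)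

theorem measurable_evalFn (hs : -(1 / 2 : ℝ) < s.re) (z : ℂ) : Measurable (evalFn s z) := by
  have := (differentiable_entireZ hs).continuous
  refine Measurable.indicator ?_ measurableSet_Ioc
  have h1 : Measurable fun t : ℝ => entireZ s (t * z) := by
    have : Continuous fun t : ℝ => entireZ s (t * z) := by fun_prop
    exact this.measurable
  fun_prop

theorem memLp_evalFn (hs : -(1 / 2 : ℝ) < s.re) (z : ℂ) : MemLp (evalFn s z) 2 := by
  have h1 := memLp_weighted (s := conj s) (by simpa using hs) 1
  have hc : Continuous fun t : ℝ => entireZ s (t * z) / (Real.sqrt (2 * Real.pi) : ℂ) := by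
    have := (differentiable_entireZ hs).continuous
    fun_prop
  obtain ⟨C, hC⟩ := (isCompact_Icc (a := (0 : ℝ)) (b := 1)).exists_bound_of_continuousOn
    hc.continuousOn
  refine MemLp.of_le_mul (c := C) h1 (measurable_evalFn hs z).aestronglyMeasurable
    (ae_of_all _ fun t => ?_)
  by_cases ht : t ∈ Ioc (0 : ℝ) 1
  · rw [evalFn, weighted, indicator_of_mem ht, indicator_of_mem (Ioc_subset_Icc_self ht),
      mul_div_assoc, norm_mul, mul_comm, eval_one, mul_one]
    exact mul_le_mul_of_nonneg_right (hC t (Ioc_subset_Icc_self ht)) (norm_nonneg _)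
  · rw [evalFn, indicator_of_notMem ht, norm_zero]
    have : 0 ≤ C := (norm_nonneg _).trans (hC 0 (by simp))
    positivity

variable (hs : -(1 / 2 : ℝ) < s.re)

/-- The elements of `L₂[0,1]` that represent evaluation at `z`. -/
def evalL2 (z : ℂ) : L2 := star ((memLp_evalFn hs z).toLp _)

theorem coeFn_evalL2 (z : ℂ) : evalL2 hs z =ᵐ[volume] fun t => conj (evalFn s z t) := by
  filter_upwards [Lp.coeFn_star ((memLp_evalFn hs z).toLp _), (memLp_evalFn hs z).coeFn_toLp]
    with t h1 h2
  rw [evalL2, h1, Pi.star_apply, h2]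
  rfl

theorem evalL2_mem (z : ℂ) : evalL2 hs z ∈ L2Unit := by
  change ∀ᵐ t : ℝ, t ∉ Icc (0 : ℝ) 1 → evalL2 hs z t = 0
  filter_upwards [coeFn_evalL2 hs z] with t h1 ht
  rw [h1, evalFn, indicator_of_notMem (fun h => ht (Ioc_subset_Icc_self h)), map_zero]

theorem inner_evalL2 (z : ℂ) (g : L2) : ⟪evalL2 hs z, g⟫_ℂ = ∫ t, evalFn s z t * g t := by
  rw [evalL2, inner_star_left]
  refine integral_congr_ae ?_
  filter_upwards [(memLp_evalFn hs z).coeFn_toLp] with t h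
  rw [h]

/-- Elements of L₂[0,1] are integrable, so the adjoint is given by the conjugated integral formula;
its kernel is ρ(x) times `evalFn`. The inner product makes sense at every complex point, and it is
the entire factor h. -/
theorem unitaryMap_ae_eq {g : L2} (hg : g ∈ L2Unit) :
    ∀ᵐ x : ℝ, unitaryMap hs g x = rho s x * ⟪evalL2 hs x, g⟫_ℂ := by
  have hstar : Integrable (star g : L2) :=
    integrable_of_mem_L2Unit (star_mem_L2Unit hg)
  have hg' : ∀ᵐ t : ℝ, t ∉ Icc (0 : ℝ) 1 → g t = 0 := hg
  filter_upwards [transform_ae_eq_of_integrable hs hstar, coeFn_psiStar s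
    (ContinuousLinearMap.adjoint (transform hs) g), Lp.coeFn_star (transform hs (star g)),
    ae_ne_zero] with x h1 h2 h3 h0
  rw [unitaryMap_apply, h2, adjoint_transform, h3, Pi.star_apply, h1, inner_evalL2,
    ← integral_const_mul, RCLike.star_def, ← integral_conj, ← integral_const_mul]
  refine integral_congr_ae ?_
  filter_upwards [hg', Lp.coeFn_star g, ae_ne_zero] with t h4 h5 h6
  rw [h5, Pi.star_apply, map_mul, RCLike.star_def, Complex.conj_conj, ← mul_assoc]
  by_cases ht : t ∈ Icc (0 : ℝ) 1
  · have ht0 : 0 < t := lt_of_le_of_ne ht.1 h6.symm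
    rw [conj_psi_mul_conj_genExp hs ht0 h0, evalFn,
      indicator_of_mem (show t ∈ Ioc (0 : ℝ) 1 from ⟨ht0, ht.2⟩)]
    push_cast
    ring
  · rw [h4 ht]; simp

/-- The operator `ψ^* 𝒯_s^* 𝕀_{[0,1]} 𝒯_s ψ`. -/
def kernelOperator : L2 →L[ℂ] L2 :=
  (unitaryMap hs).toContinuousLinearEquiv.toContinuousLinearMap ∘L L2Unit.starProjection ∘L
    (unitaryMap hs).symm.toContinuousLinearEquiv.toContinuousLinearMap

theorem kernelOperator_apply (f : L2) :
    kernelOperator hs f = unitaryMap hs (L2Unit.starProjection ((unitaryMap hs).symm f)) := rfl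

theorem mem_range_kernelOperator {f : L2} :
    f ∈ (kernelOperator hs).range ↔ ∃ g ∈ L2Unit, unitaryMap hs g = f := by
  constructor
  · rintro ⟨f, rfl⟩
    exact ⟨_, Submodule.starProjection_apply_mem _ _, rfl⟩
  · rintro ⟨g, hg, rfl⟩
    refine ⟨unitaryMap hs g, ?_⟩
    change kernelOperator hs _ = _
    rw [kernelOperator_apply, LinearIsometryEquiv.symm_apply_apply,
      Submodule.starProjection_eq_self_iff.2 hg]

/-- The reproducing property: the vector representing evaluation already lies in L₂[0,1], so the
projection can be dropped. -/
theorem kernelOperator_ae_eq (f : L2) :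
    ∀ᵐ x : ℝ, kernelOperator hs f x = rho s x * ⟪unitaryMap hs (evalL2 hs x), f⟫_ℂ := by
  filter_upwards [unitaryMap_ae_eq hs (L2Unit.starProjection_apply_mem ((unitaryMap hs).symm f))]
    with x hx
  rw [kernelOperator_apply, hx]
  congr 1
  rw [← Submodule.inner_starProjection_left_eq_right,
    Submodule.starProjection_eq_self_iff.2 (evalL2_mem hs x),
    ← LinearIsometryEquiv.inner_map_map (unitaryMap hs), LinearIsometryEquiv.apply_symm_apply]

end Reproducing

/-! ### The Christoffel–Darboux identity along a ray. -/

section ChristoffelDarboux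

variable {s : ℂ}

theorem hasDerivAt_Z_dilate (hs : -(1 / 2 : ℝ) < s.re) (x : ℝ) {t : ℝ} (ht : t ≠ 0) :
    HasDerivAt (fun t => Z s (t * x)) (conj s * (gammaPhase s *
      (Complex.exp (Complex.I * (t * x)) * conj (Z s (t * x))) - Z s (t * x)) / t) t := by
  have h1 : HasDerivAt (fun t : ℝ => t * x) x t := by simpa using (hasDerivAt_id t).mul_const x
  have h2 := (hasDerivAt_Z hs (t * x)).differentiableAt.hasDerivAt.scomp t h1
  refine h2.congr_deriv ?_
  have h3 := mul_deriv_Z hs (t * x)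
  have ht' : (t : ℂ) ≠ 0 := by exact_mod_cast ht
  rw [Complex.real_smul, eq_div_iff ht', ← Complex.ofReal_mul, ← h3]
  push_cast; ring

/-- The numerator of the confluent hypergeometric kernel along a ray. -/
def kernelNumerator (s : ℂ) (x y t : ℝ) : ℂ :=
  Z s (t * x) * conj (Z s (t * y)) -
    Complex.exp (Complex.I * (t * (x - y))) * conj (Z s (t * x)) * Z s (t * y)

theorem exp_ray_deriv (x y t : ℝ) : HasDerivAt (fun t : ℝ => Complex.exp (Complex.I * (t * (x - y))))
    (Complex.exp (Complex.I * (t * (x - y))) * (Complex.I * (x - y))) t := by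
  have h1 : HasDerivAt (fun t : ℝ => Complex.I * ((t : ℂ) * (x - y))) (Complex.I * (x - y)) t := by
    simpa using (((hasDerivAt_id t).ofReal_comp).mul_const ((x : ℂ) - y)).const_mul Complex.I
  exact h1.cexp

theorem differentiable_kernelNumerator (hs : -(1 / 2 : ℝ) < s.re) (x y : ℝ) :
    Differentiable ℝ (kernelNumerator s x y) := by
  intro t
  have h1 : ∀ u : ℝ, DifferentiableAt ℝ (fun t : ℝ => Z s (t * u)) t := fun u =>
    DifferentiableAt.comp (g := Z s) t (hasDerivAt_Z hs (t * u)).differentiableAt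
      (differentiableAt_id.mul_const u)
  have h2 : ∀ u : ℝ, DifferentiableAt ℝ (fun t : ℝ => conj (Z s (t * u))) t := fun u =>
    (h1 u).star
  exact ((h1 x).mul (h2 y)).sub
    ((((exp_ray_deriv x y t).differentiableAt).mul (h2 x)).mul (h1 y))

/-- In the derivative of the numerator, the diagonal terms from `mul_deriv_Z` carry the factor -(s +
s̄)/t, which the weight t^{2 Re s} compensates. The terms with `gammaPhase` cancel because |e^{itu}|
= 1. Only the derivative of e^{it(x-y)} survives. -/
theorem hasDerivAt_rpow_mul_kernelNumerator (hs : -(1 / 2 : ℝ) < s.re) (x y : ℝ) {t : ℝ}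
    (ht : 0 < t) :
    HasDerivAt (fun t : ℝ => ((t ^ (2 * s.re) : ℝ) : ℂ) * kernelNumerator s x y t)
      (((t ^ (2 * s.re) : ℝ) : ℂ) * (Complex.I * (y - x) *
        (Complex.exp (Complex.I * (t * (x - y))) * conj (Z s (t * x)) * Z s (t * y)))) t := by
  have ht' : (t : ℂ) ≠ 0 := by exact_mod_cast ht.ne'
  have hZ := fun u => hasDerivAt_Z_dilate hs u ht.ne'
  have hZc : ∀ u : ℝ, HasDerivAt (fun t => conj (Z s (t * u))) (conj (conj s * (gammaPhase s *
      (Complex.exp (Complex.I * (t * u)) * conj (Z s (t * u))) - Z s (t * u)) / t)) t :=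
    fun u => (hZ u).star
  have hN := ((hZ x).mul (hZc y)).sub (((exp_ray_deriv x y t).mul (hZc x)).mul (hZ y))
  have hp : HasDerivAt (fun t : ℝ => ((t ^ (2 * s.re) : ℝ) : ℂ))
      (((2 * s.re * t ^ (2 * s.re) / t : ℝ)) : ℂ) t := by
    refine HasDerivAt.ofReal_comp ((Real.hasDerivAt_rpow_const (Or.inl ht.ne')).congr_deriv ?_)
    rw [Real.rpow_sub_one ht.ne', mul_div_assoc]
  refine (hp.mul hN).congr_deriv ?_
  have h2a : (2 * s.re : ℂ) = s + conj s := by rw [Complex.add_conj]; push_cast; ring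
  have hE : Complex.exp (Complex.I * (t * (x - y))) =
      Complex.exp (Complex.I * (t * x)) * conj (Complex.exp (Complex.I * (t * y))) := by
    rw [← Complex.exp_conj, ← Complex.exp_add]
    congr 1
    simp
    ring
  have hu : ∀ u : ℝ, Complex.exp (Complex.I * (t * u)) *
      conj (Complex.exp (Complex.I * (t * u))) = 1 := fun u => by
    rw [← Complex.exp_conj, ← Complex.exp_add]
    simp
  have hux := hu x
  have huy := hu y
  simp only [Pi.sub_apply, Pi.mul_apply]
  push_cast
  rw [h2a, hE]
  simp only [map_mul, map_div₀, map_sub, Complex.conj_conj, Complex.conj_ofReal]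
  generalize Complex.exp (Complex.I * (t * x)) = X at *
  generalize Complex.exp (Complex.I * (t * y)) = Y at *
  generalize Z s (t * x) = A at *
  generalize Z s (t * y) = B at *
  generalize (((t ^ (2 * s.re) : ℝ)) : ℂ) = P at *
  generalize conj (gammaPhase s) = K at *
  field_simp
  linear_combination (-P * s * K * conj Y * A * B) * hux +
    (-P * conj s * gammaPhase s * X * conj A * conj B) * huy

end ChristoffelDarboux

/-! ### The confluent hypergeometric kernel as a Gram kernel. -/

section KernelIntegral

variable {s : ℂ}

theorem kernelNumerator_zero (s : ℂ) (x y : ℝ) : kernelNumerator s x y 0 = 0 := by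
  simp [kernelNumerator, mul_comm]

/-- The weight may blow up, but the numerator vanishes at 0 with a finite slope, and t^{2 Re s + 1}
tends to 0. -/
theorem tendsto_rpow_mul_kernelNumerator_zero (hs : -(1 / 2 : ℝ) < s.re) (x y : ℝ) :
    Tendsto (fun t : ℝ => ((t ^ (2 * s.re) : ℝ) : ℂ) * kernelNumerator s x y t)
      (𝓝[>] 0) (𝓝 0) := by
  have h1 := (hasDerivAt_iff_tendsto_slope.1
    (differentiable_kernelNumerator hs x y 0).hasDerivAt).mono_left
    (nhdsWithin_mono 0 fun t (ht : 0 < t) => ht.ne')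
  have h2 : Tendsto (fun t : ℝ => ((t ^ (2 * s.re + 1) : ℝ) : ℂ)) (𝓝[>] 0) (𝓝 0) := by
    have h3 : ContinuousAt (fun t : ℝ => ((t ^ (2 * s.re + 1) : ℝ) : ℂ)) 0 :=
      Complex.continuous_ofReal.continuousAt.comp
        (Real.continuousAt_rpow_const 0 _ (Or.inr (by linarith)))
    have h4 := h3.tendsto.mono_left (nhdsWithin_le_nhds (s := Ioi (0 : ℝ)))
    rwa [Real.zero_rpow (by linarith), Complex.ofReal_zero] at h4
  have h5 := h2.mul h1
  rw [zero_mul] at h5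
  refine h5.congr' ?_
  filter_upwards [self_mem_nhdsWithin] with t (ht : 0 < t)
  have ht' : (t : ℂ) ≠ 0 := by exact_mod_cast ht.ne'
  rw [slope_def_module, kernelNumerator_zero, sub_zero, sub_zero, Complex.real_smul,
    Real.rpow_add_one ht.ne']
  push_cast
  field_simp

theorem integral_rpow_mul_exp_mul_Z (hs : -(1 / 2 : ℝ) < s.re) {x y : ℝ} (hxy : x ≠ y) :
    ∫ t in (0 : ℝ)..1, ((t ^ (2 * s.re) : ℝ) : ℂ) *
        (Complex.exp (Complex.I * (t * (x - y))) * conj (Z s (t * x)) * Z s (t * y)) =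
      (Z s x * conj (Z s y) - Complex.exp (Complex.I * (x - y)) * conj (Z s x) * Z s y) /
        (Complex.I * (y - x)) := by
  have hc : Complex.I * ((y : ℂ) - x) ≠ 0 :=
    mul_ne_zero Complex.I_ne_zero (sub_ne_zero.2 (by exact_mod_cast hxy.symm))
  have hcont : Continuous fun t : ℝ => Complex.I * ((y : ℂ) - x) *
      (Complex.exp (Complex.I * (t * (x - y))) * conj (Z s (t * x)) * Z s (t * y)) := by
    have h1 := continuous_Z hs
    have h2 : Continuous fun t : ℝ => conj (Z s (t * x)) :=
      Complex.continuous_conj.comp (h1.comp (continuous_id.mul continuous_const))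
    have h3 : Continuous fun t : ℝ => Z s (t * y) :=
      h1.comp (continuous_id.mul continuous_const)
    fun_prop
  have hint : IntervalIntegrable (fun t : ℝ => ((t ^ (2 * s.re) : ℝ) : ℂ)) volume 0 1 :=
    ⟨(intervalIntegral.intervalIntegrable_rpow' (by linarith)).1.ofReal,
      (intervalIntegral.intervalIntegrable_rpow' (by linarith)).2.ofReal⟩
  have h1 : Tendsto (fun t : ℝ => ((t ^ (2 * s.re) : ℝ) : ℂ) * kernelNumerator s x y t)
      (𝓝[<] 1) (𝓝 (kernelNumerator s x y 1)) := by
    have h2 := ((hasDerivAt_rpow_mul_kernelNumerator hs x y one_pos).continuousAt.tendsto).mono_left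
      (nhdsWithin_le_nhds (s := Iio (1 : ℝ)))
    simpa using h2
  have h3 := intervalIntegral.integral_eq_sub_of_hasDerivAt_of_tendsto zero_lt_one
    (fun t ht => hasDerivAt_rpow_mul_kernelNumerator hs x y ht.1)
    (hint.mul_continuousOn hcont.continuousOn)
    (tendsto_rpow_mul_kernelNumerator_zero hs x y) h1
  rw [sub_zero] at h3
  rw [eq_div_iff hc, ← intervalIntegral.integral_mul_const]
  refine Eq.trans ?_ (h3.trans ?_)
  · refine intervalIntegral.integral_congr fun t _ => ?_
    ring
  · simp [kernelNumerator]

theorem evalFn_mul_conj_evalFn (hs : -(1 / 2 : ℝ) < s.re) (x y : ℝ) {t : ℝ}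
    (ht : t ∈ Ioc (0 : ℝ) 1) :
    evalFn s x t * conj (evalFn s y t) = ((t ^ (2 * s.re) : ℝ) : ℂ) *
      (Complex.exp (Complex.I * (t * (x - y))) * conj (Z s (t * x)) * Z s (t * y)) /
        (2 * Real.pi) := by
  have hpi : (Real.sqrt (2 * Real.pi) : ℂ) * (Real.sqrt (2 * Real.pi) : ℂ) = 2 * Real.pi := by
    rw [← Complex.ofReal_mul, Real.mul_self_sqrt (by positivity)]; push_cast; rfl
  have hp : (t : ℂ) ^ conj s * conj ((t : ℂ) ^ conj s) = ((t ^ (2 * s.re) : ℝ) : ℂ) := by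
    rw [conj_ofReal_cpow ht.1, Complex.conj_conj,
      ← Complex.cpow_add _ _ (by exact_mod_cast ht.1.ne'), add_comm, Complex.add_conj,
      Complex.ofReal_cpow ht.1.le]
  have hE : Complex.exp (Complex.I * (t * (x - y))) =
      Complex.exp (Complex.I * ((t * x : ℝ) : ℂ)) *
        conj (Complex.exp (Complex.I * ((t * y : ℝ) : ℂ))) := by
    rw [← Complex.exp_conj, ← Complex.exp_add]
    congr 1
    simp
    ring
  rw [evalFn, evalFn, indicator_of_mem ht, indicator_of_mem ht, ← Complex.ofReal_mul,
    ← Complex.ofReal_mul, ← exp_mul_conj_Z hs, ← exp_mul_conj_Z hs, ← hp, hE, ← hpi]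
  simp only [map_mul, map_div₀, Complex.conj_conj, Complex.conj_ofReal]
  ring

/-- The inner product is the integral over [0,1] of the derivative just computed, divided by 2πi(y -
x). -/
theorem kernel_eq_inner (hs : -(1 / 2 : ℝ) < s.re) {x y : ℝ} (hxy : x ≠ y) :
    kernel s x y = rho s x * rho s y * ⟪evalL2 hs x, evalL2 hs y⟫_ℂ := by
  have h1 : ⟪evalL2 hs x, evalL2 hs y⟫_ℂ =
      ∫ t in (0 : ℝ)..1, evalFn s x t * conj (evalFn s y t) := by
    rw [inner_evalL2, intervalIntegral.integral_of_le zero_le_one,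
      setIntegral_eq_integral_of_forall_compl_eq_zero fun t ht => by
        rw [evalFn, indicator_of_notMem ht, zero_mul]]
    refine integral_congr_ae ?_
    filter_upwards [coeFn_evalL2 hs y] with t h
    rw [h]
  have h2 : ∫ t in (0 : ℝ)..1, evalFn s x t * conj (evalFn s y t) =
      ∫ t in (0 : ℝ)..1, ((t ^ (2 * s.re) : ℝ) : ℂ) *
      (Complex.exp (Complex.I * (t * (x - y))) * conj (Z s (t * x)) * Z s (t * y)) /
        (2 * Real.pi) := by
    rw [intervalIntegral.integral_of_le zero_le_one, intervalIntegral.integral_of_le zero_le_one]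
    exact setIntegral_congr_fun measurableSet_Ioc fun t ht => evalFn_mul_conj_evalFn hs x y ht
  rw [h1, h2, intervalIntegral.integral_div, integral_rpow_mul_exp_mul_Z hs hxy, kernel,
    if_neg hxy, kernelFormula]
  rw [div_div, mul_div_assoc]
  congr 2
  ring

theorem isIntegralOperator_kernelOperator (hs : -(1 / 2 : ℝ) < s.re) :
    IsIntegralOperator (kernel s) (kernelOperator hs) := by
  intro f
  filter_upwards [kernelOperator_ae_eq hs f] with x hx
  -- For fixed x the diagonal is one point of measure zero, so the limit defining the kernel there
  -- is never evaluated.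
  have hne : ∀ᵐ y : ℝ, y ≠ x := compl_mem_ae_iff.2 (measure_singleton x)
  have hk : (fun y => kernel s x y * f y) =ᵐ[volume] fun y =>
      (rho s x : ℂ) * (⟪unitaryMap hs (evalL2 hs x) y, f y⟫_ℂ) := by
    filter_upwards [unitaryMap_ae_eq hs (evalL2_mem hs x), hne] with y h1 h2
    rw [kernel_eq_inner hs h2.symm, h1, RCLike.inner_apply, map_mul, inner_conj_symm,
      Complex.conj_ofReal]
    ring
  refine ⟨((L2.integrable_inner _ _).const_mul _).congr hk.symm, ?_⟩
  rw [hx, integral_congr_ae hk, integral_const_mul, L2.inner_def]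

end KernelIntegral

/-! ### Order of vanishing and Taylor coefficients. -/

section PowerSeries

/-- Shifted coefficients keep an exponential bound because (k+n)! ≥ k!, so the quotient by zⁿ is
again a convergent series. -/
theorem exists_factor_of_exp_bound {c : ℕ → ℂ} {A r : ℝ} (hr : 0 ≤ r)
    (hc : ∀ k, ‖c k‖ ≤ A * (r ^ k / k.factorial)) {n : ℕ} (h0 : ∀ k < n, c k = 0) :
    ∃ q : ℂ → ℂ, Continuous q ∧ q 0 = c n ∧ ∀ z, ∑' k, c k * z ^ k = z ^ n * q z := by
  have hA : 0 ≤ A := by simpa using (norm_nonneg _).trans (hc 0)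
  have hb : ∀ k, ‖c (k + n)‖ ≤ A * r ^ n * (r ^ k / k.factorial) := fun k => by
    refine (hc (k + n)).trans ?_
    rw [pow_add, mul_assoc, mul_comm (r ^ k), mul_div_assoc]
    gcongr
    exact Nat.le_add_right k n
  refine ⟨fun z => ∑' k, c (k + n) * z ^ k, ?_, ?_, fun z => ?_⟩
  · exact continuous_iff_continuousAt.2 fun z =>
      (hasDerivAt_tsum_of_exp_bound hr hb z).continuousAt
  · refine (tsum_eq_single 0 fun k hk => by rw [zero_pow hk, mul_zero]).trans ?_
    simp
  · have hsum := (summable_norm_of_exp_bound hc z).of_norm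
    rw [← hsum.sum_add_tsum_nat_add n, Finset.sum_eq_zero fun k hk => by
      rw [h0 k (Finset.mem_range.1 hk), zero_mul], zero_add, ← tsum_mul_left]
    refine tsum_congr fun k => ?_
    ring

theorem isBigO_of_exp_bound {c : ℕ → ℂ} {A r : ℝ} (hr : 0 ≤ r)
    (hc : ∀ k, ‖c k‖ ≤ A * (r ^ k / k.factorial)) {n : ℕ} (h0 : ∀ k < n, c k = 0) :
    (fun z => ∑' k, c k * z ^ k) =O[𝓝 0] fun z : ℂ => z ^ n := by
  obtain ⟨q, hq, -, h⟩ := exists_factor_of_exp_bound hr hc h0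
  simp only [h]
  simpa using (Asymptotics.isBigO_refl (fun z : ℂ => z ^ n) (𝓝 0)).mul
    (hq.continuousAt (x := 0).norm.isBoundedUnder_le.isBigO_one ℂ)

/-- Strong induction: after division by xᵏ the series tends to c k, while the growth bound forces
the limit 0. Growth along the real axis is enough, and it is there that an entire factor of f is
compared with the series. -/
theorem coeff_eq_zero_of_isBigO {c : ℕ → ℂ} {A r : ℝ} (hr : 0 ≤ r)
    (hc : ∀ k, ‖c k‖ ≤ A * (r ^ k / k.factorial)) {n : ℕ}
    (h : (fun x : ℝ => ∑' k, c k * (x : ℂ) ^ k) =O[𝓝 0] fun x : ℝ => (x : ℂ) ^ n) :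
    ∀ k < n, c k = 0 := by
  intro k
  induction k using Nat.strong_induction_on with
  | _ k ih =>
    intro hk
    obtain ⟨q, hq, hq0, hf⟩ := exists_factor_of_exp_bound hr hc fun j hj => ih j hj (hj.trans hk)
    simp only [hf] at h
    have hq1 : Tendsto (fun x : ℝ => q x) (𝓝[≠] 0) (𝓝 (c k)) := by
      have h1 : Continuous fun x : ℝ => q x := hq.comp Complex.continuous_ofReal
      have h2 := (h1.tendsto 0).mono_left (nhdsWithin_le_nhds (s := {(0 : ℝ)}ᶜ))
      rwa [Complex.ofReal_zero, hq0] at h2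
    refine tendsto_nhds_unique hq1 ?_
    obtain ⟨C, hC⟩ := h.bound
    have h3 : Tendsto (fun x : ℝ => C * |x| ^ (n - k)) (𝓝[≠] 0) (𝓝 0) := by
      have h4 : Continuous fun x : ℝ => C * |x| ^ (n - k) := by fun_prop
      have h5 := (h4.tendsto 0).mono_left (nhdsWithin_le_nhds (s := {(0 : ℝ)}ᶜ))
      rwa [abs_zero, zero_pow (Nat.sub_ne_zero_of_lt hk), mul_zero] at h5
    refine squeeze_zero_norm' ?_ h3
    filter_upwards [self_mem_nhdsWithin, nhdsWithin_le_nhds hC] with x hx hxC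
    have hx0 : 0 < |x| := abs_pos.2 hx
    rw [norm_mul, norm_pow, norm_pow, Complex.norm_real, Real.norm_eq_abs,
      ← Nat.add_sub_cancel' hk.le, pow_add] at hxC
    have h6 := pow_pos hx0 k
    refine le_of_mul_le_mul_left ?_ h6
    linarith

end PowerSeries

/-! ### Taylor coefficients of the entire factor, and the spaces H^{(s,n)}. -/

section Evaluation

variable {s : ℂ}

/-- The Taylor coefficients of `entireZ s / √(2π)`. -/
def reproCoeff (s : ℂ) (k : ℕ) : ℂ :=
  Complex.Gamma (1 + conj s) / Complex.Gamma (1 + 2 * (s.re : ℂ)) *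
    kummerCoeff (1 + conj s) (1 + 2 * s.re : ℝ) k * Complex.I ^ k /
    (Real.sqrt (2 * Real.pi) : ℂ)

theorem sqrt_two_pi_ne_zero : (Real.sqrt (2 * Real.pi) : ℂ) ≠ 0 := by
  exact_mod_cast (Real.sqrt_pos.2 (by positivity)).ne'

/-- Because Re (1 + s̄) > 0, no factor of the numerator Pochhammer symbol vanishes. Without this,
vanishing of h to order n would not force orthogonality to all of F^{(s,n)}. -/
theorem reproCoeff_ne_zero (hs : -(1 / 2 : ℝ) < s.re) (k : ℕ) : reproCoeff s k ≠ 0 := by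
  have h1 := Gamma_one_add_conj_ne_zero hs
  have h2 := Gamma_beta_ne_zero hs
  have h3 := kummerCoeff_ne_zero (a := 1 + conj s) (b := ((1 + 2 * s.re : ℝ) : ℂ))
    (by simp; linarith) (by rw [Complex.ofReal_re]; linarith) k
  rw [beta_eq] at h2
  exact div_ne_zero (mul_ne_zero (mul_ne_zero (div_ne_zero h1 (by rwa [beta_eq])) h3)
    (pow_ne_zero _ Complex.I_ne_zero)) sqrt_two_pi_ne_zero

theorem exists_norm_reproCoeff_le (hs : -(1 / 2 : ℝ) < s.re) :
    ∃ A r : ℝ, 0 ≤ r ∧ ∀ k, ‖reproCoeff s k‖ ≤ A * (r ^ k / k.factorial) := by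
  refine ⟨‖Complex.Gamma (1 + conj s) / Complex.Gamma (1 + 2 * (s.re : ℂ)) /
    (Real.sqrt (2 * Real.pi) : ℂ)‖, max 1 (‖1 + conj s‖ / (1 + 2 * s.re)),
    zero_le_one.trans (le_max_left _ _), fun k => ?_⟩
  have h := norm_kummerCoeff_le (1 + conj s) (beta_pos hs) k
  rw [reproCoeff, mul_assoc, mul_div_right_comm, norm_mul, norm_mul, norm_pow, Complex.norm_I,
    one_pow, mul_one]
  gcongr

theorem entireZ_div_eq_tsum (s w : ℂ) :
    entireZ s w / (Real.sqrt (2 * Real.pi) : ℂ) = ∑' k, reproCoeff s k * w ^ k := by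
  rw [entireZ_eq]
  simp only [oneFOne]
  rw [← tsum_mul_left, ← tsum_div_const]
  refine tsum_congr fun k => ?_
  rw [reproCoeff, kummerCoeff, mul_pow]
  ring

variable (hs : -(1 / 2 : ℝ) < s.re)

theorem coeFn_weightedL2 (p : ℂ[X]) : weightedL2 hs p =ᵐ[volume] weighted s p :=
  (memLp_weighted hs p).coeFn_toLp

theorem weightedL2_mem (p : ℂ[X]) : weightedL2 hs p ∈ L2Unit := by
  change ∀ᵐ t : ℝ, t ∉ Icc (0 : ℝ) 1 → weightedL2 hs p t = 0
  filter_upwards [coeFn_weightedL2 hs p] with t h1 ht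
  rw [h1, weighted, indicator_of_notMem ht]

theorem norm_weightedL2_X_pow_le (k : ℕ) : ‖weightedL2 hs (X ^ k)‖ ≤ ‖weightedL2 hs 1‖ := by
  refine Lp.norm_le_norm_of_ae_le ?_
  filter_upwards [coeFn_weightedL2 hs (X ^ k), coeFn_weightedL2 hs 1] with t h1 h2
  rw [h1, h2]
  by_cases ht : t ∈ Icc (0 : ℝ) 1
  · rw [weighted, weighted, indicator_of_mem ht, indicator_of_mem ht, eval_pow, eval_X, eval_one,
      mul_one, norm_mul, norm_pow, Complex.norm_real, Real.norm_of_nonneg ht.1]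
    exact mul_le_of_le_one_right (norm_nonneg _) (pow_le_one₀ ht.1 ht.2)
  · rw [weighted, weighted, indicator_of_notMem ht, indicator_of_notMem ht]

/-- The Taylor coefficients of `z ↦ ⟪evalL2 hs z, g⟫`. -/
def evalCoeff (g : L2) (k : ℕ) : ℂ := reproCoeff s k * ⟪weightedL2 hs (X ^ k), g⟫_ℂ

theorem evalCoeff_eq_zero_iff {g : L2} {k : ℕ} :
    evalCoeff hs g k = 0 ↔ ⟪weightedL2 hs (X ^ k), g⟫_ℂ = 0 := by
  rw [evalCoeff, mul_eq_zero, or_iff_right (reproCoeff_ne_zero hs k)]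

theorem exists_norm_evalCoeff_le (g : L2) :
    ∃ A r : ℝ, 0 ≤ r ∧ ∀ k, ‖evalCoeff hs g k‖ ≤ A * (r ^ k / k.factorial) := by
  obtain ⟨A, r, hr, h⟩ := exists_norm_reproCoeff_le hs
  refine ⟨A * (‖weightedL2 hs 1‖ * ‖g‖), r, hr, fun k => ?_⟩
  rw [evalCoeff, norm_mul, mul_right_comm]
  refine mul_le_mul (h k) ((norm_inner_le_norm _ _).trans ?_) (norm_nonneg _)
    ((norm_nonneg _).trans (h k))
  exact mul_le_mul_of_nonneg_right (norm_weightedL2_X_pow_le hs k) (norm_nonneg _)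

/-- Expand E(tz) in powers of tz and integrate termwise. On [0,1] the powers of t are at most 1, so
one integral bounds all terms. -/
theorem inner_evalL2_eq_tsum (g : L2) (z : ℂ) :
    ⟪evalL2 hs z, g⟫_ℂ = ∑' k, evalCoeff hs g k * z ^ k := by
  obtain ⟨A, r, hr, hb⟩ := exists_norm_reproCoeff_le hs
  have hterm : ∀ k, Integrable fun t => ⟪weightedL2 hs (X ^ k) t, g t⟫_ℂ :=
    fun k => L2.integrable_inner _ _
  have hint : ∀ k, Integrable fun t =>
      reproCoeff s k * z ^ k * ⟪weightedL2 hs (X ^ k) t, g t⟫_ℂ := fun k => (hterm k).const_mul _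
  have hle : ∀ k, ∫ t, ‖⟪weightedL2 hs (X ^ k) t, g t⟫_ℂ‖ ≤
      ∫ t, ‖⟪weightedL2 hs 1 t, g t⟫_ℂ‖ := fun k => by
    refine integral_mono_ae (hterm k).norm (L2.integrable_inner _ _).norm ?_
    filter_upwards [coeFn_weightedL2 hs (X ^ k), coeFn_weightedL2 hs 1] with t h1 h2
    rw [RCLike.inner_apply, RCLike.inner_apply, norm_mul, norm_mul, RCLike.norm_conj,
      RCLike.norm_conj, h1, h2]
    refine mul_le_mul_of_nonneg_left ?_ (norm_nonneg _)
    by_cases ht : t ∈ Icc (0 : ℝ) 1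
    · rw [weighted, weighted, indicator_of_mem ht, indicator_of_mem ht, eval_pow, eval_X,
        eval_one, mul_one, norm_mul, norm_pow, Complex.norm_real, Real.norm_of_nonneg ht.1]
      exact mul_le_of_le_one_right (norm_nonneg _) (pow_le_one₀ ht.1 ht.2)
    · rw [weighted, weighted, indicator_of_notMem ht, indicator_of_notMem ht]
  have hsum : Summable fun k => ∫ t,
      ‖reproCoeff s k * z ^ k * ⟪weightedL2 hs (X ^ k) t, g t⟫_ℂ‖ := by
    refine Summable.of_nonneg_of_le (fun k => integral_nonneg fun t => norm_nonneg _) (fun k => ?_)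
      ((summable_norm_of_exp_bound hb z).mul_right (∫ t, ‖⟪weightedL2 hs 1 t, g t⟫_ℂ‖))
    simp only [norm_mul (reproCoeff s k * z ^ k)]
    rw [integral_const_mul]
    exact mul_le_mul_of_nonneg_left (hle k) (norm_nonneg _)
  have h := (hasSum_integral_of_summable_integral_norm hint hsum).tsum_eq
  have hk : ∀ k, ∫ t, reproCoeff s k * z ^ k * ⟪weightedL2 hs (X ^ k) t, g t⟫_ℂ =
      evalCoeff hs g k * z ^ k := fun k => by
    rw [integral_const_mul, ← L2.inner_def, evalCoeff]
    ring
  simp only [hk] at h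
  rw [h, inner_evalL2]
  refine integral_congr_ae ?_
  filter_upwards [ae_all_iff.2 fun k => coeFn_weightedL2 hs (X ^ k), ae_ne_zero] with t ht h0
  simp only [RCLike.inner_apply, ht]
  by_cases h1 : t ∈ Ioc (0 : ℝ) 1
  · rw [evalFn, indicator_of_mem h1, mul_div_assoc, entireZ_div_eq_tsum, ← tsum_mul_left,
      ← tsum_mul_right]
    refine tsum_congr fun k => ?_
    rw [weighted, indicator_of_mem (Ioc_subset_Icc_self h1), eval_pow, eval_X, map_mul, map_pow,
      conj_ofReal_cpow h1.1, Complex.conj_ofReal]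
    ring
  · have h2 : t ∉ Icc (0 : ℝ) 1 := fun h => h1 ⟨lt_of_le_of_ne h.1 h0.symm, h.2⟩
    simp [evalFn, weighted, indicator_of_notMem h1, indicator_of_notMem h2]

theorem differentiable_inner_evalL2 (g : L2) : Differentiable ℂ fun z => ⟪evalL2 hs z, g⟫_ℂ := by
  obtain ⟨A, r, hr, hb⟩ := exists_norm_evalCoeff_le hs g
  simp only [inner_evalL2_eq_tsum]
  exact fun z => (hasDerivAt_tsum_of_exp_bound hr hb z).differentiableAt

theorem mem_F_orthogonal {n : ℕ} {g : L2} :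
    g ∈ (F hs n)ᗮ ↔ ∀ k < n, ⟪weightedL2 hs (X ^ k), g⟫_ℂ = 0 := by
  constructor
  · intro h k hk
    exact (Submodule.mem_orthogonal _ _).1 h _ (Submodule.subset_span ⟨⟨k, hk⟩, rfl⟩)
  · intro h
    have h1 : F hs n ≤ (ℂ ∙ g)ᗮ := by
      refine Submodule.span_le.2 ?_
      rintro _ ⟨k, rfl⟩
      exact (Submodule.mem_orthogonal_singleton_iff_inner_left).2 (h k k.2)
    refine (Submodule.mem_orthogonal _ _).2 fun u hu => ?_
    exact (Submodule.mem_orthogonal_singleton_iff_inner_left).1 (h1 hu)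

/-- Dividing by ρ identifies any entire factor of U g with z ↦ ⟪`evalL2 hs z`, g⟫ on the real line.
Its order of vanishing at 0 is read off from the Taylor coefficients, that is, from the moments ⟪t^s
t^k, g⟫. -/
theorem mem_H_range_iff {n : ℕ} {f : L2} :
    f ∈ H s (kernelOperator hs).range n ↔
      ∃ g ∈ (F hs n)ᗮ ⊓ L2Unit, unitaryMap hs g = f := by
  constructor
  · rintro ⟨hf, h, hd, he, ho⟩
    obtain ⟨g, hg, rfl⟩ := (mem_range_kernelOperator hs).1 hf
    refine ⟨g, ⟨?_, hg⟩, rfl⟩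
    obtain ⟨A, r, hr, hb⟩ := exists_norm_evalCoeff_le hs g
    have h1 : (fun x : ℝ => ⟪evalL2 hs x, g⟫_ℂ) =ᵐ[volume] fun x : ℝ => h x := by
      filter_upwards [unitaryMap_ae_eq hs hg, he, ae_ne_zero] with x h2 h3 h0
      have hρ : (rho s x : ℂ) ≠ 0 := by exact_mod_cast (rho_pos s h0).ne'
      exact mul_left_cancel₀ hρ (h2.symm.trans h3)
    -- Equality almost everywhere of continuous functions is equality everywhere, in particular near
    -- the origin.
    have h2 := ((Continuous.ae_eq_iff_eq _
      ((differentiable_inner_evalL2 hs g).continuous.comp Complex.continuous_ofReal)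
      (hd.continuous.comp Complex.continuous_ofReal)).1 h1)
    have h3 : (fun x : ℝ => h x) =O[𝓝 0] fun x : ℝ => (x : ℂ) ^ n :=
      ho.comp_tendsto (k := fun x : ℝ => (x : ℂ))
        (by simpa using Complex.continuous_ofReal.tendsto 0)
    refine (mem_F_orthogonal hs).2 ?_
    intro k hk
    rw [← evalCoeff_eq_zero_iff]
    refine coeff_eq_zero_of_isBigO hr hb ?_ k hk
    refine h3.congr_left fun x => ?_
    rw [← inner_evalL2_eq_tsum]
    exact (congrFun h2 x).symm
  · rintro ⟨g, ⟨hF, hg⟩, rfl⟩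
    obtain ⟨A, r, hr, hb⟩ := exists_norm_evalCoeff_le hs g
    refine ⟨(mem_range_kernelOperator hs).2 ⟨g, hg, rfl⟩, fun z => ⟪evalL2 hs z, g⟫_ℂ,
      differentiable_inner_evalL2 hs g, unitaryMap_ae_eq hs hg, ?_⟩
    simp only [inner_evalL2_eq_tsum]
    exact isBigO_of_exp_bound hr hb fun k hk =>
      (evalCoeff_eq_zero_iff hs).2 ((mem_F_orthogonal hs).1 hF k hk)

end Evaluation

/-! ### Orthogonal polynomials and the spaces L^{(s,n)}. -/

section OrthogonalPolynomials

variable {s : ℂ} (hs : -(1 / 2 : ℝ) < s.re)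

/-- The map `p ↦ 𝕀_{[0,1]} tˢ p(t)` as a linear map. -/
def weightedLM : ℂ[X] →ₗ[ℂ] L2 where
  toFun := weightedL2 hs
  map_add' p q := by
    ext1
    filter_upwards [coeFn_weightedL2 hs (p + q), coeFn_weightedL2 hs p, coeFn_weightedL2 hs q,
      Lp.coeFn_add (weightedL2 hs p) (weightedL2 hs q)] with t h1 h2 h3 h4
    rw [h1, h4, Pi.add_apply, h2, h3, weighted, weighted, weighted]
    by_cases ht : t ∈ Icc (0 : ℝ) 1
    · simp only [indicator_of_mem ht, eval_add, mul_add]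
    · simp only [indicator_of_notMem ht, add_zero]
  map_smul' c p := by
    ext1
    filter_upwards [coeFn_weightedL2 hs (c • p), coeFn_weightedL2 hs p,
      Lp.coeFn_smul c (weightedL2 hs p)] with t h1 h2 h3
    rw [h1, RingHom.id_apply, h3, Pi.smul_apply, h2, weighted, weighted]
    by_cases ht : t ∈ Icc (0 : ℝ) 1
    · simp only [indicator_of_mem ht, eval_smul, smul_eq_mul, mul_left_comm]
    · simp only [indicator_of_notMem ht, smul_zero]

theorem weightedLM_apply (p : ℂ[X]) : weightedLM hs p = weightedL2 hs p := rfl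

theorem weightedL2_ne_zero {p : ℂ[X]} (hp : p ≠ 0) : weightedL2 hs p ≠ 0 := by
  intro h
  have h1 : ∀ᵐ t : ℝ, p.eval (t : ℂ) ≠ 0 := by
    have hfin : {t : ℝ | p.eval (t : ℂ) = 0}.Finite := by
      have h2 : {z : ℂ | p.IsRoot z}.Finite := Polynomial.finite_setOfPred_isRoot hp
      exact h2.preimage (f := fun t : ℝ => (t : ℂ)) Complex.ofReal_injective.injOn
    have h3 : {t : ℝ | p.eval (t : ℂ) = 0}ᶜ ∈ ae volume :=
      compl_mem_ae_iff.2 (hfin.measure_zero _)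
    exact h3
  have h4 : ∀ᵐ t : ℝ, t ∉ Ioc (0 : ℝ) 1 := by
    filter_upwards [h1, coeFn_weightedL2 hs p, (Lp.eq_zero_iff_ae_eq_zero).1 h] with t h5 h6 h7 ht
    rw [h7, weighted, indicator_of_mem (Ioc_subset_Icc_self ht), Pi.zero_apply] at h6
    have h8 : (t : ℂ) ^ s ≠ 0 := by
      rw [Complex.cpow_ne_zero_iff]
      exact Or.inl (by exact_mod_cast ht.1.ne')
    exact mul_ne_zero h8 h5 h6.symm
  have h5 := measure_eq_zero_iff_ae_notMem.2 h4
  rw [Real.volume_Ioc] at h5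
  norm_num at h5

theorem F_eq_map (n : ℕ) : F hs n = (degreeLT ℂ n).map (weightedLM hs) := by
  rw [degreeLT_eq_span_X_pow, Submodule.map_span, F]
  congr 1
  ext f
  simp only [mem_range, mem_image, Finset.coe_image, Finset.coe_range, mem_Iio,
    exists_exists_and_eq_and]
  exact ⟨fun ⟨k, hk⟩ => ⟨k, k.2, hk⟩, fun ⟨k, hk, h⟩ => ⟨⟨k, hk⟩, h⟩⟩

variable {n : ℕ} {q : ℂ[X]}

theorem weightedL2_mem_F_succ (hq : q.degree = n) : weightedL2 hs q ∈ F hs (n + 1) := by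
  rw [F_eq_map]
  refine ⟨q, mem_degreeLT.2 ?_, rfl⟩
  rw [hq]
  exact_mod_cast n.lt_succ_self

/-- Subtracting a multiple of q cancels the coefficient of tⁿ and leaves a polynomial of degree
below n. -/
theorem F_succ_le (hq : q.degree = n) : F hs (n + 1) ≤ F hs n ⊔ ℂ ∙ weightedL2 hs q := by
  rw [F_eq_map, F_eq_map]
  rintro _ ⟨r, hr, rfl⟩
  have hr' : r.degree < (n + 1 : ℕ) := mem_degreeLT.1 hr
  have hqn : q.coeff n ≠ 0 := coeff_ne_zero_of_eq_degree hq
  refine Submodule.mem_sup.2 ⟨_, ⟨r - (r.coeff n / q.coeff n) • q, ?_, rfl⟩, _,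
    Submodule.mem_span_singleton.2 ⟨r.coeff n / q.coeff n, rfl⟩, ?_⟩
  · refine mem_degreeLT.2 ((degree_lt_iff_coeff_zero _ _).2 fun m hm => ?_)
    rw [coeff_sub, coeff_smul, smul_eq_mul]
    rcases hm.eq_or_lt with rfl | hm
    · rw [div_mul_cancel₀ _ hqn, sub_self]
    · rw [(degree_lt_iff_coeff_zero _ _).1 hr' m hm,
        coeff_eq_zero_of_degree_lt (p := q) (n := m) (by rw [hq]; exact_mod_cast hm), mul_zero, sub_zero]
  · rw [map_sub, map_smul, weightedLM_apply, weightedLM_apply, sub_add_cancel]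

/-- Pulled back by the unitary map, H^{(s,n)} and H^{(s,n+1)} differ exactly by orthogonality to p,
as F^{(s,n+1)} is F^{(s,n)} together with p. -/
theorem L_range_eq_span (hq : q.degree = n) (h : weightedL2 hs q ∈ (F hs n)ᗮ) :
    L s (kernelOperator hs).range n = ℂ ∙ unitaryMap hs (weightedL2 hs q) := by
  set p := weightedL2 hs q with hp
  have hpn : p ∈ (F hs n)ᗮ ⊓ L2Unit := ⟨h, weightedL2_mem hs q⟩
  have horth : ∀ g ∈ (F hs (n + 1))ᗮ, ⟪g, p⟫_ℂ = 0 := fun g hg =>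
    (Submodule.mem_orthogonal' _ _).1 hg p (weightedL2_mem_F_succ hs hq)
  refine le_antisymm ?_ ?_
  · rintro f ⟨hf, hf'⟩
    obtain ⟨g, hg, rfl⟩ := (mem_H_range_iff hs).1 hf
    -- The remainder g' of g along p is orthogonal to p, hence belongs to H^{(s,n+1)} after
    -- transport. It is then orthogonal to g as well, hence to itself, and vanishes.
    have hg0 : g - (⟪p, g⟫_ℂ / ⟪p, p⟫_ℂ) • p ∈ (F hs n)ᗮ ⊓ L2Unit :=
      Submodule.sub_mem _ hg (Submodule.smul_mem _ _ hpn)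
    set g' := g - (⟪p, g⟫_ℂ / ⟪p, p⟫_ℂ) • p with hg'
    have hpg : ⟪p, g'⟫_ℂ = 0 := by
      rw [hg', inner_sub_right, inner_smul_right]
      by_cases h0 : ⟪p, p⟫_ℂ = 0
      · rw [inner_self_eq_zero.1 h0]; simp
      · rw [div_mul_cancel₀ _ h0, sub_self]
    have hg1 : g' ∈ (F hs (n + 1))ᗮ := by
      refine (Submodule.mem_orthogonal _ _).2 fun u hu => ?_
      obtain ⟨v, hv, w, hw, rfl⟩ := Submodule.mem_sup.1 (F_succ_le hs hq hu)
      obtain ⟨c, rfl⟩ := Submodule.mem_span_singleton.1 hw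
      rw [inner_add_left, inner_smul_left, hpg, (Submodule.mem_orthogonal _ _).1 hg0.1 v hv,
        mul_zero, add_zero]
    have h1 : ⟪g', g⟫_ℂ = 0 := by
      rw [← LinearIsometryEquiv.inner_map_map (unitaryMap hs)]
      exact (Submodule.mem_orthogonal _ _).1 hf' _
        ((mem_H_range_iff hs).2 ⟨g', ⟨hg1, hg0.2⟩, rfl⟩)
    have h2 : ⟪g', g'⟫_ℂ = 0 := by
      nth_rewrite 2 [hg']
      rw [inner_sub_right, inner_smul_right, h1, horth g' hg1, mul_zero, sub_zero]
    have h3 : g = (⟪p, g⟫_ℂ / ⟪p, p⟫_ℂ) • p := sub_eq_zero.1 (inner_self_eq_zero.1 h2)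
    exact Submodule.mem_span_singleton.2 ⟨⟪p, g⟫_ℂ / ⟪p, p⟫_ℂ, by rw [← map_smul, ← h3]⟩
  · rw [Submodule.span_singleton_le_iff_mem]
    refine ⟨(mem_H_range_iff hs).2 ⟨p, hpn, rfl⟩, (Submodule.mem_orthogonal _ _).2 fun f hf => ?_⟩
    obtain ⟨g, hg, rfl⟩ := (mem_H_range_iff hs).1 hf
    rw [LinearIsometryEquiv.inner_map_map]
    exact horth g hg.1

/-- One Gram–Schmidt step on tⁿ. The dimension count therefore does not depend on a given orthogonal
sequence. -/
theorem exists_orthogonal_of_degree_eq (n : ℕ) :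
    ∃ q : ℂ[X], q.degree = n ∧ weightedL2 hs q ∈ (F hs n)ᗮ := by
  have : FiniteDimensional ℂ (F hs n) := FiniteDimensional.span_of_finite ℂ (finite_range _)
  have h1 : (F hs n).starProjection (weightedL2 hs (X ^ n)) ∈ F hs n :=
    Submodule.starProjection_apply_mem _ _
  have h2 : weightedL2 hs (X ^ n) - (F hs n).starProjection (weightedL2 hs (X ^ n)) ∈
      (F hs n)ᗮ := Submodule.sub_starProjection_mem_orthogonal _
  obtain ⟨r, hr, hr'⟩ := (F_eq_map hs n).le h1
  refine ⟨X ^ n - r, ?_, ?_⟩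
  · rw [degree_sub_eq_left_of_degree_lt, degree_X_pow]
    rw [degree_X_pow]
    exact mem_degreeLT.1 hr
  · rw [← weightedLM_apply, map_sub, hr']
    exact h2

theorem finrank_L_range (n : ℕ) :
    Module.finrank ℂ (L s (kernelOperator hs).range n) = 1 := by
  obtain ⟨q, hq, hq'⟩ := exists_orthogonal_of_degree_eq hs n
  rw [L_range_eq_span hs hq hq', finrank_span_singleton]
  rw [Ne, LinearIsometryEquiv.map_eq_zero_iff]
  refine weightedL2_ne_zero hs fun h => ?_
  rw [h, degree_zero] at hq
  exact absurd hq (by simp)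

theorem inner_weightedL2_map (p q : ℝ[X]) :
    ⟪weightedL2 hs (p.map (algebraMap ℝ ℂ)), weightedL2 hs (q.map (algebraMap ℝ ℂ))⟫_ℂ =
      ((∫ t in (0 : ℝ)..1, t ^ (2 * s.re) * (p.eval t * q.eval t) : ℝ) : ℂ) := by
  rw [← intervalIntegral.integral_ofReal, intervalIntegral.integral_of_le zero_le_one,
    L2.inner_def, ← integral_indicator measurableSet_Ioc]
  refine integral_congr_ae ?_
  filter_upwards [coeFn_weightedL2 hs (p.map (algebraMap ℝ ℂ)),
    coeFn_weightedL2 hs (q.map (algebraMap ℝ ℂ)), ae_ne_zero] with t h1 h2 h0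
  rw [h1, h2, RCLike.inner_apply]
  have he : ∀ r : ℝ[X], (r.map (algebraMap ℝ ℂ)).eval (t : ℂ) = ((r.eval t : ℝ) : ℂ) := fun r => by
    rw [eval_map]
    exact (Polynomial.hom_eval₂ r (RingHom.id ℝ) (algebraMap ℝ ℂ) t).symm
  by_cases ht : t ∈ Ioc (0 : ℝ) 1
  · have hp : conj ((t : ℂ) ^ s) * (t : ℂ) ^ s = ((t ^ (2 * s.re) : ℝ) : ℂ) := by
      rw [conj_ofReal_cpow ht.1, ← Complex.cpow_add _ _ (by exact_mod_cast ht.1.ne'), add_comm,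
        Complex.add_conj, Complex.ofReal_cpow ht.1.le]
    rw [weighted, weighted, indicator_of_mem (Ioc_subset_Icc_self ht),
      indicator_of_mem (Ioc_subset_Icc_self ht), indicator_of_mem ht, he, he, map_mul,
      Complex.conj_ofReal]
    push_cast
    rw [← hp]
    ring
  · have ht' : t ∉ Icc (0 : ℝ) 1 := fun h => ht ⟨lt_of_le_of_ne h.1 h0.symm, h.2⟩
    simp [weighted, indicator_of_notMem ht, indicator_of_notMem ht']

/-- Adjoining P m enlarges F^{(s,m)} to F^{(s,m+1)}, so by induction orthogonality to P 0, …, P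
(n-1) is orthogonality to F^{(s,n)}. -/
theorem IsOrthogonalPolynomials.weightedL2_mem_orthogonal {P : ℕ → ℝ[X]}
    (hP : IsOrthogonalPolynomials (2 * s.re) P) (n : ℕ) :
    weightedL2 hs ((P n).map (algebraMap ℝ ℂ)) ∈ (F hs n)ᗮ := by
  have h : ∀ m ≤ n, weightedL2 hs ((P n).map (algebraMap ℝ ℂ)) ∈ (F hs m)ᗮ := by
    intro m
    induction m with
    | zero =>
      intro _
      have h0 : F hs 0 = ⊥ := by simp [F]
      rw [h0, Submodule.bot_orthogonal_eq_top]
      trivial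
    | succ m ih =>
      intro hm
      have hd : ((P m).map (algebraMap ℝ ℂ)).degree = m := by rw [degree_map, hP.1]
      refine (Submodule.mem_orthogonal _ _).2 fun u hu => ?_
      obtain ⟨v, hv, w, hw, rfl⟩ := Submodule.mem_sup.1 (F_succ_le hs hd hu)
      obtain ⟨c, rfl⟩ := Submodule.mem_span_singleton.1 hw
      rw [inner_add_left, inner_smul_left, inner_weightedL2_map,
        hP.2 m n (Nat.lt_of_succ_le hm).ne,
        (Submodule.mem_orthogonal _ _).1 (ih (Nat.le_of_succ_le hm)) v hv]
      simp
  exact h n le_rfl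

end OrthogonalPolynomials

end ConfluentPW

end

/-- `K` is the operator with the confluent hypergeometric kernel, so that `LinearMap.range K` is
`𝒫𝒲_s`, and `T` is the unitary operator `𝒯_s`; each of them is determined by the first,
respectively second, clause. -/
theorem corollary2 (s : ℂ) (hs : -(1 / 2 : ℝ) < s.re) :
    ∃ K T : ConfluentPW.L2 →L[ℂ] ConfluentPW.L2,
      ConfluentPW.IsIntegralOperator (ConfluentPW.kernel s) K ∧
      ConfluentPW.ExtendsTransform s T ∧
      T ∈ unitary (ConfluentPW.L2 →L[ℂ] ConfluentPW.L2) ∧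
      (∀ f ∈ K.range, ∃ h : ℂ → ℂ, Differentiable ℂ h ∧
        ∀ᵐ x : ℝ, f x = (ConfluentPW.rho s x : ℂ) * h (x : ℂ)) ∧
      K.range = ConfluentPW.H s K.range 0 ∧
      (∀ n : ℕ, ConfluentPW.H s K.range n =
        ((ConfluentPW.F hs n)ᗮ ⊓ ConfluentPW.L2Unit).map
          (ConfluentPW.psiStar s ∘ₗ (ContinuousLinearMap.adjoint T).toLinearMap)) ∧
      (∀ n : ℕ, Module.finrank ℂ (ConfluentPW.L s K.range n) = 1) ∧
      (∀ P : ℕ → ℝ[X], ConfluentPW.IsOrthogonalPolynomials (2 * s.re) P → ∀ n : ℕ,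
        ConfluentPW.L s K.range n =
          Submodule.span ℂ {ConfluentPW.psiStar s (ContinuousLinearMap.adjoint T
            (ConfluentPW.weightedL2 hs ((P n).map (algebraMap ℝ ℂ))))}) := by
  refine ⟨ConfluentPW.kernelOperator hs, ConfluentPW.transform hs,
    ConfluentPW.isIntegralOperator_kernelOperator hs, ConfluentPW.transform_extends hs,
    ConfluentPW.transform_mem_unitary hs, ?_, ?_, fun n => ?_,
    ConfluentPW.finrank_L_range hs, fun P hP n => ?_⟩
  · intro f hf
    obtain ⟨g, hg, rfl⟩ := (ConfluentPW.mem_range_kernelOperator hs).1 hf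
    exact ⟨_, ConfluentPW.differentiable_inner_evalL2 hs g, ConfluentPW.unitaryMap_ae_eq hs hg⟩
  · refine le_antisymm (fun f hf => ?_) fun f hf => hf.1
    obtain ⟨g, hg, rfl⟩ := (ConfluentPW.mem_range_kernelOperator hs).1 hf
    -- For n = 0 there are no moment conditions, so every g in L₂[0,1] qualifies.
    refine (ConfluentPW.mem_H_range_iff hs).2 ⟨g, ⟨?_, hg⟩, rfl⟩
    exact (ConfluentPW.mem_F_orthogonal hs).2 fun k hk => absurd hk k.not_lt_zero
  · ext f
    exact ConfluentPW.mem_H_range_iff hs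
  · refine ConfluentPW.L_range_eq_span hs ?_ (hP.weightedL2_mem_orthogonal hs n)
    rw [Polynomial.degree_map, hP.1]
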